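/- **Setting.** Let $N\ge 2$, let $\Omega\subset\mathbb R^N$ be open and bounded, and let $X=\{X_1,\dots,X_m\}$ be locally Lipschitz vector fields on $\mathbb R^N$; for a $C^1$ function $u$ write $Xu=(X_1u,\dots,X_mu)$. Let $Y$ be either $\Omega$ or $\mathbb R^N$, and let $P$ be either $Y$ or $\mathbb R^N$. An absolutely continuous path $\gamma:[0,T]\to P$ is *$X$-subunit* if for almost every $t$ there is $\theta\in\mathbb R^m$ with $\sum_j\theta_j^2\le 1$ and $\dot\gamma(t)=\sum_{j}\theta_jX_j(\gamma(t))$. Assume that any two points of $Y$ are joined by such a path, let $d_X(x,y)$ be the infimum of all $T>0$ for which there is an $X$-subunit path $\gamma:[0,T]\to P$ with $\gamma(0)=x$, $\gamma(T)=y$, and put $B_r(x)=\{y\in Y: d_X(x,y)<r\}$ for $x\in Y$, $r>0$. Assume that * for every $x\in Y$, $d_X(x,y)\to0$ as $|y-x|\to0$, $y\in Y$; * there is $Q>2$ with $0<|B_{2r}(x)|\le 2^Q|B_r(x)|$ for all $x\in Y$, $r>0$, where $|\cdot|$ is Lebesgue measure; * there are $C_P,\nu>0$ such that for all $x\in Y$,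 $r>0$ and all $u\in C^1_c(\mathbb R^N)$ $$⨍_{B_r(x)}\Big|u-⨍_{B_r(x)}u\Big|\,dy\le C_P\,r\,⨍_{B_{\nu r}(x)}|Xu|\,dy ,$$ where $⨍$ denotes the average. Let $W^{1,2}_0(\Omega,X)$ be the closure of $C_c^\infty(\Omega)$ under the norm $\|Xu\|_{L^2(\Omega)}$, realised as the set of $u\in L^2(\Omega)$ for which there are $\varphi_n\in C_c^\infty(\Omega)$ with $\varphi_n\to u$ in $L^2(\Omega)$ and $X\varphi_n$ convergent in $L^2(\Omega)^m$; the limit of $X\varphi_n$ is the $X$-gradient $Xu$ of $u$. **Theorem 4.2.** Let $p\in(Q/2,\infty]$ and $\alpha>0$. There is a constant $C$, depending only on $\Omega,Q,p,\alpha$ and on the fixed geometric data $X,Y,P$, such that the following holds. Let $\beta>\alpha$, let $A$ be a measurable $m\times m$ matrix field on $\Omega$ (not necessarily symmetric) with $$\alpha|\eta|^2\le A(x)\eta\cdot\eta\le\beta|\eta|^2\qquad\text{for all }\eta\in\mathbb R^m\text{ and a.e. }x\in\Omega,$$ let $f\in L^p(\Omega)$, and let $u\in W^{1,2}_0(\Omega,X)$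 be a weak solution of $X^*(A(x)Xu)=f$ in $\Omega$, $u=0$ on $\partial\Omega$, that is, $A\,Xu\cdot Xv$ is integrable and $$\int_\Omega A(x)Xu\cdot Xv\,dx=\int_\Omega f\,v\,dx\qquad\text{for all }v\in W^{1,2}_0(\Omega,X).$$ Then $u\in L^\infty(\Omega)$ and $\|u\|_{L^\infty(\Omega)}\le C\,\|f\|_{L^p(\Omega)}$. -/

import Mathlib

open MeasureTheory Set Filter
open scoped Topology ENNReal NNReal ContDiff Matrix

noncomputable section

/-- Absolutely continuous paths `γ : [0, T] → P` with `γ' = ∑ θⱼ Xⱼ(γ)` and `∑ θⱼ² ≤ 1`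
almost everywhere on `[0, T]` (the values of `γ` outside `[0, T]` are irrelevant). -/
def IsSubunitPath {N m : ℕ} (X : Fin m → EuclideanSpace ℝ (Fin N) → EuclideanSpace ℝ (Fin N))
    (P : Set (EuclideanSpace ℝ (Fin N))) (T : ℝ) (γ : ℝ → EuclideanSpace ℝ (Fin N)) : Prop :=
  AbsolutelyContinuousOnInterval γ 0 T ∧ (∀ t ∈ Icc 0 T, γ t ∈ P) ∧
    ∀ᵐ t ∂(volume.restrict (Icc 0 T)), ∃ θ : Fin m → ℝ,
      ∑ j, θ j ^ 2 ≤ 1 ∧ HasDerivAt γ (∑ j, θ j • X j (γ t)) t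

/-- The times `T > 0` in which `y` can be reached from `x` along a subunit path inside `P`. -/
def subunitTimes {N m : ℕ} (X : Fin m → EuclideanSpace ℝ (Fin N) → EuclideanSpace ℝ (Fin N))
    (P : Set (EuclideanSpace ℝ (Fin N))) (x y : EuclideanSpace ℝ (Fin N)) : Set ℝ :=
  {T | 0 < T ∧ ∃ γ, IsSubunitPath X P T γ ∧ γ 0 = x ∧ γ T = y}

/-- Any two points of `Y` are joined by a subunit path inside `P`. -/
def IsXConnected {N m : ℕ} (X : Fin m → EuclideanSpace ℝ (Fin N) → EuclideanSpace ℝ (Fin N))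
    (P Y : Set (EuclideanSpace ℝ (Fin N))) : Prop :=
  ∀ x ∈ Y, ∀ y ∈ Y, (subunitTimes X P x y).Nonempty

/-- The control (Carnot-Carathéodory) distance computed with subunit paths inside `P`. It is only
used for pairs of points that are joined by such a path. -/
def ccDist {N m : ℕ} (X : Fin m → EuclideanSpace ℝ (Fin N) → EuclideanSpace ℝ (Fin N))
    (P : Set (EuclideanSpace ℝ (Fin N))) (x y : EuclideanSpace ℝ (Fin N)) : ℝ :=
  sInf (subunitTimes X P x y)

/-- Open balls of the metric space `(Y, ccDist X P)`. -/
def ccBall {N m : ℕ} (X : Fin m → EuclideanSpace ℝ (Fin N) → EuclideanSpace ℝ (Fin N))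
    (P Y : Set (EuclideanSpace ℝ (Fin N))) (x : EuclideanSpace ℝ (Fin N)) (r : ℝ) :
    Set (EuclideanSpace ℝ (Fin N)) :=
  {y ∈ Y | ccDist X P x y < r}

/-- `|y - x| → 0` implies `d_X(x, y) → 0`, in `Y`. -/
def IsEuclideanCompatible {N m : ℕ}
    (X : Fin m → EuclideanSpace ℝ (Fin N) → EuclideanSpace ℝ (Fin N))
    (P Y : Set (EuclideanSpace ℝ (Fin N))) : Prop :=
  ∀ x ∈ Y, Tendsto (fun y => ccDist X P x y) (𝓝[Y] x) (𝓝 0)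

/-- `(Y, d_X, Lebesgue measure)` is a doubling space with exponent `Q`. -/
def IsDoublingSpace {N m : ℕ}
    (X : Fin m → EuclideanSpace ℝ (Fin N) → EuclideanSpace ℝ (Fin N))
    (P Y : Set (EuclideanSpace ℝ (Fin N))) (Q : ℝ) : Prop :=
  ∀ x ∈ Y, ∀ r : ℝ, 0 < r →
    0 < volume (ccBall X P Y x (2 * r)) ∧
    volume (ccBall X P Y x (2 * r)) ≤ ENNReal.ofReal (2 ^ Q) * volume (ccBall X P Y x r)

/-- The X-gradient `(X₁u, …, Xₘu)` of a `C¹` function. -/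
def xGrad {N m : ℕ} (X : Fin m → EuclideanSpace ℝ (Fin N) → EuclideanSpace ℝ (Fin N))
    (u : EuclideanSpace ℝ (Fin N) → ℝ) (x : EuclideanSpace ℝ (Fin N)) :
    EuclideanSpace ℝ (Fin m) :=
  WithLp.toLp 2 fun j => fderiv ℝ u x (X j x)

/-- The Poincaré inequality on all `d_X`-balls of `Y`. The functions range over restrictions of
compactly supported `C¹` functions on the whole space; on balls with compact closure these are
the same as the restrictions of all `C¹` functions. -/
def HasPoincareInequality {N m : ℕ}
    (X : Fin m → EuclideanSpace ℝ (Fin N) → EuclideanSpace ℝ (Fin N))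
    (P Y : Set (EuclideanSpace ℝ (Fin N))) : Prop :=
  ∃ CP ν : ℝ, 0 < CP ∧ 0 < ν ∧
    ∀ x ∈ Y, ∀ r : ℝ, 0 < r → ∀ u : EuclideanSpace ℝ (Fin N) → ℝ,
      ContDiff ℝ 1 u → HasCompactSupport u →
      ⨍ y in ccBall X P Y x r, |u y - ⨍ z in ccBall X P Y x r, u z| ≤
        CP * r * ⨍ y in ccBall X P Y x (ν * r), ‖xGrad X u y‖

/-- `u` belongs to `W₀^{1,2}(Ω, X)`, the closure of `C_c^∞(Ω)`, and its X-gradient is `G`: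
there are `φₙ ∈ C_c^∞(Ω)` with `X φₙ → G` and `φₙ → u` in `L²(Ω)`. -/
def MemW0 {N m : ℕ} (X : Fin m → EuclideanSpace ℝ (Fin N) → EuclideanSpace ℝ (Fin N))
    (Ω : Set (EuclideanSpace ℝ (Fin N))) (u : EuclideanSpace ℝ (Fin N) → ℝ)
    (G : EuclideanSpace ℝ (Fin N) → EuclideanSpace ℝ (Fin m)) : Prop :=
  MemLp u 2 (volume.restrict Ω) ∧ MemLp G 2 (volume.restrict Ω) ∧
    ∃ φ : ℕ → EuclideanSpace ℝ (Fin N) → ℝ,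
      (∀ n, ContDiff ℝ ∞ (φ n) ∧ HasCompactSupport (φ n) ∧ tsupport (φ n) ⊆ Ω) ∧
      Tendsto (fun n => eLpNorm (fun x => φ n x - u x) 2 (volume.restrict Ω)) atTop (𝓝 0) ∧
      Tendsto (fun n => eLpNorm (fun x => xGrad X (φ n) x - G x) 2 (volume.restrict Ω))
        atTop (𝓝 0)

/-- Measurable matrix fields with `α |η|² ≤ A(x) η · η ≤ β |η|²` for all `η`, for almost every
`x ∈ Ω`. The matrices need not be symmetric. -/
def IsEllipticMatrix {N m : ℕ} (Ω : Set (EuclideanSpace ℝ (Fin N)))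
    (A : EuclideanSpace ℝ (Fin N) → Matrix (Fin m) (Fin m) ℝ) (α β : ℝ) : Prop :=
  (∀ i j, AEMeasurable (fun x => A x i j) (volume.restrict Ω)) ∧
    ∀ᵐ x ∂(volume.restrict Ω), ∀ η : Fin m → ℝ,
      α * (η ⬝ᵥ η) ≤ (A x *ᵥ η) ⬝ᵥ η ∧ (A x *ᵥ η) ⬝ᵥ η ≤ β * (η ⬝ᵥ η)

/-- `u ∈ W₀^{1,2}(Ω, X)` is a weak solution of `X^*(A X u) = f` in `Ω`, `u = 0` on `∂Ω`:
`∫ A Xu · Xv = ∫ f v` for every `v ∈ W₀^{1,2}(Ω, X)`. -/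
def IsWeakSolution {N m : ℕ} (X : Fin m → EuclideanSpace ℝ (Fin N) → EuclideanSpace ℝ (Fin N))
    (Ω : Set (EuclideanSpace ℝ (Fin N)))
    (A : EuclideanSpace ℝ (Fin N) → Matrix (Fin m) (Fin m) ℝ)
    (f u : EuclideanSpace ℝ (Fin N) → ℝ) : Prop :=
  ∃ G, MemW0 X Ω u G ∧ ∀ v H, MemW0 X Ω v H →
    IntegrableOn (fun x => (A x *ᵥ (G x).ofLp) ⬝ᵥ (H x).ofLp) Ω ∧
    ∫ x in Ω, (A x *ᵥ (G x).ofLp) ⬝ᵥ (H x).ofLp = ∫ x in Ω, f x * v x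

end

/-! The proof is Stampacchia's truncation method, fed by a weak-type Sobolev inequality. Testing the
equation with a smooth truncation of `u` that vanishes on `{|u| ≤ k}` and equals `±1` on `{|u| ≥ h}`
bounds its energy by `‖f‖_p / (h - k)` times a power of `|{|u| > k}|`
(`IsWeakSolution.exists_memW0_smoothTrunc`). Weak Sobolev with exponent `q` turns this into `|{|u| >
h}| ≤ C (‖f‖_p / (h - k)) ^ q |{|u| > k}| ^ b` with `b = q (1 - 1/p)`. The condition `p > Q/2`
leaves room for a `q` with `b > 1` and `q (Q - 2) < Q` (`exists_sobolev_exponent`), and the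
iteration lemma `eq_zero_of_stampacchia` then makes the superlevel set null at a height proportional
to `‖f‖_p`.

The Sobolev inequality (`IsDoublingBallFamily.weak_sobolev`) comes from telescoping averages over
dyadic balls. Poincaré bounds each increment by an average of the gradient. Where `|φ| > t`, one of
these averages must exceed a geometrically growing threshold; Chebyshev and the volume lower bound
from doubling make the measures of these exceptional sets summable.

The telescope also needs its first term, the average at a fixed large scale (`exists_top_scale`). If
`Y` is the whole space, a large ball is at least half outside `Ω`, where `φ = 0`, and Poincaré
suffices. If `Y = Ω`, the space is a single ball and Poincaré alone cannot exclude constants.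
Suppose the average were not controlled by the gradient. Then `1` would be an `L¹(Ω)` limit of test
functions with vanishing `X`-gradients, so the complement of `Ω` would be invariant under the fields
in the distributional sense. A bump carried along a subunit path, with radius shrinking
exponentially, would then see no mass outside `Ω` (`volume_ball_sdiff_eq_zero_of_subunit`). Since
all points of `Ω` are reached in bounded time, each would have a ball of one fixed radius lying in
`Ω` up to a null set, which is impossible for a bounded set. -/

/-! ### Absolutely continuous curves and first hitting times -/

lemma AbsolutelyContinuousOnInterval.lipschitz_comp {E F : Type*} [PseudoMetricSpace E]
    [PseudoMetricSpace F] {f : ℝ → E} {g : E → F} {K : ℝ≥0} {a b : ℝ} (hg : LipschitzWith K g)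
    (hf : AbsolutelyContinuousOnInterval f a b) :
    AbsolutelyContinuousOnInterval (fun t => g (f t)) a b := by
  unfold AbsolutelyContinuousOnInterval at hf ⊢
  refine squeeze_zero (fun E => Finset.sum_nonneg fun i _ => dist_nonneg) (fun E => ?_)
    (by simpa using hf.const_mul (K : ℝ))
  rw [Finset.mul_sum]
  exact Finset.sum_le_sum fun i _ => hg.dist_le_mul _ _

/-- The fundamental theorem of calculus for absolutely continuous functions. With `C = 0` it later
closes a Gronwall argument. -/
lemma AbsolutelyContinuousOnInterval.sub_le_of_deriv_le {f : ℝ → ℝ} {a b C : ℝ} (hab : a ≤ b)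
    (hf : AbsolutelyContinuousOnInterval f a b)
    (h : ∀ᵐ t, t ∈ Icc a b → ∃ f', HasDerivAt f f' t ∧ f' ≤ C) :
    f b - f a ≤ C * (b - a) := by
  rw [← hf.integral_deriv_eq_sub]
  calc ∫ x in a..b, deriv f x ≤ ∫ x in a..b, C := by
        refine intervalIntegral.integral_mono_ae_restrict hab hf.intervalIntegrable_deriv
          intervalIntegrable_const ?_
        rw [EventuallyLE, ae_restrict_iff' measurableSet_Icc]
        filter_upwards [h] with t ht hmem
        obtain ⟨f', h1, h2⟩ := ht hmem
        rwa [h1.deriv]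
    _ = C * (b - a) := by simp [mul_comm]

/-- Pairing the curve with the fixed vector `f t - f s` reduces to the scalar case, and dividing by
the norm of that vector gives the bound. -/
lemma AbsolutelyContinuousOnInterval.lipschitzOnWith_of_deriv_le {E : Type*}
    [NormedAddCommGroup E] [InnerProductSpace ℝ E] {f : ℝ → E} {a b : ℝ} {C : ℝ≥0}
    (hf : AbsolutelyContinuousOnInterval f a b)
    (h : ∀ᵐ t, t ∈ Icc a b → ∃ f', HasDerivAt f f' t ∧ ‖f'‖ ≤ C) :
    LipschitzOnWith C f (Icc a b) := by
  have key : ∀ s ∈ Icc a b, ∀ t ∈ Icc a b, s ≤ t → ‖f t - f s‖ ≤ C * (t - s) := by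
    intro s hs t ht hst
    set e := f t - f s with he
    have hac : AbsolutelyContinuousOnInterval (fun τ => inner ℝ e (f τ)) s t :=
      AbsolutelyContinuousOnInterval.lipschitz_comp (innerSL ℝ e).lipschitz
        (hf.mono (by rw [uIcc_of_le hst, uIcc_of_le (hs.1.trans hs.2)]
                     exact Icc_subset_Icc hs.1 ht.2))
    have h1 := hac.sub_le_of_deriv_le (C := ‖e‖ * C) hst (by
      filter_upwards [h] with τ hτ hmem
      obtain ⟨f', h1, h2⟩ := hτ ⟨hs.1.trans hmem.1, hmem.2.trans ht.2⟩
      refine ⟨inner ℝ e f', (innerSL ℝ e).hasFDerivAt.comp_hasDerivAt τ h1, ?_⟩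
      exact (real_inner_le_norm _ _).trans (by gcongr))
    rw [← inner_sub_right, ← he, real_inner_self_eq_norm_mul_norm] at h1
    rcases (norm_nonneg e).eq_or_lt with h0 | h0
    · rw [← h0]
      exact mul_nonneg C.2 (sub_nonneg.2 hst)
    · exact le_of_mul_le_mul_left (by linarith) h0
  refine LipschitzOnWith.of_dist_le_mul fun s hs t ht => ?_
  rcases le_total s t with hst | hst
  · rw [dist_comm, dist_eq_norm, dist_comm, Real.dist_eq, abs_of_nonneg (sub_nonneg.2 hst)]
    exact key s hs t ht hst
  · rw [dist_eq_norm, Real.dist_eq, abs_of_nonneg (sub_nonneg.2 hst)]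
    exact key t ht s hs hst

lemma abs_le_one_of_sum_sq_le_one {m : ℕ} {θ : Fin m → ℝ} (hθ : ∑ j, θ j ^ 2 ≤ 1) (j : Fin m) :
    |θ j| ≤ 1 := by
  rw [← sq_le_one_iff_abs_le_one]
  exact (Finset.single_le_sum (f := fun j => θ j ^ 2) (fun i _ => sq_nonneg _)
    (Finset.mem_univ j)).trans hθ

lemma norm_sum_smul_le_of_sum_sq_le_one {m : ℕ} {E : Type*} [NormedAddCommGroup E]
    [NormedSpace ℝ E] {θ : Fin m → ℝ} (hθ : ∑ j, θ j ^ 2 ≤ 1) {v : Fin m → E} {M : ℝ}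
    (hv : ∀ j, ‖v j‖ ≤ M) : ‖∑ j, θ j • v j‖ ≤ m * M := by
  calc ‖∑ j, θ j • v j‖ ≤ ∑ j : Fin m, M := by
        refine norm_sum_le_of_le _ fun j _ => ?_
        rw [norm_smul, Real.norm_eq_abs]
        calc |θ j| * ‖v j‖ ≤ 1 * ‖v j‖ := by
              gcongr; exact abs_le_one_of_sum_sq_le_one hθ j
          _ ≤ M := by simpa using hv j
    _ = m * M := by simp

/-- Take the least point of the compact level set: a larger value before it would force an earlier
crossing. This is used to stop paths while they are still in a ball with known bounds on the fields.
-/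
lemma exists_first_hitting {f : ℝ → ℝ} {T c : ℝ} (hT : 0 ≤ T) (hf : ContinuousOn f (Icc 0 T))
    (h0 : f 0 ≤ c) (hc : c ≤ f T) :
    ∃ s ∈ Icc 0 T, f s = c ∧ ∀ t ∈ Icc 0 s, f t ≤ c := by
  have hclosed : IsClosed {t ∈ Icc 0 T | f t = c} :=
    hf.preimage_isClosed_of_isClosed isClosed_Icc isClosed_singleton
  obtain ⟨t, ht, htc⟩ := intermediate_value_Icc hT hf ⟨h0, hc⟩
  obtain ⟨s, ⟨hs, hsc⟩, hmin⟩ := (isCompact_Icc.of_isClosed_subset hclosed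
    (sep_subset _ _)).exists_isLeast ⟨t, ht, htc⟩
  refine ⟨s, hs, hsc, fun t ht => ?_⟩
  by_contra hcon
  obtain ⟨t', ht', htc'⟩ := intermediate_value_Icc ht.1
    (hf.mono (Icc_subset_Icc_right (ht.2.trans hs.2))) ⟨h0, (not_le.1 hcon).le⟩
  have h1 := hmin ⟨⟨ht'.1, ht'.2.trans (ht.2.trans hs.2)⟩, htc'⟩
  have h2 : t = s := le_antisymm ht.2 (h1.trans ht'.2)
  rw [h2, hsc] at hcon
  exact hcon le_rfl

/-! ### Subunit paths and the control distance -/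

section Paths

variable {N m : ℕ} {X : Fin m → EuclideanSpace ℝ (Fin N) → EuclideanSpace ℝ (Fin N)}
  {P Y : Set (EuclideanSpace ℝ (Fin N))} {T : ℝ} {γ : ℝ → EuclideanSpace ℝ (Fin N)}

lemma IsSubunitPath.ae (h : IsSubunitPath X P T γ) : ∀ᵐ t, t ∈ Icc 0 T →
    ∃ θ : Fin m → ℝ, ∑ j, θ j ^ 2 ≤ 1 ∧ HasDerivAt γ (∑ j, θ j • X j (γ t)) t :=
  (ae_restrict_iff' measurableSet_Icc).1 h.2.2

lemma IsSubunitPath.lipschitzOnWith (h : IsSubunitPath X P T γ) {M : ℝ≥0}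
    (hM : ∀ t ∈ Icc 0 T, ∀ j, ‖X j (γ t)‖ ≤ M) : LipschitzOnWith (m * M) γ (Icc 0 T) := by
  refine h.1.lipschitzOnWith_of_deriv_le ?_
  filter_upwards [h.ae] with t ht hmem
  obtain ⟨θ, hθ, hd⟩ := ht hmem
  exact ⟨_, hd, by simpa using norm_sum_smul_le_of_sum_sq_le_one hθ (hM t hmem)⟩

lemma IsSubunitPath.continuousOn (h : IsSubunitPath X P T γ) : ContinuousOn γ (Icc 0 T) :=
  h.1.continuousOn.mono Icc_subset_uIcc

lemma IsSubunitPath.restrict (h : IsSubunitPath X P T γ) {T' : ℝ} (h0 : 0 ≤ T') (hT : T' ≤ T) :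
    IsSubunitPath X P T' γ := by
  refine ⟨h.1.mono ?_, fun t ht => h.2.1 t ⟨ht.1, ht.2.trans hT⟩,
    ae_restrict_of_ae_restrict_of_subset (Icc_subset_Icc_right hT) h.2.2⟩
  rw [uIcc_of_le h0, uIcc_of_le (h0.trans hT)]
  exact Icc_subset_Icc_right hT

lemma IsSubunitPath.exists_lipschitzOnWith (hX : ∀ j, Continuous (X j))
    (h : IsSubunitPath X P T γ) : ∃ K, LipschitzOnWith K γ (Icc 0 T) := by
  have : ∃ M : ℝ≥0, ∀ t ∈ Icc 0 T, ∀ j, ‖X j (γ t)‖ ≤ M := by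
    have h1 : ContinuousOn (fun t => fun j => X j (γ t)) (Icc 0 T) :=
      continuousOn_pi.2 fun j => (hX j).comp_continuousOn h.continuousOn
    obtain ⟨M, hM⟩ := isCompact_Icc.exists_bound_of_continuousOn h1
    exact ⟨M.toNNReal, fun t ht j => ((norm_le_pi_norm _ j).trans (hM t ht)).trans
      (Real.le_coe_toNNReal M)⟩
  obtain ⟨M, hM⟩ := this
  exact ⟨_, h.lipschitzOnWith hM⟩

lemma ae_mem_Ioo_of_mem_Icc (a b : ℝ) : ∀ᵐ t : ℝ, t ∈ Icc a b → t ∈ Ioo a b := by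
  have h1 : ∀ᵐ t : ℝ, t ≠ a := by simp [ae_iff, measure_singleton]
  have h2 : ∀ᵐ t : ℝ, t ≠ b := by simp [ae_iff, measure_singleton]
  filter_upwards [h1, h2] with t ha hb ht
  exact ⟨lt_of_le_of_ne ht.1 ha.symm, lt_of_le_of_ne ht.2 hb⟩

/-- Reversing time replaces `θ` by `-θ`. Absolute continuity is recovered from a Lipschitz bound,
available because the fields are bounded along the compact path; concatenation below works the same
way. -/
lemma IsSubunitPath.reverse (hX : ∀ j, Continuous (X j)) (hT : 0 ≤ T)
    (h : IsSubunitPath X P T γ) : IsSubunitPath X P T (fun t => γ (T - t)) := by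
  obtain ⟨K, hK⟩ := h.exists_lipschitzOnWith hX
  have hmaps : ∀ t ∈ Icc 0 T, T - t ∈ Icc 0 T := fun t ht => ⟨by linarith [ht.2], by linarith [ht.1]⟩
  refine ⟨?_, fun t ht => h.2.1 _ (hmaps t ht), ?_⟩
  · refine LipschitzOnWith.absolutelyContinuousOnInterval (K := K) ?_
    rw [uIcc_of_le hT]
    refine LipschitzOnWith.of_dist_le_mul fun s hs t ht => ?_
    refine (hK.dist_le_mul _ (hmaps s hs) _ (hmaps t ht)).trans_eq ?_
    rw [dist_sub_left]
  · rw [ae_restrict_iff' measurableSet_Icc]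
    have h1 := (Measure.measurePreserving_sub_left volume T).quasiMeasurePreserving.ae h.ae
    filter_upwards [h1] with t ht hmem
    obtain ⟨θ, hθ, hd⟩ := ht (hmaps t hmem)
    refine ⟨-θ, by simpa using hθ, ?_⟩
    have := HasDerivAt.scomp (h := fun t => T - t) t hd ((hasDerivAt_id t).const_sub T)
    simpa [Function.comp_def] using this

lemma IsSubunitPath.trans (hX : ∀ j, Continuous (X j)) {T' : ℝ}
    {γ' : ℝ → EuclideanSpace ℝ (Fin N)} (hT : 0 ≤ T) (hT' : 0 ≤ T')
    (h : IsSubunitPath X P T γ) (h' : IsSubunitPath X P T' γ') (hγ : γ T = γ' 0) :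
    IsSubunitPath X P (T + T') (fun t => if t ≤ T then γ t else γ' (t - T)) := by
  obtain ⟨K, hK⟩ := h.exists_lipschitzOnWith hX
  obtain ⟨K', hK'⟩ := h'.exists_lipschitzOnWith hX
  set Γ := fun t => if t ≤ T then γ t else γ' (t - T) with hΓ
  have e1 : ∀ t ≤ T, Γ t = γ t := fun t ht => by simp [hΓ, ht]
  have e2 : ∀ t, T ≤ t → Γ t = γ' (t - T) := by
    intro t ht
    rcases ht.eq_or_lt with rfl | ht
    · simp [hΓ, hγ]
    · simp [hΓ, not_le.2 ht]
  have key : ∀ s ∈ Icc 0 (T + T'), ∀ t ∈ Icc 0 (T + T'), s ≤ t →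
      dist (Γ s) (Γ t) ≤ (K ⊔ K' : ℝ≥0) * dist s t := by
    intro s hs t ht hst
    have b1 : ∀ s ∈ Icc 0 T, ∀ t ∈ Icc 0 T, dist (Γ s) (Γ t) ≤ (K ⊔ K' : ℝ≥0) * dist s t := by
      intro s hs t ht
      rw [e1 s hs.2, e1 t ht.2]
      refine (hK.dist_le_mul _ hs _ ht).trans ?_
      gcongr
      exact le_sup_left
    have b2 : ∀ s ∈ Icc T (T + T'), ∀ t ∈ Icc T (T + T'),
        dist (Γ s) (Γ t) ≤ (K ⊔ K' : ℝ≥0) * dist s t := by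
      intro s hs t ht
      rw [e2 s hs.1, e2 t ht.1]
      refine (hK'.dist_le_mul _ ⟨by linarith [hs.1], by linarith [hs.2]⟩ _
        ⟨by linarith [ht.1], by linarith [ht.2]⟩).trans ?_
      rw [dist_sub_right]
      gcongr
      exact le_sup_right
    rcases le_total t T with h1 | h1
    · exact b1 s ⟨hs.1, hst.trans h1⟩ t ⟨ht.1, h1⟩
    rcases le_total T s with h2 | h2
    · exact b2 s ⟨h2, hs.2⟩ t ⟨h1, ht.2⟩
    have c1 := b1 s ⟨hs.1, h2⟩ T ⟨hT, le_rfl⟩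
    have c2 := b2 T ⟨le_rfl, by linarith⟩ t ⟨h1, ht.2⟩
    have c3 : dist s t = dist s T + dist T t := by
      simp only [Real.dist_eq]
      rw [abs_of_nonpos (by linarith), abs_of_nonpos (by linarith), abs_of_nonpos (by linarith)]
      ring
    rw [c3, mul_add]
    exact (dist_triangle _ _ _).trans (add_le_add c1 c2)
  refine ⟨?_, fun t ht => ?_, ?_⟩
  · refine LipschitzOnWith.absolutelyContinuousOnInterval (K := K ⊔ K') ?_
    rw [uIcc_of_le (by positivity)]
    refine LipschitzOnWith.of_dist_le_mul fun s hs t ht => ?_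
    rcases le_total s t with hst | hst
    · exact key s hs t ht hst
    · rw [dist_comm, dist_comm s]; exact key t ht s hs hst
  · rcases le_total t T with h1 | h1
    · rw [e1 t h1]; exact h.2.1 t ⟨ht.1, h1⟩
    · rw [e2 t h1]; exact h'.2.1 _ ⟨by linarith, by linarith [ht.2]⟩
  · rw [ae_restrict_iff' measurableSet_Icc]
    have h1 := (measurePreserving_sub_right volume T).quasiMeasurePreserving.ae h'.ae
    have h2 : ∀ᵐ t : ℝ, t ≠ T := by simp [ae_iff, measure_singleton]
    filter_upwards [h1, h2, h.ae] with t ht hne ht' hmem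
    rcases lt_or_gt_of_ne hne with hlt | hlt
    · obtain ⟨θ, hθ, hd⟩ := ht' ⟨hmem.1, hlt.le⟩
      refine ⟨θ, hθ, ?_⟩
      rw [e1 t hlt.le]
      refine hd.congr_of_eventuallyEq ?_
      filter_upwards [Iio_mem_nhds hlt] with s hs using e1 s (le_of_lt hs)
    · obtain ⟨θ, hθ, hd⟩ := ht ⟨by linarith, by linarith [hmem.2]⟩
      refine ⟨θ, hθ, ?_⟩
      rw [e2 t hlt.le]
      refine (hd.comp_sub_const t T).congr_of_eventuallyEq ?_
      filter_upwards [Ioi_mem_nhds hlt] with s hs using e2 s (le_of_lt hs)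

lemma subunitTimes_bddBelow (x y : EuclideanSpace ℝ (Fin N)) : BddBelow (subunitTimes X P x y) :=
  ⟨0, fun _ hT => hT.1.le⟩

lemma subunitTimes_comm (hX : ∀ j, Continuous (X j)) (x y : EuclideanSpace ℝ (Fin N)) :
    subunitTimes X P x y = subunitTimes X P y x := by
  have : ∀ x y, subunitTimes X P x y ⊆ subunitTimes X P y x := by
    rintro x y T ⟨hT, γ, hγ, h0, h1⟩
    exact ⟨hT, _, hγ.reverse hX hT.le, by simpa using h1, by simpa using h0⟩
  exact Subset.antisymm (this x y) (this y x)

lemma ccDist_comm (hX : ∀ j, Continuous (X j)) (x y : EuclideanSpace ℝ (Fin N)) :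
    ccDist X P x y = ccDist X P y x := by
  rw [ccDist, ccDist, subunitTimes_comm hX]

lemma add_mem_subunitTimes (hX : ∀ j, Continuous (X j)) {x y z : EuclideanSpace ℝ (Fin N)}
    {S T : ℝ} (hS : S ∈ subunitTimes X P x y) (hT : T ∈ subunitTimes X P y z) :
    S + T ∈ subunitTimes X P x z := by
  obtain ⟨hS, γ, hγ, h0, h1⟩ := hS
  obtain ⟨hT, γ', hγ', h0', h1'⟩ := hT
  refine ⟨add_pos hS hT, _, hγ.trans hX hS.le hT.le hγ' (h1.trans h0'.symm), ?_, ?_⟩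
  · simpa [hS.le] using h0
  · simpa [not_le.2 hT] using h1'

lemma ccDist_triangle (hX : ∀ j, Continuous (X j)) (hconn : IsXConnected X P Y)
    {x y z : EuclideanSpace ℝ (Fin N)} (hx : x ∈ Y) (hy : y ∈ Y) (hz : z ∈ Y) :
    ccDist X P x z ≤ ccDist X P x y + ccDist X P y z := by
  refine le_of_forall_pos_le_add fun ε hε => ?_
  obtain ⟨S, hS, hS'⟩ := Real.lt_sInf_add_pos (hconn x hx y hy) (half_pos hε)
  obtain ⟨T, hT, hT'⟩ := Real.lt_sInf_add_pos (hconn y hy z hz) (half_pos hε)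
  have := csInf_le (subunitTimes_bddBelow x z) (add_mem_subunitTimes hX hS hT)
  simp only [ccDist] at *
  linarith

lemma exists_path_of_ccDist_lt (hconn : IsXConnected X P Y) {x y : EuclideanSpace ℝ (Fin N)}
    (hx : x ∈ Y) (hy : y ∈ Y) {r : ℝ} (h : ccDist X P x y < r) :
    ∃ T γ, 0 < T ∧ T < r ∧ IsSubunitPath X P T γ ∧ γ 0 = x ∧ γ T = y := by
  obtain ⟨T, ⟨hT, γ, hγ, h0, h1⟩, hlt⟩ := exists_lt_of_csInf_lt (hconn x hx y hy) h
  exact ⟨T, γ, hT, hlt, hγ, h0, h1⟩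

/-- Small control balls are small in the Euclidean sense. -/
lemma exists_ccBall_subset_ball (hX : ∀ j, Continuous (X j)) (hconn : IsXConnected X P Y)
    {x : EuclideanSpace ℝ (Fin N)} (hx : x ∈ Y) {ε : ℝ} (hε : 0 < ε) :
    ∃ r > 0, ccBall X P Y x r ⊆ Metric.ball x ε := by
  have : ∃ M : ℝ≥0, ∀ y ∈ Metric.closedBall x ε, ∀ j, ‖X j y‖ ≤ M := by
    have h1 : Continuous (fun y => fun j => X j y) := continuous_pi fun j => hX j
    obtain ⟨M, hM⟩ := (isCompact_closedBall x ε).exists_bound_of_continuousOn h1.continuousOn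
    exact ⟨M.toNNReal, fun t ht j => ((norm_le_pi_norm _ j).trans (hM t ht)).trans
      (Real.le_coe_toNNReal M)⟩
  obtain ⟨M, hM⟩ := this
  -- Inside the closed ball the speed is at most `m * M`, so distance `ε` cannot be reached in time
  -- `ε / (m * M + 1)`. The `+ 1` covers a vanishing speed bound.
  refine ⟨ε / (m * M + 1), by positivity, ?_⟩
  rintro y ⟨hy, hd⟩
  obtain ⟨T, γ, hT, hTr, hγ, h0, h1⟩ := exists_path_of_ccDist_lt hconn hx hy hd
  by_contra hfar
  obtain ⟨s, hs, hsε, hin⟩ := exists_first_hitting (f := fun t => dist (γ t) x) (c := ε) hT.le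
    ((continuous_id.dist continuous_const).comp_continuousOn hγ.continuousOn)
    (by simp [h0, hε.le]) (by simpa [h1] using hfar)
  have hin' : ∀ t ∈ Icc 0 s, γ t ∈ Metric.closedBall x ε := hin
  have hL := (hγ.restrict hs.1 hs.2).lipschitzOnWith (M := M) (fun t ht j => hM _ (hin' t ht) j)
  have h2 := hL.dist_le_mul s ⟨hs.1, le_rfl⟩ 0 ⟨le_rfl, hs.1⟩
  rw [h0, hsε, Real.dist_eq, sub_zero, abs_of_nonneg hs.1] at h2
  push_cast at h2
  have h3 : s < ε / (m * M + 1) := hs.2.trans_lt hTr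
  rw [lt_div_iff₀ (by positivity)] at h3
  nlinarith [hs.1]

end Paths

/-! ### Doubling ball families -/

/-- The balls of a metric on `Y` for which `volume` is doubling and which shrink to their
centres in the ambient space. -/
structure IsDoublingBallFamily {E : Type*} [PseudoMetricSpace E] [MeasureSpace E] (Y : Set E)
    (B : E → ℝ → Set E) (D : ℝ≥0) : Prop where
  subset : ∀ x r, B x r ⊆ Y
  mem_comm : ∀ x ∈ Y, ∀ y ∈ Y, ∀ r, y ∈ B x r ↔ x ∈ B y r
  subset_add : ∀ x ∈ Y, ∀ y r s, y ∈ B x r → B y s ⊆ B x (r + s)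
  mono : ∀ x r s, r ≤ s → B x r ⊆ B x s
  measurableSet : ∀ r, MeasurableSet {p : E × E | p.1 ∈ Y ∧ p.2 ∈ B p.1 r}
  exists_mem : ∀ x ∈ Y, ∀ y ∈ Y, ∃ r, y ∈ B x r
  exists_subset_ball : ∀ x ∈ Y, ∀ ε > 0, ∃ r > 0, B x r ⊆ Metric.ball x ε
  pos : ∀ x ∈ Y, ∀ r > 0, 0 < volume (B x r)
  lt_top : ∀ x ∈ Y, ∀ r, volume (B x r) < ⊤
  doubling : ∀ x ∈ Y, ∀ r > 0, volume (B x (2 * r)) ≤ D * volume (B x r)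

namespace IsDoublingBallFamily

variable {E : Type*} [PseudoMetricSpace E] [MeasureSpace E] {Y : Set E}
    {B : E → ℝ → Set E} {D : ℝ≥0} (hB : IsDoublingBallFamily Y B D)
include hB

lemma measurableSet_ball {x : E} (hx : x ∈ Y) (r : ℝ) : MeasurableSet (B x r) := by
  have := measurable_prodMk_left (x := x) (hB.measurableSet r)
  convert this using 1
  ext y
  simp [hx]

lemma volume_le_pow_mul {x : E} (hx : x ∈ Y) {r : ℝ} (hr : 0 < r) (n : ℕ) :
    volume (B x r) ≤ D ^ n * volume (B x (r / 2 ^ n)) := by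
  induction n with
  | zero => simp
  | succ n ih =>
    refine ih.trans ?_
    have := hB.doubling x hx (r / 2 ^ (n + 1)) (by positivity)
    have h2 : 2 * (r / 2 ^ (n + 1)) = r / 2 ^ n := by rw [pow_succ]; field_simp
    rw [h2] at this
    rw [pow_succ, mul_assoc]
    gcongr

lemma volume_le_of_mem {x y : E} (hx : x ∈ Y) (hy : y ∈ Y) {r : ℝ} (hr : 0 < r)
    (h : y ∈ B x r) : volume (B x r) ≤ D * volume (B y r) := by
  refine le_trans (measure_mono ?_) (hB.doubling y hy r hr)
  rw [two_mul]
  exact hB.subset_add y hy x r r ((hB.mem_comm x hx y hy r).1 h)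

/-- By Tonelli, a point `z` contributes through the centres `y ∈ B z ρ`, whose balls have volume at
least that of `B z ρ` divided by `D`. This `L¹` bound at a single scale takes the place of the
maximal function theorem. -/
lemma lintegral_average_le [SFinite (volume : Measure E)] {ρ : ℝ} (hρ : 0 < ρ) {h : E → ℝ≥0∞}
    (hh : Measurable h) (hY : MeasurableSet Y) :
    ∫⁻ y in Y, (∫⁻ z in B y ρ, h z) / volume (B y ρ) ≤ D * ∫⁻ z in Y, h z := by
  set S := {p : E × E | p.1 ∈ Y ∧ p.2 ∈ B p.1 ρ} with hS
  have hSm : MeasurableSet S := hB.measurableSet ρ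
  set V : E → ℝ≥0∞ := fun z => volume (Prod.mk z ⁻¹' S) with hV
  have hVm : Measurable V := measurable_measure_prodMk_left hSm
  have hVe : ∀ z ∈ Y, V z = volume (B z ρ) := by
    intro z hz
    simp only [hV]
    congr 1
    ext y; simp [hS, hz]
  -- The weight is moved from the volume of the ball at `y` to that at `z`, so that for fixed `z`
  -- the kernel is constant in `y` on `B z ρ`.
  set K : E × E → ℝ≥0∞ := S.indicator (fun p => h p.2 * (D * (V p.2)⁻¹)) with hK
  have hKm : Measurable K := ((hh.mul (hVm.inv.const_mul _)).comp measurable_snd).indicator hSm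
  calc ∫⁻ y in Y, (∫⁻ z in B y ρ, h z) / volume (B y ρ)
      ≤ ∫⁻ y in Y, ∫⁻ z, K (y, z) := by
        refine setLIntegral_mono' hY fun y hy => ?_
        rw [div_eq_mul_inv, ← lintegral_mul_const _ hh,
          ← lintegral_indicator (hB.measurableSet_ball hy ρ)]
        refine lintegral_mono fun z => ?_
        by_cases hz : z ∈ B y ρ
        · have hzY := hB.subset _ _ hz
          simp only [hK, indicator, hz, if_true, hS, mem_ofPred_eq, hy, true_and]
          gcongr
          rw [hVe z hzY]
          have h0 := (hB.pos z hzY ρ hρ).ne'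
          have h1 := (hB.lt_top z hzY ρ).ne
          calc (volume (B y ρ))⁻¹
              = (volume (B y ρ))⁻¹ * (volume (B z ρ) * (volume (B z ρ))⁻¹) := by
                rw [ENNReal.mul_inv_cancel h0 h1, mul_one]
            _ ≤ (volume (B y ρ))⁻¹ * (D * volume (B y ρ) * (volume (B z ρ))⁻¹) := by
                gcongr
                exact hB.volume_le_of_mem hzY hy hρ ((hB.mem_comm y hy z hzY ρ).1 hz)
            _ = (volume (B y ρ))⁻¹ * volume (B y ρ) * (D * (volume (B z ρ))⁻¹) := by ring
            _ = D * (volume (B z ρ))⁻¹ := by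
                rw [ENNReal.inv_mul_cancel (hB.pos y hy ρ hρ).ne' (hB.lt_top y hy ρ).ne, one_mul]
        · simp [hK, hz, hS]
    _ ≤ ∫⁻ y, ∫⁻ z, K (y, z) := setLIntegral_le_lintegral _ _
    _ = ∫⁻ z, ∫⁻ y, K (y, z) := lintegral_lintegral_swap hKm.aemeasurable
    _ ≤ ∫⁻ z, Y.indicator (fun z => D * h z) z := by
        refine lintegral_mono fun z => ?_
        by_cases hz : z ∈ Y
        · have : ∀ y, K (y, z) = (B z ρ).indicator (fun _ => h z * (D * (V z)⁻¹)) y := by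
            intro y
            by_cases hy : y ∈ B z ρ
            · have hyY := hB.subset _ _ hy
              simp [hK, hS, indicator, hyY, hy, (hB.mem_comm z hz y hyY ρ).1 hy]
            · have : ¬ (y ∈ Y ∧ z ∈ B y ρ) :=
                fun hc => hy ((hB.mem_comm y hc.1 z hz ρ).1 hc.2)
              simp [hK, hS, indicator, this, hy]
          simp only [this, indicator, hz, if_true]
          change ∫⁻ y, (B z ρ).indicator (fun _ => h z * (D * (V z)⁻¹)) y ≤ _
          rw [lintegral_indicator (hB.measurableSet_ball hz ρ), setLIntegral_const, hVe z hz]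
          rw [mul_assoc, mul_assoc, ENNReal.inv_mul_cancel (hB.pos z hz ρ hρ).ne'
            (hB.lt_top z hz ρ).ne, mul_one, mul_comm]
        · have : ∀ y, K (y, z) = 0 := by
            intro y
            have : ¬ (y ∈ Y ∧ z ∈ B y ρ) := fun hc => hz (hB.subset _ _ hc.2)
            simp [hK, hS, this]
          simp [this]
    _ = D * ∫⁻ z in Y, h z := by
        rw [lintegral_indicator hY, lintegral_const_mul _ hh]

/-- A ball family of finite total volume has finite diameter. -/
lemma exists_ball_eq_of_volume_lt_top (hY : MeasurableSet Y) (hfin : volume Y < ⊤) :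
    ∃ R > 0, ∀ x ∈ Y, B x R = Y := by
  rcases Y.eq_empty_or_nonempty with rfl | ⟨x₀, hx₀⟩
  · exact ⟨1, one_pos, by simp⟩
  have hpos : 0 < volume Y := (hB.pos x₀ hx₀ 1 one_pos).trans_le (measure_mono (hB.subset _ _))
  have hU : ⋃ n : ℕ, B x₀ n = Y := by
    refine Subset.antisymm (iUnion_subset fun n => hB.subset _ _) fun y hy => ?_
    obtain ⟨r, hr⟩ := hB.exists_mem x₀ hx₀ y hy
    obtain ⟨n, hn⟩ := exists_nat_ge r
    exact mem_iUnion.2 ⟨n, hB.mono _ _ _ hn hr⟩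
  have hlim : Tendsto (fun n : ℕ => volume (Y \ B x₀ n)) atTop (𝓝 0) := by
    have h1 : ⋂ n : ℕ, Y \ B x₀ n = ∅ := by rw [← sdiff_iUnion, hU, sdiff_self]
    have := tendsto_measure_iInter_atTop (μ := volume) (s := fun n : ℕ => Y \ B x₀ n)
      (fun n => (hY.diff (hB.measurableSet_ball hx₀ n)).nullMeasurableSet)
      (fun a b hab => sdiff_subset_sdiff_right (hB.mono _ _ _ (by exact_mod_cast hab)))
      ⟨0, ((measure_mono sdiff_subset).trans_lt hfin).ne⟩
    rwa [h1, measure_empty] at this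
  -- If `y` lies between distances `s` and `2 * s` from `x₀`, with `s ≥ 4 * n`, then `B y (s / 2)`
  -- misses `B x₀ n` while `B y (4 * s)` contains it. Three doublings bound the volume of `B x₀ n`
  -- by `D ^ 3` times the remaining volume, which this threshold contradicts.
  have hδ : 0 < volume Y / (D ^ 3 + 2) := ENNReal.div_pos hpos.ne' (by finiteness)
  obtain ⟨n, hn⟩ := ((hlim.eventually (gt_mem_nhds hδ)).and (eventually_ge_atTop 1)).exists
  obtain ⟨hn, hn1⟩ := hn
  have hn0 : (0 : ℝ) < n := by exact_mod_cast hn1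
  have hall : ∀ y ∈ Y, y ∈ B x₀ (4 * n) := by
    intro y hy
    by_contra hcon
    obtain ⟨r, hr⟩ := hB.exists_mem x₀ hx₀ y hy
    -- a scale at which `y` is just reached
    obtain ⟨k, hk1, hk2⟩ : ∃ k : ℕ, y ∉ B x₀ (2 ^ k * (4 * n)) ∧
        y ∈ B x₀ (2 ^ (k + 1) * (4 * n)) := by
      by_contra! hno
      have : ∀ k : ℕ, y ∉ B x₀ (2 ^ k * (4 * n)) := by
        intro k
        induction k with
        | zero => simpa using hcon
        | succ k ih => exact hno k ih
      obtain ⟨k, hk⟩ := pow_unbounded_of_one_lt r (one_lt_two : (1 : ℝ) < 2)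
      refine this k (hB.mono _ _ _ ?_ hr)
      have : (1 : ℝ) ≤ n := by exact_mod_cast hn1
      nlinarith [pow_pos (two_pos : (0 : ℝ) < 2) k]
    set s : ℝ := 2 ^ k * (4 * n) with hs
    have hsn : 4 * (n : ℝ) ≤ s := le_mul_of_one_le_left (by positivity) (one_le_pow₀ one_le_two)
    have hs0 : 0 < s := by positivity
    have h1 : B y (s / 2) ⊆ Y \ B x₀ n := by
      intro z hz
      have hzY := hB.subset _ _ hz
      refine ⟨hzY, fun hz' => hk1 ?_⟩
      have := hB.subset_add x₀ hx₀ z n (s / 2) hz' ((hB.mem_comm y hy z hzY _).1 hz)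
      exact hB.mono _ _ _ (by linarith) this
    have h2 : B x₀ n ⊆ B y (4 * s) := by
      have := hB.subset_add y hy x₀ (2 * s) n (by
        rw [hB.mem_comm y hy x₀ hx₀]
        convert hk2 using 2
        rw [hs]; ring)
      exact this.trans (hB.mono _ _ _ (by linarith))
    have h3 := hB.volume_le_pow_mul hy (r := 4 * s) (by positivity) 3
    have h4 : 4 * s / 2 ^ 3 = s / 2 := by ring
    rw [h4] at h3
    refine lt_irrefl (volume Y) ?_
    calc volume Y ≤ volume (B x₀ n) + volume (Y \ B x₀ n) := by
          refine (measure_le_inter_add_sdiff volume Y (B x₀ n)).trans ?_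
          gcongr
          exact inter_subset_right
      _ ≤ D ^ 3 * volume (Y \ B x₀ n) + volume (Y \ B x₀ n) := by
          gcongr
          refine (measure_mono h2).trans (h3.trans ?_)
          gcongr
      _ ≤ volume (Y \ B x₀ n) * (D ^ 3 + 2) := by
          rw [mul_add, mul_comm]
          gcongr
          exact le_mul_of_one_le_right' (by norm_num)
      _ < volume Y := ENNReal.mul_lt_of_lt_div hn
  refine ⟨8 * n, by positivity, fun x hx => Subset.antisymm (hB.subset _ _) fun y hy => ?_⟩
  have := hB.subset_add x hx x₀ (4 * n) (4 * n) ((hB.mem_comm x hx x₀ hx₀ _).2 (hall x hx)) (hall y hy)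
  exact hB.mono _ _ _ (by linarith) this

end IsDoublingBallFamily

/-! ### Control balls form a doubling ball family -/

section Control

variable {N m : ℕ} {X : Fin m → EuclideanSpace ℝ (Fin N) → EuclideanSpace ℝ (Fin N)}
  {P Y : Set (EuclideanSpace ℝ (Fin N))}

/-- Joint continuity makes the relation `y ∈ B x r` measurable on the product, as Tonelli requires.
-/
lemma continuousOn_ccDist (hX : ∀ j, Continuous (X j)) (hconn : IsXConnected X P Y)
    (hcomp : IsEuclideanCompatible X P Y) :
    ContinuousOn (fun p : EuclideanSpace ℝ (Fin N) × EuclideanSpace ℝ (Fin N) =>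
      ccDist X P p.1 p.2) (Y ×ˢ Y) := by
  rintro ⟨x, y⟩ ⟨hx, hy⟩
  have h1 : Tendsto (fun p : EuclideanSpace ℝ (Fin N) × EuclideanSpace ℝ (Fin N) =>
      ccDist X P x p.1 + ccDist X P y p.2) (𝓝[Y ×ˢ Y] (x, y)) (𝓝 0) := by
    rw [nhdsWithin_prod_eq]
    simpa using ((hcomp x hx).comp tendsto_fst).add ((hcomp y hy).comp tendsto_snd)
  rw [ContinuousWithinAt, tendsto_iff_dist_tendsto_zero]
  refine squeeze_zero' (Eventually.of_forall fun _ => dist_nonneg) ?_ h1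
  filter_upwards [self_mem_nhdsWithin] with p hp
  obtain ⟨hp1, hp2⟩ := hp
  have a1 := ccDist_triangle hX hconn hx hp1 hp2
  have a2 := ccDist_triangle hX hconn hp1 hx hy
  have a3 := ccDist_triangle hX hconn hx hp2 hy
  have a4 := ccDist_triangle hX hconn hp1 hy hp2
  rw [ccDist_comm hX p.1 x] at a2
  rw [ccDist_comm hX p.2 y] at a3
  rw [Real.dist_eq, abs_le]
  have a5 := ccDist_triangle hX hconn hx hp1 hy
  have a6 := ccDist_triangle hX hconn hp1 hx hp2
  constructor <;> dsimp only at * <;> linarith [ccDist_comm (P := P) hX p.1 x]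

lemma isDoublingBallFamily_ccBall (hX : ∀ j, Continuous (X j)) (hY : IsOpen Y)
    (hconn : IsXConnected X P Y) (hcomp : IsEuclideanCompatible X P Y) {Q : ℝ}
    (hdoub : IsDoublingSpace X P Y Q) :
    IsDoublingBallFamily Y (ccBall X P Y) (2 ^ Q : ℝ).toNNReal where
  subset x r y hy := hy.1
  mem_comm x hx y hy r := by simp only [ccBall, mem_ofPred_eq, hx, hy, ccDist_comm hX x y]
  subset_add x hx y r s hy z hz :=
    ⟨hz.1, (ccDist_triangle hX hconn hx hy.1 hz.1).trans_lt (add_lt_add hy.2 hz.2)⟩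
  mono x r s hrs y hy := ⟨hy.1, hy.2.trans_le hrs⟩
  measurableSet r := by
    have := (continuousOn_ccDist hX hconn hcomp).isOpen_inter_preimage (hY.prod hY)
      (isOpen_Iio (a := r))
    convert this.measurableSet using 1
    ext p
    simp [ccBall, and_assoc]
  exists_mem x hx y hy := ⟨ccDist X P x y + 1, hy, by linarith⟩
  exists_subset_ball x hx ε hε := exists_ccBall_subset_ball hX hconn hx hε
  pos x hx r hr := by simpa [mul_div_cancel₀] using (hdoub x hx (r / 2) (half_pos hr)).1
  lt_top x hx r := by
    -- A small control ball lies in a Euclidean ball and has finite volume; doubling carries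
    -- finiteness to all larger radii.
    obtain ⟨r₀, hr₀, hsub⟩ := exists_ccBall_subset_ball hX hconn hx one_pos
    have h : ∀ n : ℕ, volume (ccBall X P Y x (2 ^ n * r₀)) < ⊤ := by
      intro n
      induction n with
      | zero => simpa using (measure_mono hsub).trans_lt Metric.isBounded_ball.measure_lt_top
      | succ n ih =>
        rw [pow_succ', mul_assoc]
        exact (hdoub x hx _ (by positivity)).2.trans_lt (ENNReal.mul_lt_top (by simp) ih)
    obtain ⟨n, hn⟩ := pow_unbounded_of_one_lt (r / r₀) (one_lt_two : (1 : ℝ) < 2)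
    rw [div_lt_iff₀ hr₀] at hn
    have hsub' : ccBall X P Y x r ⊆ ccBall X P Y x (2 ^ n * r₀) :=
      fun y hy => ⟨hy.1, hy.2.trans hn⟩
    exact (measure_mono hsub').trans_lt (h n)
  doubling x hx r hr := (hdoub x hx r hr).2

end Control

/-! ### Weak-type Sobolev inequality from Poincaré and doubling -/

/-- The expression is continuous at `ρ = 1`, so the strict inequality leaves room for a ratio `ρ <
1` that makes the telescoping series converge. -/
lemma exists_lt_one_rpow_lt {a q : ℝ} (h : a < 4 ^ q) :
    ∃ ρ : ℝ, 0 < ρ ∧ ρ < 1 ∧ a < (4 * ρ ^ 2) ^ q := by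
  have h1 : Tendsto (fun ρ : ℝ => (4 * ρ ^ 2) ^ q) (𝓝[<] 1) (𝓝 (4 ^ q)) := by
    have : ContinuousAt (fun ρ : ℝ => (4 * ρ ^ 2) ^ q) 1 :=
      ContinuousAt.rpow_const (by fun_prop) (Or.inl (by norm_num))
    have h2 := this.tendsto
    norm_num at h2
    exact h2.mono_left nhdsWithin_le_nhds
  obtain ⟨ρ, h2, h3, h4⟩ := ((h1.eventually (lt_mem_nhds h)).and
    ((eventually_mem_nhdsWithin (a := (1 : ℝ)) (s := Iio 1)).and
      (mem_nhdsWithin_of_mem_nhds (lt_mem_nhds (zero_lt_one' ℝ))))).exists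
  exact ⟨ρ, h4, h3, h2⟩

namespace IsDoublingBallFamily

variable {E : Type*} [PseudoMetricSpace E] [MeasureSpace E] {Y : Set E}
    {B : E → ℝ → Set E} {D : ℝ≥0} (hB : IsDoublingBallFamily Y B D)
include hB

/-- Subtract the average over the large ball first; passing to the half ball then costs only the
ratio of volumes, at most `D`. -/
lemma abs_average_half_sub_le {φ : E → ℝ} (hφ : IntegrableOn φ Y) {y : E} (hy : y ∈ Y)
    {r : ℝ} (hr : 0 < r) :
    |(⨍ z in B y r, φ z) - ⨍ z in B y (r / 2), φ z| ≤
      D * ⨍ z in B y r, |φ z - ⨍ w in B y r, φ w| := by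
  set c := ⨍ w in B y r, φ w with hc
  have hr2 := half_pos hr
  have hi : IntegrableOn (fun z => φ z - c) (B y r) :=
    (hφ.mono_set (hB.subset _ _)).sub (integrableOn_const (hB.lt_top y hy r).ne)
  have hsub : B y (r / 2) ⊆ B y r := hB.mono _ _ _ (by linarith)
  have v1 : 0 < volume.real (B y (r / 2)) :=
    ENNReal.toReal_pos (hB.pos y hy _ hr2).ne' (hB.lt_top y hy _).ne
  have v2 : 0 < volume.real (B y r) :=
    ENNReal.toReal_pos (hB.pos y hy _ hr).ne' (hB.lt_top y hy _).ne
  have v3 : volume.real (B y r) ≤ D * volume.real (B y (r / 2)) := by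
    have := hB.doubling y hy _ hr2
    rw [mul_div_cancel₀ _ (two_ne_zero' ℝ)] at this
    have h2 := ENNReal.toReal_mono (by finiteness [(hB.lt_top y hy (r / 2)).ne]) this
    simpa [measureReal_def] using h2
  rw [abs_sub_comm]
  change |(⨍ z in B y (r / 2), φ z) - c| ≤ _
  have h1 : (⨍ z in B y (r / 2), φ z) - c = ⨍ z in B y (r / 2), (φ z - c) := by
    rw [setAverage_eq, setAverage_eq, integral_sub, setIntegral_const]
    · simp only [smul_eq_mul]
      field_simp
    · exact hφ.mono_set (hB.subset _ _)
    · exact integrableOn_const (hB.lt_top y hy _).ne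
  rw [h1, setAverage_eq, setAverage_eq, smul_eq_mul, smul_eq_mul, abs_mul, abs_inv, abs_of_pos v1,
    ← mul_assoc]
  have h3 : |∫ z in B y (r / 2), (φ z - c)| ≤ ∫ z in B y r, |φ z - c| :=
    (abs_integral_le_integral_abs).trans (setIntegral_mono_set hi.abs
      (Eventually.of_forall fun _ => abs_nonneg _) hsub.eventuallyLE)
  refine mul_le_mul ?_ h3 (abs_nonneg _) (by positivity)
  rw [inv_le_iff_one_le_mul₀ v1, mul_assoc, mul_comm, mul_assoc, mul_comm _ (D : ℝ),
    ← div_eq_inv_mul, le_div_iff₀ v2, one_mul]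
  exact v3

lemma tendsto_average {φ : E → ℝ} (hφ : IntegrableOn φ Y)
    {y : E} (hy : y ∈ Y) (hc : ContinuousAt φ y) {r : ℝ} (hr : 0 < r) :
    Tendsto (fun k : ℕ => ⨍ z in B y (r / 2 ^ k), φ z) atTop (𝓝 (φ y)) := by
  rw [Metric.tendsto_atTop]
  intro ε hε
  obtain ⟨δ, hδ, hball⟩ := Metric.continuousAt_iff.1 hc (ε / 2) (half_pos hε)
  obtain ⟨r₀, hr₀, hsub⟩ := hB.exists_subset_ball y hy δ hδ
  have hlim : Tendsto (fun k : ℕ => r / 2 ^ k) atTop (𝓝 0) := by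
    have := (tendsto_pow_atTop_nhds_zero_of_lt_one (r := (1 / 2 : ℝ)) (by norm_num)
      (by norm_num)).const_mul r
    simpa [div_eq_mul_inv] using this
  obtain ⟨n, hn⟩ := eventually_atTop.1 (hlim.eventually (gt_mem_nhds hr₀))
  refine ⟨n, fun k hk => ?_⟩
  have h0 : 0 < r / 2 ^ k := by positivity
  have hmem : ⨍ z in B y (r / 2 ^ k), φ z ∈ Metric.closedBall (φ y) (ε / 2) := by
    refine (convex_closedBall _ _).set_average_mem Metric.isClosed_closedBall
      (hB.pos y hy _ h0).ne' (hB.lt_top y hy _).ne ?_ (hφ.mono_set (hB.subset _ _))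
    filter_upwards [ae_restrict_mem (hB.measurableSet_ball hy _)] with z hz
    exact (hball (hsub (hB.mono _ _ _ (hn k hk).le hz))).le
  exact (Metric.mem_closedBall.1 hmem).trans_lt (by linarith)

lemma aemeasurable_average [SFinite (volume : Measure E)] (ρ : ℝ) {h : E → ℝ≥0∞}
    (hh : Measurable h) (hY : MeasurableSet Y) :
    AEMeasurable (fun y => (∫⁻ z in B y ρ, h z) / volume (B y ρ)) (volume.restrict Y) := by
  set S := {p : E × E | p.1 ∈ Y ∧ p.2 ∈ B p.1 ρ} with hS
  have hSm : MeasurableSet S := hB.measurableSet ρ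
  have h1 : Measurable fun y => ∫⁻ z, S.indicator (fun p => h p.2) (y, z) :=
    ((hh.comp measurable_snd).indicator hSm).lintegral_prod_right'
  have h2 : Measurable fun y => volume (Prod.mk y ⁻¹' S) := measurable_measure_prodMk_left hSm
  refine ⟨_, h1.div h2, ?_⟩
  filter_upwards [ae_restrict_mem hY] with y hy
  have e1 : Prod.mk y ⁻¹' S = B y ρ := by ext z; simp [hS, hy]
  have e2 : ∀ z, S.indicator (fun p => h p.2) (y, z) = (B y ρ).indicator h z := by
    intro z
    by_cases hz : z ∈ B y ρ <;> simp [hS, indicator, hy, hz]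
  change _ = (∫⁻ z, S.indicator (fun p => h p.2) (y, z)) / volume (Prod.mk y ⁻¹' S)
  simp only [e1, e2]
  rw [lintegral_indicator (hB.measurableSet_ball hy ρ)]

/-- Jensen's inequality for the square. -/
lemma ofReal_sq_average_le {g : E → ℝ} (hg : MemLp g 2 (volume.restrict Y)) {y : E} (hy : y ∈ Y)
    {r : ℝ} (hr : 0 < r) :
    ENNReal.ofReal ((⨍ z in B y r, g z) ^ 2) ≤
      (∫⁻ z in B y r, ENNReal.ofReal (g z ^ 2)) / volume (B y r) := by
  have hg' : MemLp g 2 (volume.restrict (B y r)) :=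
    hg.mono_measure (Measure.restrict_mono (hB.subset _ _) le_rfl)
  have h0 := (hB.pos y hy r hr)
  have h1 := (hB.lt_top y hy r)
  have : IsFiniteMeasure (volume.restrict (B y r)) := ⟨by simpa using h1⟩
  have hJ : (⨍ z in B y r, g z) ^ 2 ≤ ⨍ z in B y r, g z ^ 2 :=
    (Even.convexOn_pow (even_two)).map_set_average_le (by fun_prop) isClosed_univ h0.ne' h1.ne
      (by simp) (hg'.integrable (by norm_num)) hg'.integrable_sq
  refine (ENNReal.ofReal_le_ofReal hJ).trans_eq ?_
  rw [setAverage_eq, smul_eq_mul, ENNReal.ofReal_mul (by positivity),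
    ofReal_integral_eq_lintegral_ofReal hg'.integrable_sq
      (Eventually.of_forall fun _ => sq_nonneg _),
    measureReal_def,
    ENNReal.ofReal_inv_of_pos (ENNReal.toReal_pos h0.ne' h1.ne), ENNReal.ofReal_toReal h1.ne, div_eq_mul_inv, mul_comm]

/-- Weak type Sobolev inequality for functions that satisfy a Poincaré inequality on all balls
and whose averages at one fixed scale are controlled. -/
theorem weak_sobolev [OpensMeasurableSpace E] [SFinite (volume : Measure E)]
    (hY : MeasurableSet Y)
    {Ω : Set E} (hΩY : Ω ⊆ Y) (hΩ : volume Ω < ⊤) {R c₀ C₁ CP ν q : ℝ} (hR : 0 < R) (hc₀ : 0 < c₀)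
    (hvol : ∀ y ∈ Ω, ENNReal.ofReal c₀ ≤ volume (B y R)) (hC₁ : 0 ≤ C₁) (hCP : 0 < CP)
    (hν : 0 < ν) (hq : 1 < q) (hqD : (D : ℝ) ^ (q - 1) < 4 ^ q) :
    ∃ C : ℝ, 0 ≤ C ∧ ∀ φ g : E → ℝ, Continuous φ → IntegrableOn φ Y → Measurable g → (∀ x, 0 ≤ g x) →
      MemLp g 2 (volume.restrict Y) →
      (∀ y ∈ Y, ∀ r > 0, ⨍ z in B y r, |φ z - ⨍ w in B y r, φ w| ≤
        CP * r * ⨍ z in B y (ν * r), g z) →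
      (∀ y ∈ Ω, (⨍ z in B y R, φ z) ^ 2 ≤ C₁ * ∫ z in Y, g z ^ 2) →
      ∀ t > 0, volume {y ∈ Ω | t < |φ y|} ≤
        ENNReal.ofReal (C * ((∫ z in Y, g z ^ 2) / t ^ 2) ^ q) := by
  obtain ⟨ρ, hρ0, hρ1, hρ⟩ := exists_lt_one_rpow_lt hqD
  -- `j` is the number of halvings that absorbs the dilation `ν` of the Poincaré inequality.
  obtain ⟨j, hj⟩ := exists_pow_lt_of_lt_one hν (by norm_num : (1 / 2 : ℝ) < 1)
  set θ : ℝ := 4 * ρ ^ 2 with hθ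
  have hθ0 : 0 < θ := by positivity
  -- Chosen so that the increments at scale `k` are at most `(t / 2) * (1 - ρ) * ρ ^ k`, with total
  -- `t / 2`.
  set κ : ℝ := (1 - ρ) / (2 * (D * CP * R + 1)) with hκ
  have hκ0 : 0 < κ := div_pos (by linarith) (by positivity)
  set l : ℝ := (D : ℝ) ^ (q - 1) / θ ^ q with hl
  have hl0 : 0 ≤ l := by positivity
  have hl1 : l < 1 := (div_lt_one (by positivity)).2 hρ
  set c₂ : ℝ := D / κ ^ 2 * (D ^ j / (c₀ * κ ^ 2)) ^ (q - 1) with hc₂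
  have hc₂0 : 0 ≤ c₂ := by positivity
  refine ⟨c₂ * (1 - l)⁻¹ + volume.real Ω * (4 * C₁) ^ q, by
    have : 0 < 1 - l := by linarith
    positivity, ?_⟩
  intro φ g hφ hφi hgm hg0 hg2 hP hav t ht
  set A := ∫ z in Y, g z ^ 2 with hA
  have hA0 : 0 ≤ A := integral_nonneg fun _ => sq_nonneg _
  set x := A / t ^ 2 with hx
  have hx0 : 0 ≤ x := by positivity
  have hAl : ∫⁻ z in Y, ENNReal.ofReal (g z ^ 2) = ENNReal.ofReal A :=
    (ofReal_integral_eq_lintegral_ofReal hg2.integrable_sq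
      (Eventually.of_forall fun _ => sq_nonneg _)).symm
  have h1l : 0 < 1 - l := by linarith
  -- If this fails, the top average is not controlled by `t / 2`, but then `4 * C₁ * x > 1` and the
  -- volume of `Ω` itself is an admissible bound.
  by_cases hcase : C₁ * A ≤ t ^ 2 / 4
  swap
  · refine (measure_mono (sep_subset _ _)).trans ?_
    rw [← ENNReal.ofReal_toReal hΩ.ne]
    refine ENNReal.ofReal_le_ofReal ?_
    have h1 : 1 ≤ (4 * C₁ * x) ^ q := by
      refine Real.one_le_rpow ?_ (by linarith)
      rw [hx, ← mul_div_assoc, le_div_iff₀ (by positivity)]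
      linarith
    rw [Real.mul_rpow (by positivity) hx0] at h1
    calc (volume Ω).toReal ≤ volume.real Ω * ((4 * C₁) ^ q * x ^ q) :=
          le_mul_of_one_le_right (by positivity) h1
      _ ≤ _ := by
        rw [add_mul, mul_assoc (volume.real Ω)]
        have : 0 ≤ c₂ * (1 - l)⁻¹ * x ^ q := by positivity
        linarith
  set F : ℕ → E → ℝ≥0∞ := fun k y =>
    (∫⁻ z in B y (ν * (R / 2 ^ k)), ENNReal.ofReal (g z ^ 2)) / volume (B y (ν * (R / 2 ^ k)))
    with hF
  -- The radius supplies a factor `2 ^ (-k)`, so a gradient average may be as large as `(2 * ρ) ^ k`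
  -- and still give increments of order `ρ ^ k`; this is the square of that threshold.
  set M : ℕ → ℝ := fun k => t ^ 2 * κ ^ 2 * θ ^ k with hM
  have hM0 : ∀ k, 0 < M k := fun k => by positivity
  set S : ℕ → Set E := fun k => {y ∈ Ω | ENNReal.ofReal (M k) ≤ F k y} with hS
  -- Off every `S k` the telescope moves the top average by at most `t / 2`, and the top average is
  -- itself at most `t / 2`.
  have hcover : {y ∈ Ω | t < |φ y|} ⊆ ⋃ k, S k := by
    rintro y ⟨hyΩ, hty⟩
    have hy := hΩY hyΩ
    by_contra hno
    simp only [mem_iUnion, not_exists] at hno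
    have hstep : ∀ k : ℕ, dist (⨍ z in B y (R / 2 ^ k), φ z) (⨍ z in B y (R / 2 ^ (k + 1)), φ z)
        ≤ (t / 2 * (1 - ρ)) * ρ ^ k := by
      intro k
      have hrk : 0 < R / 2 ^ k := by positivity
      set Tk := ⨍ z in B y (ν * (R / 2 ^ k)), g z with hTk
      have hT0 : 0 ≤ Tk := by
        rw [hTk, setAverage_eq]
        exact mul_nonneg (by positivity) (integral_nonneg fun z => hg0 z)
      have hF' : F k y < ENNReal.ofReal (M k) := by
        by_contra hcon
        exact hno k ⟨hyΩ, not_lt.1 hcon⟩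
      have h1 := (hB.ofReal_sq_average_le hg2 hy (mul_pos hν hrk)).trans_lt hF'
      have h2 : Tk ^ 2 < M k := (ENNReal.ofReal_lt_ofReal_iff (hM0 k)).1 h1
      have h3 : Tk ≤ t * κ * (2 * ρ) ^ k := by
        refine le_of_sq_le_sq ?_ (by positivity)
        refine h2.le.trans_eq ?_
        simp only [hM, hθ, mul_pow]
        rw [← pow_mul, ← pow_mul, ← pow_mul, mul_comm k 2, pow_mul 2 2 k]
        norm_num
      have h4 := hB.abs_average_half_sub_le hφi hy hrk
      rw [Real.dist_eq, pow_succ, ← div_div]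
      refine h4.trans ?_
      calc (D : ℝ) * ⨍ z in B y (R / 2 ^ k), |φ z - ⨍ w in B y (R / 2 ^ k), φ w|
          ≤ D * (CP * (R / 2 ^ k) * Tk) := by gcongr; exact hP y hy _ hrk
        _ ≤ (D * CP * R + 1) / 2 ^ k * Tk := by
            rw [show (D : ℝ) * (CP * (R / 2 ^ k) * Tk) = (D * CP * R) / 2 ^ k * Tk by ring]
            gcongr
            linarith
        _ ≤ (D * CP * R + 1) / 2 ^ k * (t * κ * (2 * ρ) ^ k) := by gcongr
        _ = (t / 2 * (1 - ρ)) * ρ ^ k := by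
            rw [hκ, mul_pow]
            field_simp
    have h5 := dist_le_of_le_geometric_of_tendsto₀ ρ _ hρ1 hstep
      (hB.tendsto_average hφi hy hφ.continuousAt hR)
    rw [mul_div_assoc, div_self (by linarith), mul_one, pow_zero, div_one, Real.dist_eq] at h5
    have h6 : |⨍ z in B y R, φ z| ≤ t / 2 := by
      refine abs_le_of_sq_le_sq ?_ (by positivity)
      refine (hav y hyΩ).trans (hcase.trans_eq ?_)
      ring
    have h7 := abs_sub_abs_le_abs_sub (φ y) (⨍ z in B y R, φ z)
    rw [abs_sub_comm] at h5
    linarith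
  have hSk : ∀ k, volume (S k) ≤ ENNReal.ofReal (c₂ * x ^ q * l ^ k) := by
    intro k
    rcases (S k).eq_empty_or_nonempty with he | ⟨y, hyΩ, hyF⟩
    · simp [he]
    have hy := hΩY hyΩ
    have hrk : 0 < ν * (R / 2 ^ k) := by positivity
    -- Chebyshev
    have hch : ENNReal.ofReal (M k) * volume (S k) ≤ ENNReal.ofReal (D * A) := by
      have hm : Measurable fun z => ENNReal.ofReal (g z ^ 2) := (hgm.pow_const 2).ennreal_ofReal
      have h1 := mul_meas_ge_le_lintegral₀ (hB.aemeasurable_average (ν * (R / 2 ^ k)) hm hY)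
        (ENNReal.ofReal (M k))
      have h2 := h1.trans (hB.lintegral_average_le hrk hm hY)
      rw [hAl, ← ENNReal.ofReal_coe_nnreal, ← ENNReal.ofReal_mul D.coe_nonneg] at h2
      refine le_trans (mul_le_mul_right (le_trans (measure_mono fun z hz => ?_)
        (Measure.le_restrict_apply Y _)) _) h2
      exact ⟨hz.2, hΩY hz.1⟩
    -- a point of the superlevel set bounds the level
    have hlev : 1 ≤ x * (D ^ (j + k) / (c₀ * κ ^ 2 * θ ^ k)) := by
      have hv := hB.lt_top y hy (ν * (R / 2 ^ k))
      have hv0 := hB.pos y hy _ hrk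
      have h1 : M k * volume.real (B y (ν * (R / 2 ^ k))) ≤ A := by
        have h2 : F k y ≤ ENNReal.ofReal A / volume (B y (ν * (R / 2 ^ k))) := by
          rw [← hAl]
          exact ENNReal.div_le_div_right (lintegral_mono_set (hB.subset _ _)) _
        have h3 := hyF.trans h2
        rw [ENNReal.le_div_iff_mul_le (Or.inl hv0.ne') (Or.inl hv.ne)] at h3
        rw [← ENNReal.ofReal_toReal hv.ne, ← ENNReal.ofReal_mul (hM0 k).le] at h3
        exact (ENNReal.ofReal_le_ofReal_iff hA0).1 h3
      have h2 : c₀ ≤ D ^ (j + k) * volume.real (B y (ν * (R / 2 ^ k))) := by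
        have h3 : R / 2 ^ (j + k) ≤ ν * (R / 2 ^ k) := by
          rw [pow_add, ← div_div, div_right_comm, mul_comm ν]
          calc R / 2 ^ k / 2 ^ j = R / 2 ^ k * (1 / 2) ^ j := by rw [one_div_pow]; ring
            _ ≤ _ := by gcongr
        have h4 := (hvol y hyΩ).trans ((hB.volume_le_pow_mul hy hR (j + k)).trans
          (mul_le_mul_right (measure_mono (hB.mono y _ _ h3)) _))
        have h5 := ENNReal.toReal_mono (by finiteness [hv.ne]) h4
        simpa [measureReal_def, ENNReal.toReal_ofReal hc₀.le] using h5
      have h3 : M k * c₀ ≤ D ^ (j + k) * A := by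
        calc M k * c₀ ≤ M k * (D ^ (j + k) * volume.real (B y (ν * (R / 2 ^ k)))) := by
              gcongr
          _ = D ^ (j + k) * (M k * volume.real (B y (ν * (R / 2 ^ k)))) := by ring
          _ ≤ _ := by gcongr
      have h4 : x * (D ^ (j + k) / (c₀ * κ ^ 2 * θ ^ k)) = D ^ (j + k) * A / (M k * c₀) := by
        simp only [hx, hM]
        field_simp
      rw [h4, le_div_iff₀ (mul_pos (hM0 k) hc₀), one_mul]
      exact h3
    have h1 : volume (S k) ≤ ENNReal.ofReal (D * A / M k) := by
      rw [ENNReal.ofReal_div_of_pos (hM0 k), ENNReal.le_div_iff_mul_le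
        (Or.inl (by simpa using hM0 k)) (Or.inl ENNReal.ofReal_ne_top), mul_comm]
      exact hch
    refine h1.trans (ENNReal.ofReal_le_ofReal ?_)
    have h2 : D * A / M k = D / κ ^ 2 * x * (θ ^ k)⁻¹ := by
      simp only [hM, hx]
      field_simp
    rw [h2]
    -- Interpolation: Chebyshev alone gives only a bound linear in `x`. Multiplying by the power `q
    -- - 1` of a quantity that is at least `1` raises the exponent to `q` and leaves the geometric
    -- factor `l ^ k`.
    have h3 : 1 ≤ (x * (D ^ (j + k) / (c₀ * κ ^ 2 * θ ^ k))) ^ (q - 1) :=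
      Real.one_le_rpow hlev (by linarith)
    refine (le_mul_of_one_le_right (by positivity) h3).trans_eq ?_
    have hxpos : 0 < x := by
      by_contra hcon
      have : x = 0 := le_antisymm (not_lt.1 hcon) hx0
      rw [this, zero_mul] at hlev
      linarith
    have e1 : x ^ q = x * x ^ (q - 1) := by
      rw [← Real.rpow_one_add' hx0 (by linarith)]; congr 1; ring
    have e2 : θ ^ q = θ * θ ^ (q - 1) := by
      rw [← Real.rpow_one_add' hθ0.le (by linarith)]; congr 1; ring
    have e3 : (D : ℝ) ^ (j + k) / (c₀ * κ ^ 2 * θ ^ k) =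
        (D ^ j / (c₀ * κ ^ 2)) * ((D : ℝ) / θ) ^ k := by
      rw [pow_add, div_pow (D : ℝ) θ k, div_mul_div_comm]
    have e4 : (((D : ℝ) / θ) ^ k) ^ (q - 1) = (D ^ (q - 1) / θ ^ (q - 1)) ^ k := by
      rw [← Real.rpow_natCast, ← Real.rpow_mul (by positivity), mul_comm,
        Real.rpow_mul (by positivity), Real.rpow_natCast, Real.div_rpow (by positivity) hθ0.le]
    rw [e3, Real.mul_rpow hx0 (by positivity), Real.mul_rpow (by positivity) (by positivity), e4,
      hl, e1, e2, hc₂, div_mul_eq_div_div_swap]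
    simp only [div_pow, mul_pow]
    field_simp
  calc volume {y ∈ Ω | t < |φ y|} ≤ ∑' k, volume (S k) :=
        (measure_mono hcover).trans (measure_iUnion_le _)
    _ ≤ ∑' k, ENNReal.ofReal (c₂ * x ^ q * l ^ k) := ENNReal.tsum_le_tsum hSk
    _ = ENNReal.ofReal (c₂ * x ^ q * (1 - l)⁻¹) := by
        rw [← ENNReal.ofReal_tsum_of_nonneg (fun k => by positivity)
          ((summable_geometric_of_lt_one hl0 hl1).mul_left _), tsum_mul_left,
          tsum_geometric_of_lt_one hl0 hl1]
    _ ≤ _ := by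
        refine ENNReal.ofReal_le_ofReal ?_
        have : 0 ≤ volume.real Ω * (4 * C₁) ^ q * x ^ q := by positivity
        linarith

end IsDoublingBallFamily

/-! ### Lipschitz fields, their divergence and integration by parts -/

/-- Compactness gives a constant on a ball one unit larger than a ball containing the support. A
point outside it is at distance at least `1` from that inner ball, so the supremum of `|f|` serves
as a Lipschitz constant there. -/
lemma LocallyLipschitz.exists_lipschitzWith_of_hasCompactSupport {E : Type*}
    [NormedAddCommGroup E] [ProperSpace E] {f : E → ℝ} (hf : LocallyLipschitz f)
    (hs : HasCompactSupport f) : ∃ K, LipschitzWith K f := by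
  obtain ⟨R, hR⟩ := hs.isCompact.isBounded.subset_closedBall 0
  obtain ⟨K, hK⟩ := (hf.locallyLipschitzOn (s := Metric.closedBall 0 (R + 1))).exists_lipschitzOnWith_of_compact
    (isCompact_closedBall 0 (R + 1))
  obtain ⟨M, hM⟩ := (hs.exists_bound_of_continuous hf.continuous)
  have hzero : ∀ x, R < ‖x‖ → f x = 0 := fun x hx => image_eq_zero_of_notMem_tsupport
    fun h => absurd (mem_closedBall_zero_iff.1 (hR h)) (not_le.2 hx)
  have hM0 : 0 ≤ M := (norm_nonneg _).trans (hM 0)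
  have key : ∀ x y, R + 1 < ‖y‖ → dist (f x) (f y) ≤ (K + M.toNNReal : ℝ≥0) * dist x y := by
    intro x y hy
    have h1 : (0 : ℝ) ≤ (K + M.toNNReal : ℝ≥0) * dist x y := by positivity
    rw [hzero y (by linarith), dist_zero_right]
    by_cases hx : R < ‖x‖
    · rwa [hzero x hx, norm_zero]
    · have h2 : 1 ≤ dist x y := by
        rw [dist_eq_norm, norm_sub_rev]
        linarith [norm_sub_norm_le y x]
      calc ‖f x‖ ≤ M * 1 := by simpa using hM x
        _ ≤ (K + M.toNNReal : ℝ≥0) * dist x y := by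
          push_cast
          rw [Real.coe_toNNReal _ hM0]
          gcongr
          linarith [K.coe_nonneg]
  refine ⟨K + M.toNNReal, LipschitzWith.of_dist_le_mul fun x y => ?_⟩
  by_cases hy : R + 1 < ‖y‖
  · exact key x y hy
  by_cases hx : R + 1 < ‖x‖
  · rw [dist_comm, dist_comm x]; exact key y x hx
  refine (hK.dist_le_mul x (by simpa using hx) y (by simpa using hy)).trans ?_
  gcongr
  simp

lemma lineDeriv_eq_zero_of_notMem_tsupport {E : Type*} [NormedAddCommGroup E] [NormedSpace ℝ E]
    {f : E → ℝ} {x v : E} (hx : x ∉ tsupport f) : lineDeriv ℝ f x v = 0 := by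
  have h1 : f =ᶠ[𝓝 x] fun _ => 0 := notMem_tsupport_iff_eventuallyEq.1 hx
  rw [h1.lineDeriv_eq]
  simp [lineDeriv]

lemma hasDerivAt_max_zero_sq (x : ℝ) :
    HasDerivAt (fun x : ℝ => max x 0 ^ 2) (2 * max x 0) x := by
  rcases lt_trichotomy x 0 with h | rfl | h
  · rw [max_eq_right h.le, mul_zero]
    refine (hasDerivAt_const x (0 : ℝ)).congr_of_eventuallyEq ?_
    filter_upwards [Iio_mem_nhds h] with y hy
    simp [max_eq_right (le_of_lt (mem_Iio.1 hy))]
  · rw [max_self, mul_zero, hasDerivAt_iff_isLittleO_nhds_zero]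
    simp only [zero_add, max_self, smul_zero, sub_zero, ne_eq, OfNat.ofNat_ne_zero,
      not_false_eq_true, zero_pow]
    have h1 : (fun h : ℝ => max h 0 ^ 2) =O[𝓝 0] fun h => h ^ 2 := by
      refine Asymptotics.IsBigO.of_bound 1 (Eventually.of_forall fun h => ?_)
      rw [one_mul, norm_pow, norm_pow]
      gcongr
      rw [Real.norm_eq_abs, Real.norm_eq_abs, abs_of_nonneg (le_max_right _ _)]
      exact max_le (le_abs_self _) (abs_nonneg _)
    refine h1.trans_isLittleO ?_
    simpa using Asymptotics.isLittleO_pow_id (𝕜 := ℝ) (n := 2) one_lt_two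
  · rw [max_eq_left h.le]
    have := (hasDerivAt_id x).pow 2
    simp only [id, Nat.cast_ofNat, mul_one, Nat.add_one_sub_one, pow_one] at this
    refine this.congr_of_eventuallyEq ?_
    filter_upwards [Ioi_mem_nhds h] with y hy
    simp [max_eq_left (le_of_lt (mem_Ioi.1 hy))]

lemma contDiff_max_zero_sq : ContDiff ℝ 1 (fun x : ℝ => max x 0 ^ 2) := by
  rw [contDiff_one_iff_deriv]
  refine ⟨fun x => (hasDerivAt_max_zero_sq x).differentiableAt, ?_⟩
  rw [show deriv (fun x : ℝ => max x 0 ^ 2) = fun x => 2 * max x 0 from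
    funext fun x => (hasDerivAt_max_zero_sq x).deriv]
  fun_prop

noncomputable section Divergence

variable {N : ℕ}

/-- The almost everywhere defined divergence of the Lipschitz field `ψ V`. -/
def smulDiv (V : EuclideanSpace ℝ (Fin N) → EuclideanSpace ℝ (Fin N))
    (ψ : EuclideanSpace ℝ (Fin N) → ℝ) (x : EuclideanSpace ℝ (Fin N)) : ℝ :=
  ∑ i, lineDeriv ℝ (fun y => V y i * ψ y) x (EuclideanSpace.single i 1)

variable {V : EuclideanSpace ℝ (Fin N) → EuclideanSpace ℝ (Fin N)}
  {ψ : EuclideanSpace ℝ (Fin N) → ℝ}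

lemma tsupport_coord_mul_subset (i : Fin N) : tsupport (fun y => V y i * ψ y) ⊆ tsupport ψ :=
  tsupport_mul_subset_right

lemma LocallyLipschitz.coord (hV : LocallyLipschitz V) (i : Fin N) :
    LocallyLipschitz (fun y => V y i) :=
  (EuclideanSpace.proj i : EuclideanSpace ℝ (Fin N) →L[ℝ] ℝ).lipschitz.locallyLipschitz.comp hV

lemma exists_lipschitzWith_coord_mul (hV : LocallyLipschitz V) (hψ : LocallyLipschitz ψ)
    (hs : HasCompactSupport ψ) (i : Fin N) : ∃ K, LipschitzWith K (fun y => V y i * ψ y) := by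
  refine LocallyLipschitz.exists_lipschitzWith_of_hasCompactSupport ?_ hs.mul_left
  exact (contDiff_mul (𝕜 := ℝ) (n := 1)).locallyLipschitz.comp ((hV.coord i).prodMk hψ)

lemma smulDiv_eq_zero {x : EuclideanSpace ℝ (Fin N)} (hx : x ∉ tsupport ψ) :
    smulDiv V ψ x = 0 :=
  Finset.sum_eq_zero fun i _ =>
    lineDeriv_eq_zero_of_notMem_tsupport fun h => hx (tsupport_coord_mul_subset i h)

lemma exists_abs_smulDiv_le (hV : LocallyLipschitz V) (hψ : LocallyLipschitz ψ)
    (hs : HasCompactSupport ψ) : ∃ M, ∀ x, |smulDiv V ψ x| ≤ M := by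
  choose K hK using exists_lipschitzWith_coord_mul hV hψ hs
  refine ⟨∑ i, K i, fun x => (Finset.abs_sum_le_sum_abs _ _).trans ?_⟩
  refine Finset.sum_le_sum fun i _ => ?_
  simpa using norm_lineDeriv_le_of_lipschitz ℝ (x₀ := x) (v := EuclideanSpace.single i 1) (hK i)

lemma integrable_lineDeriv_coord_mul (hV : LocallyLipschitz V) (hψ : LocallyLipschitz ψ)
    (hs : HasCompactSupport ψ) (i : Fin N) (v : EuclideanSpace ℝ (Fin N)) :
    Integrable (fun x => lineDeriv ℝ (fun y => V y i * ψ y) x v) := by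
  obtain ⟨K, hK⟩ := exists_lipschitzWith_coord_mul hV hψ hs i
  have h1 : IntegrableOn (fun x => lineDeriv ℝ (fun y => V y i * ψ y) x v) (tsupport ψ) :=
    (hK.locallyIntegrable_lineDeriv v).integrableOn_isCompact hs.isCompact
  refine (integrableOn_iff_integrable_of_support_subset fun x hx => ?_).1 h1
  by_contra hcon
  exact hx (lineDeriv_eq_zero_of_notMem_tsupport fun h => hcon (tsupport_coord_mul_subset i h))

lemma integrable_smulDiv (hV : LocallyLipschitz V) (hψ : LocallyLipschitz ψ)
    (hs : HasCompactSupport ψ) : Integrable (smulDiv V ψ) :=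
  integrable_finsetSum _ fun i _ => integrable_lineDeriv_coord_mul hV hψ hs i _

/-- Coordinatewise integration by parts for Lipschitz functions. Only `ψ` has compact support, so `f
= 1` is allowed and yields `integral_smulDiv`. -/
lemma integral_lineDeriv_mul_eq_neg_integral_smulDiv (hV : LocallyLipschitz V)
    (hψ : LocallyLipschitz ψ) (hs : HasCompactSupport ψ) {f : EuclideanSpace ℝ (Fin N) → ℝ}
    {K : ℝ≥0} (hf : LipschitzWith K f) :
    ∫ x, ∑ i, lineDeriv ℝ f x (EuclideanSpace.single i 1) * (V x i * ψ x) =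
      -∫ x, smulDiv V ψ x * f x := by
  have hfb : ∀ i : Fin N, Integrable (fun x => lineDeriv ℝ f x (EuclideanSpace.single i 1) * (V x i * ψ x)) := by
    intro i
    obtain ⟨L, hL⟩ := exists_lipschitzWith_coord_mul hV hψ hs i
    refine (hL.continuous.integrable_of_hasCompactSupport hs.mul_left).bdd_mul
      (aestronglyMeasurable_lineDeriv hf.continuous _) (c := K * ‖EuclideanSpace.single i (1 : ℝ)‖)
      (Eventually.of_forall fun x => norm_lineDeriv_le_of_lipschitz ℝ hf)
  have hgb : ∀ i : Fin N, Integrable (fun x => lineDeriv ℝ (fun y => V y i * ψ y) x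
      (EuclideanSpace.single i 1) * f x) := by
    intro i
    have hsub : Function.support (fun x => lineDeriv ℝ (fun y => V y i * ψ y) x
        (EuclideanSpace.single i 1) * f x) ⊆ tsupport ψ := by
      intro x hx
      by_contra hcon
      refine hx ?_
      simp only
      rw [lineDeriv_eq_zero_of_notMem_tsupport fun h => hcon (tsupport_coord_mul_subset i h),
        zero_mul]
    refine (integrableOn_iff_integrable_of_support_subset hsub).1 ?_
    obtain ⟨M, hM⟩ := hs.isCompact.exists_bound_of_continuousOn hf.continuous.continuousOn
    refine (integrable_lineDeriv_coord_mul hV hψ hs i _).integrableOn.mul_bdd (c := M)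
      hf.continuous.aestronglyMeasurable ?_
    filter_upwards [ae_restrict_mem hs.isCompact.measurableSet] with x hx using hM x hx
  simp only [smulDiv, Finset.sum_mul]
  rw [integral_finsetSum _ fun i _ => hfb i, integral_finsetSum _ fun i _ => hgb i,
    ← Finset.sum_neg_distrib]
  refine Finset.sum_congr rfl fun i _ => ?_
  obtain ⟨L, hL⟩ := exists_lipschitzWith_coord_mul hV hψ hs i
  rw [hf.integral_lineDeriv_mul_eq hL hs.mul_left, ← integral_neg]
  refine integral_congr_ae (Eventually.of_forall fun x => ?_)
  simp only [lineDeriv_neg, neg_mul]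

lemma integral_smulDiv (hV : LocallyLipschitz V) (hψ : LocallyLipschitz ψ)
    (hs : HasCompactSupport ψ) : ∫ x, smulDiv V ψ x = 0 := by
  have := integral_lineDeriv_mul_eq_neg_integral_smulDiv hV hψ hs (LipschitzWith.const (1 : ℝ))
  simpa [lineDeriv] using this

lemma integral_fderiv_mul_eq_neg_integral_smulDiv (hV : LocallyLipschitz V)
    (hψ : LocallyLipschitz ψ) (hs : HasCompactSupport ψ) {φ : EuclideanSpace ℝ (Fin N) → ℝ}
    (hφ : ContDiff ℝ 1 φ) (hφs : HasCompactSupport φ) :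
    ∫ x, fderiv ℝ φ x (V x) * ψ x = -∫ x, smulDiv V ψ x * φ x := by
  obtain ⟨K, hK⟩ := hφ.lipschitzWith_of_hasCompactSupport hφs one_ne_zero
  rw [← integral_lineDeriv_mul_eq_neg_integral_smulDiv hV hψ hs hK]
  refine integral_congr_ae (Eventually.of_forall fun x => ?_)
  have hd : DifferentiableAt ℝ φ x := hφ.differentiable one_ne_zero x
  simp only [hd.lineDeriv_eq_fderiv, ← mul_assoc, ← Finset.sum_mul]
  congr 1
  have : V x = ∑ i, V x i • EuclideanSpace.single i (1 : ℝ) := by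
    ext k
    simp [Pi.single_apply]
  conv_lhs => rw [this]
  simp [map_sum, mul_comm]

/-- Pointwise product rule for `smulDiv`. -/
lemma smulDiv_eq_of_differentiableAt {x : EuclideanSpace ℝ (Fin N)} (hV : DifferentiableAt ℝ V x)
    (hψ : DifferentiableAt ℝ ψ x) :
    smulDiv V ψ x = (∑ i, lineDeriv ℝ (fun y => V y i) x (EuclideanSpace.single i 1)) * ψ x +
      fderiv ℝ ψ x (V x) := by
  have hVi : ∀ i, DifferentiableAt ℝ (fun y => V y i) x := fun i =>
    (EuclideanSpace.proj i : EuclideanSpace ℝ (Fin N) →L[ℝ] ℝ).differentiableAt.comp x hV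
  have h1 : V x = ∑ i, V x i • EuclideanSpace.single i (1 : ℝ) := by
    ext k
    simp [Pi.single_apply]
  conv_rhs => rw [h1]
  simp only [smulDiv, map_sum, map_smul, smul_eq_mul, Finset.sum_mul, ← Finset.sum_add_distrib]
  refine Finset.sum_congr rfl fun i _ => ?_
  rw [((hVi i).fun_mul hψ).lineDeriv_eq_fderiv, (hVi i).lineDeriv_eq_fderiv, fderiv_fun_mul (hVi i) hψ]
  simp
  ring

end Divergence

/-! ### Moving bumps and transport of null sets along subunit paths -/

lemma abs_max_zero_sq_sub_le {a b : ℝ} (ha : a ≤ 1) (hb : b ≤ 1) :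
    |max a 0 ^ 2 - max b 0 ^ 2| ≤ 2 * |a - b| := by
  have h1 : |max a 0 - max b 0| ≤ |a - b| := abs_max_sub_max_le_abs a b 0
  have h2 : |max a 0 + max b 0| ≤ 2 := by
    rw [abs_of_nonneg (by positivity)]
    have := max_le ha (zero_le_one' ℝ)
    have := max_le hb (zero_le_one' ℝ)
    linarith
  rw [sq_sub_sq, abs_mul]
  exact mul_le_mul h2 h1 (abs_nonneg _) zero_le_two

section Bump

variable {N : ℕ}

/-- A `C¹` bump supported in the closed ball of radius `r` around `z`. -/
noncomputable def quadBump (z : EuclideanSpace ℝ (Fin N)) (r : ℝ) (y : EuclideanSpace ℝ (Fin N)) : ℝ :=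
  max (r ^ 2 - ‖y - z‖ ^ 2) 0 ^ 2

variable {z y w : EuclideanSpace ℝ (Fin N)} {r : ℝ}

lemma quadBump_eq_zero (hr : 0 ≤ r) (h : r ≤ ‖y - z‖) : quadBump z r y = 0 := by
  have : r ^ 2 ≤ ‖y - z‖ ^ 2 := by gcongr
  simp [quadBump, this]

lemma quadBump_pos (h : ‖y - z‖ < r) : 0 < quadBump z r y := by
  have : ‖y - z‖ ^ 2 < r ^ 2 := by gcongr
  have h1 : 0 < max (r ^ 2 - ‖y - z‖ ^ 2) 0 := lt_max_of_lt_left (by linarith)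
  exact pow_pos h1 2

lemma contDiff_quadBump (z : EuclideanSpace ℝ (Fin N)) (r : ℝ) : ContDiff ℝ 1 (quadBump z r) :=
  contDiff_max_zero_sq.comp (contDiff_const.sub ((contDiff_id.sub contDiff_const).norm_sq ℝ))

lemma tsupport_quadBump_subset (hr : 0 ≤ r) : tsupport (quadBump z r) ⊆ Metric.closedBall z r := by
  refine closure_minimal (fun y hy => ?_) Metric.isClosed_closedBall
  rw [Metric.mem_closedBall, dist_eq_norm]
  by_contra hcon
  exact hy (quadBump_eq_zero hr (not_le.1 hcon).le)

lemma hasCompactSupport_quadBump (hr : 0 ≤ r) : HasCompactSupport (quadBump z r) :=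
  (isCompact_closedBall z r).of_isClosed_subset (isClosed_tsupport _) (tsupport_quadBump_subset hr)

lemma fderiv_quadBump : fderiv ℝ (quadBump z r) y w =
    -(4 * max (r ^ 2 - ‖y - z‖ ^ 2) 0 * inner ℝ (y - z) w) := by
  have h1 : HasFDerivAt (fun y => r ^ 2 - ‖y - z‖ ^ 2) _ y :=
    (((hasFDerivAt_id y).sub_const z).norm_sq).const_sub (r ^ 2)
  have h2 := (hasDerivAt_max_zero_sq _).comp_hasFDerivAt y h1
  have h3 : HasFDerivAt (quadBump z r) _ y := h2
  rw [h3.fderiv]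
  simp [inner_sub_left]
  ring

end Bump

section Transport

variable {N m : ℕ} {X : Fin m → EuclideanSpace ℝ (Fin N) → EuclideanSpace ℝ (Fin N)}
  {P Ω : Set (EuclideanSpace ℝ (Fin N))} {T : ℝ} {γ : ℝ → EuclideanSpace ℝ (Fin N)}

lemma hasDerivAt_quadBump {ρ : ℝ → ℝ} {ρ' : ℝ} {v y : EuclideanSpace ℝ (Fin N)} {t : ℝ}
    (hρ : HasDerivAt ρ ρ' t) (hγ : HasDerivAt γ v t) :
    HasDerivAt (fun s => quadBump (γ s) (ρ s) y)
      (2 * max (ρ t ^ 2 - ‖y - γ t‖ ^ 2) 0 * (2 * ρ t * ρ' + 2 * inner ℝ (y - γ t) v)) t := by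
  have h1 : HasDerivAt (fun s => ρ s ^ 2 - ‖y - γ s‖ ^ 2)
      (2 * ρ t * ρ' + 2 * inner ℝ (y - γ t) v) t := by
    have := (hρ.pow 2).sub ((hγ.const_sub y).norm_sq)
    exact HasDerivAt.congr_deriv this (by simp)
  exact (hasDerivAt_max_zero_sq _).comp t h1

/-- Pointwise bound behind the transport of null sets along subunit paths. -/
lemma transport_pointwise_bound {R Λ r : ℝ} {L : ℝ≥0} {θ : Fin m → ℝ} (hθ : ∑ j, θ j ^ 2 ≤ 1)
    (hL : ∀ j, LipschitzOnWith L (X j) (Metric.closedBall 0 (R + 1)))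
    {z y : EuclideanSpace ℝ (Fin N)} (hz : z ∈ Metric.closedBall 0 R) (hr : 0 ≤ r) (hr1 : r < 1)
    (hΛ : Λ = m * L)
    (hd : ∀ j, y ∈ Metric.ball 0 (R + 1) → DifferentiableAt ℝ (X j) y) :
    2 * max (r ^ 2 - ‖y - z‖ ^ 2) 0 * (2 * r * (-Λ * r) + 2 * inner ℝ (y - z) (∑ j, θ j • X j z)) +
      ∑ j, θ j * smulDiv (X j) (quadBump z r) y ≤ m * (N * L) * quadBump z r y := by
  rw [mem_closedBall_zero_iff] at hz
  by_cases hy : r < ‖y - z‖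
  · have h1 : y ∉ tsupport (quadBump z r) := fun h => by
      have := tsupport_quadBump_subset hr h
      rw [Metric.mem_closedBall, dist_eq_norm] at this
      linarith
    have h2 : max (r ^ 2 - ‖y - z‖ ^ 2) 0 = 0 := max_eq_right (by
      have : r ^ 2 ≤ ‖y - z‖ ^ 2 := by gcongr
      linarith)
    simp [smulDiv_eq_zero h1, quadBump_eq_zero hr hy.le, h2]
  have hy := not_lt.1 hy
  have hyb : ‖y‖ < R + 1 := by linarith [norm_sub_norm_le y z]
  have hymem : y ∈ Metric.ball (0 : EuclideanSpace ℝ (Fin N)) (R + 1) := mem_ball_zero_iff.2 hyb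
  set p := max (r ^ 2 - ‖y - z‖ ^ 2) 0 with hp
  have hp0 : 0 ≤ p := le_max_right _ _
  set δ : Fin m → ℝ := fun j =>
    ∑ i, lineDeriv ℝ (fun y => X j y i) y (EuclideanSpace.single i 1) with hδ
  have h1 : ∀ j, smulDiv (X j) (quadBump z r) y =
      δ j * quadBump z r y - 4 * p * inner ℝ (y - z) (X j y) := fun j => by
    rw [smulDiv_eq_of_differentiableAt (hd j hymem)
      ((contDiff_quadBump z r).differentiable one_ne_zero y), fderiv_quadBump, ← sub_eq_add_neg]
  have hδb : ∀ j, |δ j| ≤ N * L := by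
    intro j
    refine (Finset.abs_sum_le_sum_abs _ _).trans ?_
    calc _ ≤ ∑ i : Fin N, (L : ℝ) := by
          refine Finset.sum_le_sum fun i _ => ?_
          have h2 : LipschitzOnWith L (fun y => X j y i) (Metric.closedBall 0 (R + 1)) := by
            refine LipschitzOnWith.of_dist_le_mul fun a ha b hb => ?_
            refine le_trans ?_ ((hL j).dist_le_mul a ha b hb)
            rw [Real.dist_eq, dist_eq_norm]
            exact PiLp.norm_apply_le (X j a - X j b) i
          have h3 := norm_lineDeriv_le_of_lipschitzOn ℝ (v := EuclideanSpace.single i (1 : ℝ))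
            (Filter.mem_of_superset (Metric.isOpen_ball.mem_nhds hymem)
              Metric.ball_subset_closedBall) h2
          simpa using h3
      _ = N * L := by simp
  have h2 : ∑ j, θ j * δ j ≤ m * (N * L) := by
    calc ∑ j, θ j * δ j ≤ ∑ j : Fin m, (N * L : ℝ) := by
          refine Finset.sum_le_sum fun j _ => (le_abs_self _).trans ?_
          rw [abs_mul]
          calc |θ j| * |δ j| ≤ 1 * (N * L) := by
                gcongr
                exacts [abs_le_one_of_sum_sq_le_one hθ j, hδb j]
            _ = _ := one_mul _
      _ = _ := by simp
  have h3 : ∑ j, θ j * smulDiv (X j) (quadBump z r) y =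
      (∑ j, θ j * δ j) * quadBump z r y - 4 * p * inner ℝ (y - z) (∑ j, θ j • X j y) := by
    simp only [h1, inner_sum, inner_smul_right, Finset.sum_mul, Finset.mul_sum,
      ← Finset.sum_sub_distrib]
    exact Finset.sum_congr rfl fun j _ => by ring
  -- The bump moves with the velocity at its centre, while the divergence involves the field at `y`.
  -- The Lipschitz error between the two is exactly absorbed by the shrinking of the radius at rate
  -- `Λ * r`.
  have h4 : inner ℝ (y - z) (∑ j, θ j • X j z) - inner ℝ (y - z) (∑ j, θ j • X j y) ≤ Λ * r ^ 2 := by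
    rw [← inner_sub_right, ← Finset.sum_sub_distrib]
    simp only [← smul_sub]
    have h5 : ‖∑ j, θ j • (X j z - X j y)‖ ≤ m * (L * ‖y - z‖) := by
      refine norm_sum_smul_le_of_sum_sq_le_one hθ fun j => ?_
      have := (hL j).dist_le_mul z (mem_closedBall_zero_iff.2 (by linarith)) y
        (mem_closedBall_zero_iff.2 hyb.le)
      rwa [dist_eq_norm, dist_eq_norm, norm_sub_rev z y] at this
    calc _ ≤ ‖y - z‖ * (m * (L * ‖y - z‖)) := (real_inner_le_norm _ _).trans (by gcongr)
      _ = Λ * ‖y - z‖ ^ 2 := by rw [hΛ]; ring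
      _ ≤ Λ * r ^ 2 := by
        have : 0 ≤ Λ := by rw [hΛ]; positivity
        gcongr
  rw [h3]
  have h6 : 0 ≤ quadBump z r y := sq_nonneg _
  have h7 := mul_le_mul_of_nonneg_right h2 h6
  have h8 := mul_le_mul_of_nonneg_left h4 hp0
  nlinarith

/-- The time-Lipschitz constant is uniform in `y`, hence a dominating bound for differentiating the
integral of the moving bump. -/
lemma exists_quadBump_lipschitz {R : ℝ} (hR : 0 ≤ R) {ρ : ℝ → ℝ} {K₁ K₂ : ℝ≥0}
    (hρ : LipschitzOnWith K₁ (fun t => ρ t ^ 2) (Icc 0 T)) (hρ1 : ∀ t ∈ Icc 0 T, ρ t ^ 2 ≤ 1)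
    (hγ : LipschitzOnWith K₂ γ (Icc 0 T)) (hin : ∀ t ∈ Icc 0 T, γ t ∈ Metric.closedBall 0 R) :
    ∃ K : ℝ≥0, ∀ y ∈ Metric.closedBall (0 : EuclideanSpace ℝ (Fin N)) (R + 1),
      LipschitzOnWith K (fun t => quadBump (γ t) (ρ t) y) (Icc 0 T) := by
  refine ⟨2 * (K₁ + K₂ * (2 * (2 * R + 1)).toNNReal), fun y hy => ?_⟩
  refine LipschitzOnWith.of_dist_le_mul fun s hs t ht => ?_
  have hb : ∀ t ∈ Icc 0 T, ‖y - γ t‖ ≤ 2 * R + 1 := fun t ht => by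
    have h1 := mem_closedBall_zero_iff.1 hy
    have h2 := mem_closedBall_zero_iff.1 (hin t ht)
    linarith [norm_sub_le y (γ t)]
  have h1 := abs_max_zero_sq_sub_le (a := ρ s ^ 2 - ‖y - γ s‖ ^ 2) (b := ρ t ^ 2 - ‖y - γ t‖ ^ 2)
    (by linarith [hρ1 s hs, sq_nonneg ‖y - γ s‖]) (by linarith [hρ1 t ht, sq_nonneg ‖y - γ t‖])
  refine h1.trans ?_
  have h2 := hρ.dist_le_mul s hs t ht
  have h3 := hγ.dist_le_mul s hs t ht
  rw [Real.dist_eq] at h2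
  have h4 : |‖y - γ s‖ ^ 2 - ‖y - γ t‖ ^ 2| ≤ 2 * (2 * R + 1) * (K₂ * dist s t) := by
    rw [sq_sub_sq, abs_mul]
    refine mul_le_mul ?_ ?_ (abs_nonneg _) (by positivity)
    · rw [abs_of_nonneg (by positivity)]
      linarith [hb s hs, hb t ht]
    · refine (abs_norm_sub_norm_le _ _).trans (le_trans ?_ h3)
      rw [sub_sub_sub_cancel_left, dist_eq_norm, norm_sub_rev]
  push_cast
  rw [Real.coe_toNNReal _ (by positivity)]
  have h5 : ρ s ^ 2 - ‖y - γ s‖ ^ 2 - (ρ t ^ 2 - ‖y - γ t‖ ^ 2) =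
    (ρ s ^ 2 - ρ t ^ 2) - (‖y - γ s‖ ^ 2 - ‖y - γ t‖ ^ 2) := by ring
  rw [h5]
  have h6 := abs_sub (ρ s ^ 2 - ρ t ^ 2) (‖y - γ s‖ ^ 2 - ‖y - γ t‖ ^ 2)
  nlinarith

/-- If the complement of `Ω` is invariant under the fields `X`, in the distributional sense, then
a subunit path starting in `Ω` keeps a neighbourhood in which the complement of `Ω` is null. -/
lemma volume_ball_sdiff_eq_zero_of_subunit (hX : ∀ j, LocallyLipschitz (X j)) (hΩ : IsOpen Ω)
    (hW : ∀ j ψ, LocallyLipschitz ψ → HasCompactSupport ψ → ∫ x in Ωᶜ, smulDiv (X j) ψ x = 0)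
    (hT : 0 ≤ T) (hγ : IsSubunitPath X P T γ) {R r₀ : ℝ} {L : ℝ≥0} (hR : 0 ≤ R)
    (hL : ∀ j, LipschitzOnWith L (X j) (Metric.closedBall 0 (R + 1)))
    (hin : ∀ t ∈ Icc 0 T, γ t ∈ Metric.closedBall 0 R) (hr₀ : 0 < r₀) (hr₁ : r₀ < 1)
    (hball : Metric.ball (γ 0) r₀ ⊆ Ω) :
    volume (Metric.ball (γ T) (r₀ * Real.exp (-(m * L) * T)) \ Ω) = 0 := by
  set Λ : ℝ := m * L with hΛ
  have hΛ0 : 0 ≤ Λ := by positivity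
  set ρ : ℝ → ℝ := fun t => r₀ * Real.exp (-Λ * t) with hρ
  have hρ0 : ∀ t, 0 < ρ t := fun t => by positivity
  have hρ1 : ∀ t ∈ Icc 0 T, ρ t < 1 := fun t ht => by
    have : Real.exp (-Λ * t) ≤ 1 := Real.exp_le_one_iff.2 (by nlinarith [ht.1])
    simp only [hρ]
    nlinarith [Real.exp_pos (-Λ * t)]
  have hρd : ∀ t, HasDerivAt ρ (-Λ * ρ t) t := fun t => by
    have := (((hasDerivAt_id t).const_mul (-Λ)).exp).const_mul r₀
    exact HasDerivAt.congr_deriv this (by simp only [hρ, id]; ring)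
  obtain ⟨K₂, hK₂⟩ := hγ.exists_lipschitzOnWith fun j => (hX j).continuous
  obtain ⟨K₁, hK₁⟩ : ∃ K₁, LipschitzOnWith K₁ (fun t => ρ t ^ 2) (Icc 0 T) := by
    have : ContDiff ℝ 1 (fun t => ρ t ^ 2) := by simp only [hρ]; fun_prop
    exact this.contDiffOn.exists_lipschitzOnWith (by decide) (convex_Icc _ _) isCompact_Icc
  obtain ⟨K, hK⟩ := exists_quadBump_lipschitz hR hK₁
    (fun t ht => pow_le_one₀ (hρ0 t).le (hρ1 t ht).le) hK₂ hin
  -- Truncating the complement makes its measure finite and loses nothing: the bump has radius below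
  -- `1` and centre in the ball of radius `R`.
  set W := Metric.closedBall (0 : EuclideanSpace ℝ (Fin N)) (R + 1) \ Ω with hWdef
  have hWm : MeasurableSet W := measurableSet_closedBall.diff hΩ.measurableSet
  have hWv : volume W < ⊤ := (measure_mono sdiff_subset).trans_lt measure_closedBall_lt_top
  have hint : ∀ {f : EuclideanSpace ℝ (Fin N) → ℝ}, Continuous f → IntegrableOn f W := fun hf =>
    (hf.continuousOn.integrableOn_compact (isCompact_closedBall 0 (R + 1))).mono_set sdiff_subset
  set F : ℝ → ℝ := fun t => ∫ y in W, quadBump (γ t) (ρ t) y with hF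
  have hbc : ∀ t, Continuous (quadBump (γ t) (ρ t)) := fun t => (contDiff_quadBump _ _).continuous
  have hFlip : LipschitzOnWith (K * (volume.real W).toNNReal) F (Icc 0 T) := by
    refine LipschitzOnWith.of_dist_le_mul fun s hs t ht => ?_
    rw [dist_eq_norm, hF, ← integral_sub (hint (hbc s)) (hint (hbc t))]
    refine (norm_setIntegral_le_of_norm_le_const (C := K * dist s t) hWv fun y hy => ?_).trans_eq ?_
    · exact (hK y hy.1).dist_le_mul s hs t ht
    · push_cast
      rw [Real.coe_toNNReal _ measureReal_nonneg]
      ring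
  have hdiff : ∀ᵐ y : EuclideanSpace ℝ (Fin N), ∀ j, y ∈ Metric.ball 0 (R + 1) →
      DifferentiableAt ℝ (X j) y := by
    rw [ae_all_iff]
    intro j
    filter_upwards [(hL j).ae_differentiableWithinAt_of_mem] with y hy hmem
    exact (hy (Metric.ball_subset_closedBall hmem)).differentiableAt
      (Filter.mem_of_superset (Metric.isOpen_ball.mem_nhds hmem) Metric.ball_subset_closedBall)
  set C : ℝ := m * (N * L) with hC
  have hderiv : ∀ᵐ t, t ∈ Icc 0 T → ∃ F', HasDerivAt F F' t ∧ F' ≤ C * F t := by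
    filter_upwards [hγ.ae, ae_mem_Ioo_of_mem_Icc 0 T] with t ht htI hmem
    obtain ⟨θ, hθ, hd⟩ := ht hmem
    have htI := htI hmem
    set ψ := quadBump (γ t) (ρ t) with hψ
    have hψs : HasCompactSupport ψ := hasCompactSupport_quadBump (hρ0 t).le
    have hψl : LocallyLipschitz ψ := (contDiff_quadBump _ _).locallyLipschitz
    set q' : EuclideanSpace ℝ (Fin N) → ℝ := fun y =>
      2 * max (ρ t ^ 2 - ‖y - γ t‖ ^ 2) 0 *
        (2 * ρ t * (-Λ * ρ t) + 2 * inner ℝ (y - γ t) (∑ j, θ j • X j (γ t))) with hq'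
    have hq'c : Continuous q' := by simp only [hq']; fun_prop
    have hFd : HasDerivAt F (∫ y in W, q' y) t := by
      refine (hasDerivAt_integral_of_dominated_loc_of_lip (μ := volume.restrict W)
        (F := fun t y => quadBump (γ t) (ρ t) y) (bound := fun _ => (K : ℝ))
        (Icc_mem_nhds htI.1 htI.2) (Eventually.of_forall fun s => (hbc s).aestronglyMeasurable)
        (hint (hbc t)) hq'c.aestronglyMeasurable ?_ (integrableOn_const hWv.ne) ?_).2
      · filter_upwards [ae_restrict_mem hWm] with y hy
        simpa using hK y hy.1
      · exact Eventually.of_forall fun y => hasDerivAt_quadBump (hρd t) hd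
    refine ⟨_, hFd, ?_⟩
    have hsd : ∀ j, IntegrableOn (smulDiv (X j) ψ) W := fun j =>
      (integrable_smulDiv (hX j) hψl hψs).integrableOn
    have hzero : ∀ j, ∫ y in W, smulDiv (X j) ψ y = 0 := by
      intro j
      rw [← hW j ψ hψl hψs]
      symm
      refine setIntegral_eq_of_subset_of_forall_sdiff_eq_zero hΩ.measurableSet.compl
        (fun y hy => hy.2) fun y hy => smulDiv_eq_zero fun h => hy.2 ⟨?_, hy.1⟩
      have h1 := tsupport_quadBump_subset (hρ0 t).le h
      rw [Metric.mem_closedBall, dist_eq_norm] at h1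
      rw [mem_closedBall_zero_iff]
      linarith [norm_sub_norm_le y (γ t), mem_closedBall_zero_iff.1 (hin t hmem), hρ1 t hmem]
    -- By invariance the divergence terms integrate to zero, so they may be added at no cost; with
    -- them the integrand obeys the pointwise bound.
    have hsum : ∫ y in W, (q' y + ∑ j, θ j * smulDiv (X j) ψ y) = ∫ y in W, q' y := by
      rw [integral_add (hint hq'c) (integrable_finsetSum _ fun j _ => (hsd j).const_mul _),
        integral_finsetSum _ fun j _ => (hsd j).const_mul _]
      simp [integral_const_mul, hzero]
    rw [← hsum, hF, ← integral_const_mul]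
    refine integral_mono_ae ((hint hq'c).add (integrable_finsetSum _ fun j _ => (hsd j).const_mul _))
      ((hint (hbc t)).const_mul _) ?_
    filter_upwards [ae_restrict_of_ae hdiff] with y hy
    exact transport_pointwise_bound hθ hL (hin t hmem) (hρ0 t).le (hρ1 t hmem) hΛ hy
  have hF0 : F 0 = 0 := by
    refine setIntegral_eq_zero_of_forall_eq_zero fun y hy => ?_
    refine quadBump_eq_zero (hρ0 0).le ?_
    by_contra hcon
    refine hy.2 (hball ?_)
    rw [Metric.mem_ball, dist_eq_norm]
    simpa [hρ] using hcon
  -- Gronwall: with the integrating factor the nonnegative mass `F` cannot increase from its initial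
  -- value zero.
  have hac : AbsolutelyContinuousOnInterval (fun t => Real.exp (-C * t) * F t) 0 T := by
    have h1 : AbsolutelyContinuousOnInterval (fun t => Real.exp (-C * t)) 0 T :=
      ContDiffOn.absolutelyContinuousOnInterval (by fun_prop)
    exact h1.fun_mul (LipschitzOnWith.absolutelyContinuousOnInterval (by rwa [uIcc_of_le hT]))
  have hdec := hac.sub_le_of_deriv_le (C := 0) hT (by
    filter_upwards [hderiv] with t ht hmem
    obtain ⟨F', h1, h2⟩ := ht hmem
    refine ⟨_, (((hasDerivAt_id t).const_mul (-C)).exp).mul h1, ?_⟩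
    simp only [id, mul_one]
    nlinarith [Real.exp_pos (-C * t)])
  rw [hF0, mul_zero, sub_zero, zero_mul] at hdec
  have hFT : F T = 0 := by
    refine le_antisymm ?_ (integral_nonneg fun y => sq_nonneg _)
    by_contra hcon
    have := mul_pos (Real.exp_pos (-C * T)) (not_le.1 hcon)
    linarith
  have hae := (setIntegral_eq_zero_iff_of_nonneg_ae (Eventually.of_forall fun y => sq_nonneg _)
    (hint (hbc T))).1 hFT
  rw [EventuallyEq, ae_restrict_iff' hWm] at hae
  refine measure_mono_null (fun y hy => ?_) hae
  simp only [mem_compl_iff, mem_ofPred_eq, Classical.not_imp]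
  have hyT : ‖y - γ T‖ < ρ T := by
    rw [← dist_eq_norm]; exact hy.1
  refine ⟨⟨?_, hy.2⟩, (quadBump_pos hyT).ne'⟩
  rw [mem_closedBall_zero_iff]
  have hTm : T ∈ Icc 0 T := ⟨hT, le_rfl⟩
  linarith [norm_sub_norm_le y (γ T), mem_closedBall_zero_iff.1 (hin T hTm), hρ1 T hTm]

end Transport

/-! ### Friedrichs inequality when `Ω` is itself a control ball -/

lemma exists_lipschitzOnWith_of_forall_locallyLipschitz {ι E F : Type*} [Fintype ι]
    [PseudoMetricSpace E] [PseudoMetricSpace F] {X : ι → E → F} (hX : ∀ j, LocallyLipschitz (X j))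
    {s : Set E} (hs : IsCompact s) : ∃ L, ∀ j, LipschitzOnWith L (X j) s := by
  choose K hK using fun j =>
    ((hX j).locallyLipschitzOn (s := s)).exists_lipschitzOnWith_of_compact hs
  exact ⟨∑ j, K j, fun j => (hK j).weaken (Finset.single_le_sum (fun _ _ => zero_le)
    (Finset.mem_univ j))⟩

/-- A bounded nonempty set does not contain, up to null sets, a neighbourhood of fixed size. -/
lemma exists_volume_ball_sdiff_ne_zero {N : ℕ} (hN : 0 < N)
    {Ω : Set (EuclideanSpace ℝ (Fin N))} (hΩb : Bornology.IsBounded Ω) (hne : Ω.Nonempty) {c : ℝ}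
    (hc : 0 < c) : ∃ x ∈ Ω, volume (Metric.ball x c \ Ω) ≠ 0 := by
  set e : EuclideanSpace ℝ (Fin N) := EuclideanSpace.single ⟨0, hN⟩ 1 with he
  have hen : ‖e‖ = 1 := by simp [he]
  set f : EuclideanSpace ℝ (Fin N) → ℝ := fun x => inner ℝ e x with hf
  have hfc : Continuous f := by fun_prop
  have hbdd : BddAbove (f '' Ω) := by
    obtain ⟨R, hR⟩ := hΩb.subset_closedBall 0
    refine ⟨R, ?_⟩
    rintro _ ⟨x, hx, rfl⟩
    have h1 := real_inner_le_norm e x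
    rw [hen, one_mul] at h1
    exact h1.trans (mem_closedBall_zero_iff.1 (hR hx))
  -- A point of `Ω` almost extremal in the direction `e`: its `c`-ball contains a nonempty open
  -- piece beyond the supremum, hence outside `Ω`.
  obtain ⟨_, ⟨x, hx, rfl⟩, hlt⟩ := exists_lt_of_lt_csSup (hne.image f)
    (show sSup (f '' Ω) - c / 2 < sSup (f '' Ω) by linarith)
  refine ⟨x, hx, fun h0 => ?_⟩
  have hU : IsOpen (Metric.ball x c ∩ {y | sSup (f '' Ω) < f y}) :=
    Metric.isOpen_ball.inter (isOpen_lt continuous_const hfc)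
  have hmem : x + (c / 2) • e ∈ Metric.ball x c ∩ {y | sSup (f '' Ω) < f y} := by
    constructor
    · rw [Metric.mem_ball, dist_eq_norm, add_sub_cancel_left, norm_smul, hen, mul_one,
        Real.norm_eq_abs, abs_of_pos (by linarith)]
      linarith
    · simp only [mem_ofPred_eq, hf, inner_add_right, inner_smul_right, real_inner_self_eq_norm_sq,
        hen]
      simp only [hf] at hlt
      linarith
  have hsub : Metric.ball x c ∩ {y | sSup (f '' Ω) < f y} ⊆ Metric.ball x c \ Ω := fun y hy =>
    ⟨hy.1, fun hyΩ => absurd (le_csSup hbdd (mem_image_of_mem f hyΩ)) (not_le.2 hy.2)⟩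
  exact (hU.measure_pos volume ⟨_, hmem⟩).ne' (measure_mono_null hsub h0)

section XGrad

variable {N m : ℕ} {X : Fin m → EuclideanSpace ℝ (Fin N) → EuclideanSpace ℝ (Fin N)}
  {P Y Ω : Set (EuclideanSpace ℝ (Fin N))} {φ : EuclideanSpace ℝ (Fin N) → ℝ}

lemma continuous_xGrad (hX : ∀ j, Continuous (X j)) (hφ : ContDiff ℝ 1 φ) :
    Continuous (xGrad X φ) := by
  refine (PiLp.continuous_toLp 2 _).comp (continuous_pi fun j => ?_)
  exact (hφ.continuous_fderiv one_ne_zero).clm_apply (hX j)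

lemma xGrad_eq_zero {x : EuclideanSpace ℝ (Fin N)} (hx : x ∉ tsupport φ) : xGrad X φ x = 0 := by
  have h : fderiv ℝ φ x = 0 := by
    by_contra hcon
    exact hx (support_fderiv_subset ℝ hcon)
  ext j
  simp [xGrad, h]

lemma hasCompactSupport_norm_xGrad (hs : HasCompactSupport φ) :
    HasCompactSupport (fun x => ‖xGrad X φ x‖) := by
  refine HasCompactSupport.intro hs.isCompact fun x hx => ?_
  rw [xGrad_eq_zero hx, norm_zero]

lemma integrable_norm_xGrad (hX : ∀ j, Continuous (X j)) (hφ : ContDiff ℝ 1 φ)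
    (hs : HasCompactSupport φ) : Integrable (fun x => ‖xGrad X φ x‖) :=
  (continuous_xGrad hX hφ).norm.integrable_of_hasCompactSupport (hasCompactSupport_norm_xGrad hs)

lemma memLp_norm_xGrad (hX : ∀ j, Continuous (X j)) (hφ : ContDiff ℝ 1 φ)
    (hs : HasCompactSupport φ) : MemLp (fun x => ‖xGrad X φ x‖) 2 :=
  (continuous_xGrad hX hφ).norm.memLp_of_hasCompactSupport (hasCompactSupport_norm_xGrad hs)

lemma xGrad_const_mul (c : ℝ) (hφ : ContDiff ℝ 1 φ) (x : EuclideanSpace ℝ (Fin N)) :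
    xGrad X (fun y => c * φ y) x = c • xGrad X φ x := by
  ext j
  simp [xGrad, fderiv_const_mul (hφ.differentiable one_ne_zero x) c]

/-- If the constant `1` can be approximated on `Ω` by test functions with small `X`-gradient, then
the complement of `Ω` is invariant under the fields in the distributional sense. -/
lemma integral_compl_smulDiv_eq_zero (hX : ∀ j, LocallyLipschitz (X j)) (hΩ : IsOpen Ω)
    (hΩv : volume Ω < ⊤)
    (h : ∀ ε > 0, ∃ φ : EuclideanSpace ℝ (Fin N) → ℝ, ContDiff ℝ 1 φ ∧ HasCompactSupport φ ∧
      tsupport φ ⊆ Ω ∧ ∫ x in Ω, |φ x - 1| ≤ ε ∧ ∫ x in Ω, ‖xGrad X φ x‖ ≤ ε)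
    (j : Fin m) {ψ : EuclideanSpace ℝ (Fin N) → ℝ} (hψ : LocallyLipschitz ψ)
    (hs : HasCompactSupport ψ) : ∫ x in Ωᶜ, smulDiv (X j) ψ x = 0 := by
  obtain ⟨M, hM⟩ := exists_abs_smulDiv_le (hX j) hψ hs
  obtain ⟨B, hB⟩ := hs.exists_bound_of_continuous hψ.continuous
  have hM0 : 0 ≤ M := (abs_nonneg _).trans (hM 0)
  have hB0 : 0 ≤ B := (norm_nonneg _).trans (hB 0)
  have hi := integrable_smulDiv (hX j) hψ hs
  have h1 : ∫ x in Ω, smulDiv (X j) ψ x = 0 := by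
    have key : ∀ ε > 0, |∫ x in Ω, smulDiv (X j) ψ x| ≤ (M + B) * ε := by
      intro ε hε
      obtain ⟨φ, hφ, hφs, hφΩ, ha, hb⟩ := h ε hε
      have hφi : Integrable φ := hφ.continuous.integrable_of_hasCompactSupport hφs
      have hφb : Integrable (fun x => smulDiv (X j) ψ x * φ x) :=
        hφi.bdd_mul hi.aestronglyMeasurable (Eventually.of_forall hM)
      -- The first part is small because `φ` is close to `1`; the second becomes an integral of the
      -- `X`-gradient by parts, with no boundary term since `φ` is supported in `Ω`.
      have e1 : ∫ x in Ω, smulDiv (X j) ψ x =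
          (∫ x in Ω, -(smulDiv (X j) ψ x * (φ x - 1))) + ∫ x in Ω, smulDiv (X j) ψ x * φ x := by
        rw [← integral_add _ hφb.integrableOn]
        · refine integral_congr_ae (Eventually.of_forall fun x => ?_)
          ring
        · have := (hi.sub hφb).integrableOn (s := Ω)
          refine this.congr (Eventually.of_forall fun x => ?_)
          simp only [Pi.sub_apply]
          ring
      have e2 : ∫ x in Ω, smulDiv (X j) ψ x * φ x = -∫ x in Ω, xGrad X φ x j * ψ x := by
        rw [setIntegral_eq_integral_of_forall_compl_eq_zero, setIntegral_eq_integral_of_forall_compl_eq_zero,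
          ← neg_eq_iff_eq_neg, ← integral_fderiv_mul_eq_neg_integral_smulDiv (hX j) hψ hs hφ hφs]
        · rfl
        · intro x hx
          rw [xGrad_eq_zero fun hx' => hx (hφΩ hx')]
          simp
        · intro x hx
          rw [image_eq_zero_of_notMem_tsupport fun hx' => hx (hφΩ hx'), mul_zero]
      have e3 : |∫ x in Ω, -(smulDiv (X j) ψ x * (φ x - 1))| ≤ M * ε := by
        have hint : IntegrableOn (fun x => |φ x - 1|) Ω :=
          (hφi.integrableOn.sub (integrableOn_const hΩv.ne)).abs
        calc _ ≤ ∫ x in Ω, M * |φ x - 1| := by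
              rw [← Real.norm_eq_abs]
              refine norm_integral_le_of_norm_le (hint.const_mul M) (Eventually.of_forall fun x => ?_)
              rw [norm_neg, norm_mul]
              exact mul_le_mul_of_nonneg_right (hM x) (abs_nonneg _)
          _ ≤ M * ε := by rw [integral_const_mul]; gcongr
      have e4 : |∫ x in Ω, xGrad X φ x j * ψ x| ≤ B * ε := by
        calc _ ≤ ∫ x in Ω, B * ‖xGrad X φ x‖ := by
              rw [← Real.norm_eq_abs]
              refine norm_integral_le_of_norm_le (((integrable_norm_xGrad
                (fun j => (hX j).continuous) hφ hφs).integrableOn).const_mul B)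
                (Eventually.of_forall fun x => ?_)
              rw [norm_mul, mul_comm]
              exact mul_le_mul (hB x) (PiLp.norm_apply_le _ j) (norm_nonneg _) hB0
          _ ≤ B * ε := by rw [integral_const_mul]; gcongr
      rw [e1, e2, add_mul]
      refine (abs_add_le _ _).trans (add_le_add e3 ?_)
      rwa [abs_neg]
    by_contra hne
    have hpos := abs_pos.2 hne
    have := key (|∫ x in Ω, smulDiv (X j) ψ x| / (2 * (M + B + 1))) (by positivity)
    rw [mul_div_assoc', le_div_iff₀ (by positivity)] at this
    nlinarith
  have h2 := integral_add_compl hΩ.measurableSet hi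
  rw [integral_smulDiv (hX j) hψ hs, h1, zero_add] at h2
  exact h2

/-- Subunit paths do not leave a bounded open set with invariant complement. -/
lemma volume_ball_sdiff_eq_zero_of_isBounded (hX : ∀ j, LocallyLipschitz (X j)) (hΩ : IsOpen Ω)
    (hW : ∀ j ψ, LocallyLipschitz ψ → HasCompactSupport ψ → ∫ x in Ωᶜ, smulDiv (X j) ψ x = 0)
    {T : ℝ} {γ : ℝ → EuclideanSpace ℝ (Fin N)}
    (hT : 0 ≤ T) (hγ : IsSubunitPath X P T γ) {R r₀ : ℝ} {L : ℝ≥0} (hR : 0 ≤ R)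
    (hΩR : Ω ⊆ Metric.closedBall 0 R)
    (hL : ∀ j, LipschitzOnWith L (X j) (Metric.closedBall 0 (R + 1 + 1))) (hr₀ : 0 < r₀)
    (hr₁ : r₀ < 1) (hball : Metric.ball (γ 0) r₀ ⊆ Ω) :
    volume (Metric.ball (γ T) (r₀ * Real.exp (-(m * L) * T)) \ Ω) = 0 := by
  refine volume_ball_sdiff_eq_zero_of_subunit hX hΩ hW hT hγ (by linarith) hL ?_ hr₀ hr₁ hball
  intro t ht
  by_contra hcon
  rw [mem_closedBall_zero_iff, not_le] at hcon
  have h0 := mem_closedBall_zero_iff.1 (hΩR (hball (Metric.mem_ball_self hr₀)))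
  -- On first reaching norm `R + 1`, the path carries a ball of radius at most `1` that is disjoint
  -- from `Ω` and yet null outside `Ω`, a contradiction. So a path allowed to run outside `Ω` still
  -- stays where `L` is valid.
  obtain ⟨s, hs, hsR, hin⟩ := exists_first_hitting (f := fun t => ‖γ t‖) (c := R + 1) ht.1
    (hγ.continuousOn.norm.mono (Icc_subset_Icc_right ht.2)) (by linarith) hcon.le
  have h1 := volume_ball_sdiff_eq_zero_of_subunit hX hΩ hW hs.1 (hγ.restrict hs.1 (hs.2.trans ht.2))
    (by linarith) hL (fun t ht => mem_closedBall_zero_iff.2 (hin t ht)) hr₀ hr₁ hball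
  have hρ : 0 < r₀ * Real.exp (-(m * L) * s) := by positivity
  have hρ1 : r₀ * Real.exp (-(m * L) * s) ≤ 1 := by
    have : Real.exp (-(m * L) * s) ≤ 1 := Real.exp_le_one_iff.2
      (mul_nonpos_of_nonpos_of_nonneg (neg_nonpos.2 (by positivity)) hs.1)
    nlinarith [Real.exp_pos (-(m * L) * s)]
  rw [sdiff_eq_left.2] at h1
  · exact (Metric.measure_ball_pos volume _ hρ).ne' h1
  · rw [Set.disjoint_left]
    intro y hy hyΩ
    have h2 := mem_closedBall_zero_iff.1 (hΩR hyΩ)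
    rw [Metric.mem_ball, dist_eq_norm, norm_sub_rev] at hy
    linarith [norm_sub_norm_le (γ s) y]

/-- Friedrichs inequality on the mean value over a bounded `Ω` that is itself a control ball. -/
lemma exists_abs_average_le_of_eq (hN : 0 < N) (hX : ∀ j, LocallyLipschitz (X j)) (hΩ : IsOpen Ω)
    (hΩb : Bornology.IsBounded Ω) (hne : Ω.Nonempty) (hconn : IsXConnected X P Ω)
    {D : ℝ} (hD : ∀ x ∈ Ω, ccBall X P Ω x D = Ω) {K : ℝ} (hK : 0 ≤ K)
    (hP : ∀ φ, ContDiff ℝ 1 φ → HasCompactSupport φ →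
      ∫ x in Ω, |φ x - ⨍ z in Ω, φ z| ≤ K * ∫ x in Ω, ‖xGrad X φ x‖) :
    ∃ C, 0 ≤ C ∧ ∀ φ, ContDiff ℝ 1 φ → HasCompactSupport φ → tsupport φ ⊆ Ω →
      |⨍ z in Ω, φ z| ≤ C * ∫ x in Ω, ‖xGrad X φ x‖ := by
  by_contra! hno
  have hW : ∀ j ψ, LocallyLipschitz ψ → HasCompactSupport ψ →
      ∫ x in Ωᶜ, smulDiv (X j) ψ x = 0 := by
    intro j ψ hψ hs
    refine integral_compl_smulDiv_eq_zero hX hΩ hΩb.measure_lt_top ?_ j hψ hs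
    intro ε hε
    -- A test function whose mean `a` dominates its gradient. Dividing by `a`, Poincaré makes it
    -- `L¹`-close to `1`, and the gradient becomes small as well.
    obtain ⟨φ, hφ, hφs, hφΩ, hlt⟩ := hno ((K + 1) / ε) (by positivity)
    set a := ⨍ z in Ω, φ z with ha
    set I := ∫ x in Ω, ‖xGrad X φ x‖ with hI
    have hI0 : 0 ≤ I := integral_nonneg fun _ => norm_nonneg _
    have ha0 : 0 < |a| := lt_of_le_of_lt (by positivity) hlt
    rw [div_mul_eq_mul_div, div_lt_iff₀ hε] at hlt
    refine ⟨fun x => a⁻¹ * φ x, contDiff_const.mul hφ, hφs.mul_left,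
      (tsupport_mul_subset_right).trans hφΩ, ?_, ?_⟩
    · have e1 : ∀ x, |a⁻¹ * φ x - 1| = |a|⁻¹ * |φ x - a| := fun x => by
        rw [← abs_inv, ← abs_mul, mul_sub, inv_mul_cancel₀ (abs_pos.1 ha0)]
      simp only [e1]
      rw [integral_const_mul, inv_mul_le_iff₀ ha0]
      refine (hP φ hφ hφs).trans ?_
      nlinarith
    · simp only [xGrad_const_mul _ hφ, norm_smul, norm_inv, Real.norm_eq_abs]
      rw [integral_const_mul, inv_mul_le_iff₀ ha0]
      nlinarith
  obtain ⟨x₀, hx₀⟩ := hne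
  obtain ⟨r₁, hr₁, hball⟩ := Metric.isOpen_iff.1 hΩ x₀ hx₀
  obtain ⟨R, hR⟩ := hΩb.subset_closedBall 0
  have hR0 : 0 ≤ R := (norm_nonneg _).trans (mem_closedBall_zero_iff.1 (hR hx₀))
  obtain ⟨L, hL⟩ := exists_lipschitzOnWith_of_forall_locallyLipschitz hX
    (isCompact_closedBall (0 : EuclideanSpace ℝ (Fin N)) (R + 1 + 1))
  set r₀ := min r₁ (1 / 2) with hr₀
  have hr₀0 : 0 < r₀ := lt_min hr₁ (by norm_num)
  have hr₀1 : r₀ < 1 := (min_le_right _ _).trans_lt (by norm_num)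
  -- The radius is the one left over at time `D`, within which every point of `Ω` is reached from
  -- `x₀`.
  obtain ⟨x, hx, hxv⟩ := exists_volume_ball_sdiff_ne_zero hN hΩb ⟨x₀, hx₀⟩
    (c := r₀ * Real.exp (-(m * L) * D)) (by positivity)
  have hxD : x ∈ ccBall X P Ω x₀ D := by rwa [hD x₀ hx₀]
  obtain ⟨T, γ, hT, hTD, hγ, h0, h1⟩ := exists_path_of_ccDist_lt hconn hx₀ hx hxD.2
  refine hxv (measure_mono_null ?_ (volume_ball_sdiff_eq_zero_of_isBounded hX hΩ hW hT.le hγ hR0 hR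
    hL hr₀0 hr₀1 ((Metric.ball_subset_ball (min_le_left _ _)).trans (by rwa [h0]))))
  rw [h1]
  refine sdiff_subset_sdiff_left (Metric.ball_subset_ball ?_)
  have : 0 ≤ (m * L : ℝ) := by positivity
  exact mul_le_mul_of_nonneg_left (Real.exp_le_exp.2 (by nlinarith)) hr₀0.le

end XGrad

/-! ### Control of averages at the top scale -/

namespace IsDoublingBallFamily

variable {E : Type*} [PseudoMetricSpace E] [MeasureSpace E] {Y : Set E}
    {B : E → ℝ → Set E} {D : ℝ≥0} (hB : IsDoublingBallFamily Y B D)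
include hB

/-- The volume of balls of a fixed radius around points where balls of another radius are large is
bounded below. -/
lemma exists_le_volume {Ω : Set E} (hΩY : Ω ⊆ Y) {R ρ c₀ : ℝ} (hR : 0 < R) (hρ : 0 < ρ)
    (hc₀ : 0 < c₀) (hvol : ∀ y ∈ Ω, ENNReal.ofReal c₀ ≤ volume (B y R)) :
    ∃ c₁ > 0, ∀ y ∈ Ω, c₁ ≤ volume.real (B y ρ) := by
  obtain ⟨j, hj⟩ := pow_unbounded_of_one_lt (R / ρ) (one_lt_two : (1 : ℝ) < 2)
  rw [div_lt_iff₀ hρ] at hj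
  refine ⟨c₀ / ((D : ℝ) ^ j + 1), by positivity, fun y hy => ?_⟩
  have hyY := hΩY hy
  rw [div_le_iff₀ (by positivity)]
  have h1 : R / 2 ^ j ≤ ρ := by
    rw [div_le_iff₀ (by positivity)]
    linarith
  have h2 := (hvol y hy).trans ((hB.volume_le_pow_mul hyY hR j).trans
    (mul_le_mul_right (measure_mono (hB.mono y _ _ h1)) _))
  have h3 := ENNReal.toReal_mono (by finiteness [(hB.lt_top y hyY ρ).ne]) h2
  rw [ENNReal.toReal_ofReal hc₀.le, ENNReal.toReal_mul] at h3
  simp only [ENNReal.toReal_pow, ENNReal.coe_toReal] at h3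
  rw [measureReal_def]
  nlinarith [ENNReal.toReal_nonneg (a := volume (B y ρ))]

lemma sq_average_le_div {g : E → ℝ} (hg : MemLp g 2 (volume.restrict Y)) {y : E} (hy : y ∈ Y)
    {r c : ℝ} (hr : 0 < r) (hc : 0 < c) (hcr : c ≤ volume.real (B y r)) :
    (⨍ z in B y r, g z) ^ 2 ≤ (∫ z in Y, g z ^ 2) / c := by
  have hI : 0 ≤ ∫ z in Y, g z ^ 2 := integral_nonneg fun _ => sq_nonneg _
  have h1 := hB.ofReal_sq_average_le hg hy hr
  have h2 : (∫⁻ z in B y r, ENNReal.ofReal (g z ^ 2)) / volume (B y r) ≤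
      ENNReal.ofReal (∫ z in Y, g z ^ 2) / ENNReal.ofReal c := by
    refine ENNReal.div_le_div ?_ ?_
    · rw [ofReal_integral_eq_lintegral_ofReal hg.integrable_sq
        (Eventually.of_forall fun _ => sq_nonneg _)]
      exact lintegral_mono_set (hB.subset _ _)
    · exact ENNReal.ofReal_le_of_le_toReal hcr
  rw [← ENNReal.ofReal_div_of_pos hc] at h2
  exact (ENNReal.ofReal_le_ofReal_iff (by positivity)).1 (h1.trans h2)

/-- Balls of a large fixed radius around points of a `B`-bounded set have large volume. -/
lemma exists_forall_le_volume {Ω : Set E} (hΩY : Ω ⊆ Y) {x₀ : E} (hx₀ : x₀ ∈ Y) {d : ℝ}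
    (hd : Ω ⊆ B x₀ d) (hd0 : 0 ≤ d) {v : ℝ≥0∞} (hv : v < volume Y) :
    ∃ R > 0, ∀ y ∈ Ω, v ≤ volume (B y R) := by
  have hU : ⋃ n : ℕ, B x₀ n = Y := by
    refine Subset.antisymm (iUnion_subset fun n => hB.subset _ _) fun y hy => ?_
    obtain ⟨r, hr⟩ := hB.exists_mem x₀ hx₀ y hy
    obtain ⟨n, hn⟩ := exists_nat_ge r
    exact mem_iUnion.2 ⟨n, hB.mono _ _ _ hn hr⟩
  have hlim := tendsto_measure_iUnion_atTop (μ := volume) (s := fun n : ℕ => B x₀ n)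
    (fun a b hab => hB.mono _ _ _ (by exact_mod_cast hab))
  rw [hU] at hlim
  obtain ⟨n, hn⟩ := (hlim.eventually (lt_mem_nhds hv)).exists
  refine ⟨d + n + 1, by positivity, fun y hy => hn.le.trans (measure_mono ?_)⟩
  exact (hB.subset_add y (hΩY hy) x₀ d n
    ((hB.mem_comm x₀ hx₀ y (hΩY hy) d).1 (hd hy))).trans (hB.mono _ _ _ (by linarith))

/-- A function supported in a small part of a ball is controlled in the mean by its oscillation. -/
lemma abs_average_le_of_support {φ : E → ℝ} (hφ : IntegrableOn φ Y) {Ω : Set E}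
    (hΩ : MeasurableSet Ω) (hsupp : ∀ x ∉ Ω, φ x = 0) {y : E} (hy : y ∈ Y) {r : ℝ} (hr : 0 < r)
    (hΩv : 2 * volume Ω ≤ volume (B y r)) :
    |⨍ z in B y r, φ z| ≤ 2 * ⨍ z in B y r, |φ z - ⨍ w in B y r, φ w| := by
  set a := ⨍ w in B y r, φ w with ha
  have hBt := (hB.lt_top y hy r).ne
  have v1 : 0 < volume.real (B y r) := ENNReal.toReal_pos (hB.pos y hy _ hr).ne' hBt
  have hBm := hB.measurableSet_ball hy r
  have hi : IntegrableOn (fun z => |φ z - a|) (B y r) :=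
    ((hφ.mono_set (hB.subset _ _)).sub (integrableOn_const hBt)).abs
  have h1 : volume.real (B y r \ Ω) * |a| ≤ ∫ z in B y r, |φ z - a| := by
    calc volume.real (B y r \ Ω) * |a| = ∫ z in B y r \ Ω, |φ z - a| := by
          rw [setIntegral_congr_fun (g := fun _ => |a|) (hBm.diff hΩ) fun z hz => by
            simp [hsupp z hz.2]]
          simp
      _ ≤ _ := setIntegral_mono_set hi (Eventually.of_forall fun _ => abs_nonneg _)
          sdiff_subset.eventuallyLE
  -- At least half of the ball lies off `Ω`, where the oscillation `|φ - a|` equals `|a|`.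
  have h2 : volume.real (B y r) ≤ 2 * volume.real (B y r \ Ω) := by
    have h3 : volume.real (B y r) ≤ volume.real Ω + volume.real (B y r \ Ω) := by
      have hΩt : volume Ω ≠ ⊤ := fun h => by simp [h, hBt] at hΩv
      have h4 : volume (B y r) ≤ volume Ω + volume (B y r \ Ω) :=
        (measure_le_inter_add_sdiff volume (B y r) Ω).trans
          (add_le_add_left (measure_mono inter_subset_right) _)
      have hdt : volume (B y r \ Ω) ≠ ⊤ := measure_ne_top_of_subset sdiff_subset hBt
      have h5 := ENNReal.toReal_mono (by finiteness) h4
      rwa [ENNReal.toReal_add hΩt hdt] at h5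
    have h6 := ENNReal.toReal_mono hBt hΩv
    rw [ENNReal.toReal_mul] at h6
    simp only [ENNReal.toReal_ofNat, ← measureReal_def] at h6
    linarith
  rw [setAverage_eq, smul_eq_mul, ← div_eq_inv_mul, mul_div_assoc', le_div_iff₀ v1]
  nlinarith [abs_nonneg a]

end IsDoublingBallFamily

section TopScale

variable {N m : ℕ} {X : Fin m → EuclideanSpace ℝ (Fin N) → EuclideanSpace ℝ (Fin N)}
  {P Y Ω : Set (EuclideanSpace ℝ (Fin N))}

lemma setIntegral_xGrad_eq {φ : EuclideanSpace ℝ (Fin N) → ℝ} (hΩY : Ω ⊆ Y)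
    (hY : MeasurableSet Y) (hφΩ : tsupport φ ⊆ Ω) :
    ∫ x in Y, ‖xGrad X φ x‖ ^ 2 = ∫ x in Ω, ‖xGrad X φ x‖ ^ 2 :=
  setIntegral_eq_of_subset_of_forall_sdiff_eq_zero hY hΩY fun x hx => by
    rw [xGrad_eq_zero fun h => hx.2 (hφΩ h)]
    simp

/-- There is a scale at which all averages of test functions are controlled by the `X`-gradient. -/
theorem exists_top_scale (hN : 0 < N) (hX : ∀ j, LocallyLipschitz (X j)) (hΩ : IsOpen Ω)
    (hΩb : Bornology.IsBounded Ω) (hne : Ω.Nonempty) (hY : Y = Ω ∨ Y = univ)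
    (hconn : IsXConnected X P Y) (hcomp : IsEuclideanCompatible X P Y) {D : ℝ≥0}
    (hB : IsDoublingBallFamily Y (ccBall X P Y) D) (hpoin : HasPoincareInequality X P Y) :
    ∃ R c₀ C₁ : ℝ, 0 < R ∧ 0 < c₀ ∧ 0 ≤ C₁ ∧
      (∀ y ∈ Ω, ENNReal.ofReal c₀ ≤ volume (ccBall X P Y y R)) ∧
      ∀ φ, ContDiff ℝ 1 φ → HasCompactSupport φ → tsupport φ ⊆ Ω → ∀ y ∈ Ω,
        (⨍ z in ccBall X P Y y R, φ z) ^ 2 ≤ C₁ * ∫ x in Y, ‖xGrad X φ x‖ ^ 2 := by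
  have hXc : ∀ j, Continuous (X j) := fun j => (hX j).continuous
  obtain ⟨CP, ν, hCP, hν, hP⟩ := hpoin
  have hΩv : volume Ω < ⊤ := hΩb.measure_lt_top
  have hΩp : 0 < volume Ω := hΩ.measure_pos volume hne
  rcases hY with rfl | rfl
  · obtain ⟨R₀, hR₀, hball⟩ := hB.exists_ball_eq_of_volume_lt_top hΩ.measurableSet hΩv
    -- Both the ball of radius `R` and its Poincaré dilate of radius `ν * R` must be all of `Y`.
    set R := max R₀ (R₀ / ν) with hR
    have hRpos : 0 < R := lt_max_of_lt_left hR₀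
    have hb1 : ∀ x ∈ Y, ∀ r, R₀ ≤ r → ccBall X P Y x r = Y := fun x hx r hr =>
      Subset.antisymm (hB.subset _ _) ((hball x hx).symm.subset.trans (hB.mono _ _ _ hr))
    have hνR : R₀ ≤ ν * R := by
      have := le_max_right R₀ (R₀ / ν)
      rwa [div_le_iff₀' hν] at this
    have v1 : 0 < volume.real Y := ENNReal.toReal_pos hΩp.ne' hΩv.ne
    obtain ⟨x₀, hx₀⟩ := hne
    obtain ⟨C, hC, hCφ⟩ := exists_abs_average_le_of_eq hN hX hΩ hΩb ⟨x₀, hx₀⟩ hconn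
      (D := R₀) (fun x hx => hball x hx) (K := CP * R) (by positivity) (by
        intro φ hφ hφs
        have h1 := hP x₀ hx₀ R hRpos φ hφ hφs
        rw [hb1 x₀ hx₀ R (le_max_left _ _), hb1 x₀ hx₀ _ hνR, setAverage_eq _ (fun y => |_|),
          setAverage_eq _ (fun y => ‖xGrad X φ y‖)] at h1
        simp only [smul_eq_mul] at h1
        rw [← div_eq_inv_mul, div_le_iff₀ v1] at h1
        refine h1.trans_eq ?_
        field_simp)
    refine ⟨R, volume.real Y, C ^ 2 * volume.real Y, hRpos, v1, by positivity, fun y hy => ?_,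
      fun φ hφ hφs hφΩ y hy => ?_⟩
    · rw [hb1 y hy R (le_max_left _ _), measureReal_def, ENNReal.ofReal_toReal hΩv.ne]
    · rw [hb1 y hy R (le_max_left _ _)]
      have h1 := hCφ φ hφ hφs hφΩ
      have h2 := hB.sq_average_le_div (((memLp_norm_xGrad hXc hφ hφs)).restrict Y) hy hRpos v1
        (by rw [hb1 y hy R (le_max_left _ _)])
      rw [hb1 y hy R (le_max_left _ _), setAverage_eq, smul_eq_mul, mul_pow,
        le_div_iff₀ v1, inv_pow, inv_mul_eq_div, div_mul_eq_mul_div, div_le_iff₀ (by positivity)] at h2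
      have h3 : (∫ x in Y, ‖xGrad X φ x‖) ^ 2 ≤ volume.real Y * ∫ x in Y, ‖xGrad X φ x‖ ^ 2 := by
        refine le_of_mul_le_mul_right (h2.trans_eq ?_) v1
        ring
      calc (⨍ z in Y, φ z) ^ 2 = |⨍ z in Y, φ z| ^ 2 := (sq_abs _).symm
        _ ≤ (C * ∫ x in Y, ‖xGrad X φ x‖) ^ 2 := by gcongr
        _ = C ^ 2 * (∫ x in Y, ‖xGrad X φ x‖) ^ 2 := mul_pow _ _ _
        _ ≤ C ^ 2 * (volume.real Y * ∫ x in Y, ‖xGrad X φ x‖ ^ 2) := by gcongr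
        _ = _ := by ring
  · obtain ⟨x₀, hx₀⟩ := hne
    have hcont : Continuous (fun y => ccDist X P x₀ y) := by
      have h1 := continuousOn_ccDist hXc hconn hcomp
      rw [univ_prod_univ, continuousOn_univ] at h1
      exact h1.comp (Continuous.prodMk continuous_const continuous_id)
    obtain ⟨d, hd⟩ := hΩb.isCompact_closure.exists_bound_of_continuousOn hcont.continuousOn
    have hdΩ : Ω ⊆ ccBall X P univ x₀ (|d| + 1) := fun y hy =>
      ⟨mem_univ _, by
        have h1 := hd y (subset_closure hy)
        have h2 := le_abs_self (ccDist X P x₀ y)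
        rw [Real.norm_eq_abs] at h1
        linarith [le_abs_self d]⟩
    have : Nonempty (Fin N) := ⟨⟨0, hN⟩⟩
    have hinf : volume (univ : Set (EuclideanSpace ℝ (Fin N))) = ⊤ := by
      have : Nontrivial (EuclideanSpace ℝ (Fin N)) := inferInstance
      exact measure_univ_of_isAddLeftInvariant volume
    -- The whole space has infinite volume, so some radius makes `Ω` no more than half of every ball
    -- centred in it.
    obtain ⟨R, hR, hRv⟩ := hB.exists_forall_le_volume (subset_univ Ω) (mem_univ x₀) hdΩ
      (by positivity) (v := 2 * volume Ω) (by rw [hinf]; finiteness [hΩv.ne])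
    have hc₀ : 0 < 2 * volume.real Ω := by
      have := ENNReal.toReal_pos hΩp.ne' hΩv.ne
      rw [measureReal_def]
      positivity
    have hvol : ∀ y ∈ Ω, ENNReal.ofReal (2 * volume.real Ω) ≤ volume (ccBall X P univ y R) := by
      intro y hy
      refine le_trans (le_of_eq ?_) (hRv y hy)
      rw [ENNReal.ofReal_mul zero_le_two, measureReal_def, ENNReal.ofReal_toReal hΩv.ne]
      simp
    obtain ⟨c₁, hc₁, hc₁v⟩ := hB.exists_le_volume (subset_univ Ω) hR (mul_pos hν hR) hc₀ hvol
    refine ⟨R, _, (2 * (CP * R)) ^ 2 / c₁, hR, hc₀, by positivity, hvol, ?_⟩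
    intro φ hφ hφs hφΩ y hy
    have h1 := hB.abs_average_le_of_support
      (hφ.continuous.integrable_of_hasCompactSupport hφs).integrableOn hΩ.measurableSet
      (fun x hx => image_eq_zero_of_notMem_tsupport fun h => hx (hφΩ h)) (mem_univ y) hR (hRv y hy)
    have h2 := hP y (mem_univ y) R hR φ hφ hφs
    have h3 := hB.sq_average_le_div ((memLp_norm_xGrad hXc hφ hφs).restrict univ) (mem_univ y)
      (mul_pos hν hR) hc₁ (hc₁v y hy)
    set T := ⨍ z in ccBall X P univ y (ν * R), ‖xGrad X φ z‖ with hT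
    have h4 : |⨍ z in ccBall X P univ y R, φ z| ≤ 2 * (CP * R) * T := by linarith
    calc (⨍ z in ccBall X P univ y R, φ z) ^ 2 = |⨍ z in ccBall X P univ y R, φ z| ^ 2 :=
          (sq_abs _).symm
      _ ≤ (2 * (CP * R) * T) ^ 2 := by gcongr
      _ = (2 * (CP * R)) ^ 2 * T ^ 2 := mul_pow _ _ _
      _ ≤ (2 * (CP * R)) ^ 2 * ((∫ x in univ, ‖xGrad X φ x‖ ^ 2) / c₁) := by gcongr
      _ = _ := by ring

/-- Weak type Sobolev inequality for test functions on `Ω`. -/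
theorem exists_weak_sobolev (hN : 0 < N) (hX : ∀ j, LocallyLipschitz (X j)) (hΩ : IsOpen Ω)
    (hΩb : Bornology.IsBounded Ω) (hne : Ω.Nonempty) (hY : Y = Ω ∨ Y = univ)
    (hconn : IsXConnected X P Y) (hcomp : IsEuclideanCompatible X P Y) {Q : ℝ}
    (hdoub : IsDoublingSpace X P Y Q) (hpoin : HasPoincareInequality X P Y) {q : ℝ} (hq : 1 < q)
    (hqQ : q * (Q - 2) < Q) :
    ∃ C : ℝ, 0 ≤ C ∧ ∀ φ, ContDiff ℝ 1 φ → HasCompactSupport φ → tsupport φ ⊆ Ω →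
      ∀ t > 0, volume {y ∈ Ω | t < |φ y|} ≤
        ENNReal.ofReal (C * ((∫ x in Ω, ‖xGrad X φ x‖ ^ 2) / t ^ 2) ^ q) := by
  have hXc : ∀ j, Continuous (X j) := fun j => (hX j).continuous
  have hYo : IsOpen Y := by rcases hY with rfl | rfl; exacts [hΩ, isOpen_univ]
  have hΩY : Ω ⊆ Y := by rcases hY with rfl | rfl; exacts [subset_rfl, subset_univ _]
  have hB := isDoublingBallFamily_ccBall hXc hYo hconn hcomp hdoub
  obtain ⟨R, c₀, C₁, hR, hc₀, hC₁, hvol, hav⟩ :=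
    exists_top_scale hN hX hΩ hΩb hne hY hconn hcomp hB hpoin
  obtain ⟨CP, ν, hCP, hν, hP⟩ := hpoin
  -- For `D = 2 ^ Q` the summability condition `D ^ (q - 1) < 4 ^ q` reads `Q * (q - 1) < 2 * q`,
  -- that is `q * (Q - 2) < Q`.
  obtain ⟨C, hC, hmain⟩ := hB.weak_sobolev hYo.measurableSet hΩY hΩb.measure_lt_top hR hc₀ hvol
    hC₁ hCP hν hq (by
      rw [Real.coe_toNNReal _ (by positivity), ← Real.rpow_mul zero_le_two,
        show (4 : ℝ) = 2 ^ (2 : ℝ) by norm_num, ← Real.rpow_mul zero_le_two]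
      exact Real.rpow_lt_rpow_of_exponent_lt one_lt_two (by linarith))
  refine ⟨C, hC, fun φ hφ hφs hφΩ t ht => ?_⟩
  have := hmain φ (fun x => ‖xGrad X φ x‖) hφ.continuous
    (hφ.continuous.integrable_of_hasCompactSupport hφs).integrableOn
    (continuous_xGrad hXc hφ).norm.measurable (fun x => norm_nonneg _)
    ((memLp_norm_xGrad hXc hφ hφs).restrict Y) (fun y hy r hr => hP y hy r hr φ hφ hφs)
    (hav φ hφ hφs hφΩ) t ht
  rwa [setIntegral_xGrad_eq hΩY hYo.measurableSet hφΩ] at this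

end TopScale

/-! ### `L²` convergence and smooth truncations -/

lemma integral_norm_sq_eq_toReal_eLpNorm_sq {α E : Type*} [MeasurableSpace α]
    [NormedAddCommGroup E] {μ : Measure α} {f : α → E} (hf : MemLp f 2 μ) :
    ∫ x, ‖f x‖ ^ 2 ∂μ = (eLpNorm f 2 μ).toReal ^ 2 := by
  have hI : 0 ≤ ∫ x, ‖f x‖ ^ 2 ∂μ := integral_nonneg fun _ => sq_nonneg _
  rw [hf.eLpNorm_eq_integral_rpow_norm two_ne_zero (by norm_num)]
  simp only [ENNReal.toReal_ofNat, Real.rpow_ofNat]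
  rw [ENNReal.toReal_ofReal (by positivity), ← Real.rpow_natCast, ← Real.rpow_mul hI]
  norm_num

lemma tendsto_eLpNorm_two_zero_of_dominated {α E F : Type*} [MeasurableSpace α]
    [NormedAddCommGroup E] [NormedAddCommGroup F] {μ : Measure α} {f : ℕ → α → E} {g : α → F}
    (hf : ∀ n, AEStronglyMeasurable (f n) μ) (hg : MemLp g 2 μ)
    (hb : ∀ n, ∀ᵐ x ∂μ, ‖f n x‖ ≤ ‖g x‖) (hlim : ∀ᵐ x ∂μ, Tendsto (fun n => f n x) atTop (𝓝 0)) :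
    Tendsto (fun n => eLpNorm (f n) 2 μ) atTop (𝓝 0) := by
  have h1 : Tendsto (fun n => ∫⁻ x, ‖f n x‖ₑ ^ (2 : ℝ) ∂μ) atTop (𝓝 (∫⁻ _, 0 ∂μ)) := by
    refine tendsto_lintegral_of_dominated_convergence' (fun x => ‖g x‖ₑ ^ (2 : ℝ))
      (fun n => (hf n).enorm.pow_const _) (fun n => ?_) ?_ ?_
    · filter_upwards [hb n] with x hx
      gcongr
      exact enorm_le_iff_norm_le.2 hx
    · have := lintegral_rpow_enorm_lt_top_of_eLpNorm_lt_top two_ne_zero (by norm_num) hg.2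
      simpa using this.ne
    · filter_upwards [hlim] with x hx
      have h2 := ((ENNReal.continuous_rpow_const (y := 2)).tendsto _).comp hx.enorm
      simpa [Function.comp_def] using h2
  rw [lintegral_zero] at h1
  have h2 := ((ENNReal.continuous_rpow_const (y := 1 / 2)).tendsto _).comp h1
  simp only [eLpNorm_eq_lintegral_rpow_enorm_toReal (two_ne_zero' ℝ≥0∞) (by norm_num),
    ENNReal.toReal_ofNat]
  simpa [Function.comp_def] using h2

lemma exists_abs_deriv_smoothTransition_le :
    ∃ c : ℝ, 0 < c ∧ ∀ x, |deriv Real.smoothTransition x| ≤ c := by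
  have hc : Continuous (deriv Real.smoothTransition) :=
    (Real.smoothTransition.contDiff (n := 1)).continuous_deriv (by simp)
  obtain ⟨c, hcb⟩ := isCompact_Icc.exists_bound_of_continuousOn (hc.continuousOn (s := Icc 0 1))
  refine ⟨|c| + 1, by positivity, fun x => ?_⟩
  by_cases hx : x ∈ Icc (0 : ℝ) 1
  · have := hcb x hx
    rw [Real.norm_eq_abs] at this
    linarith [le_abs_self c]
  · have h0 : deriv Real.smoothTransition x = 0 := by
      rcases lt_or_ge x 0 with h | h
      · have : Real.smoothTransition =ᶠ[𝓝 x] fun _ => 0 := by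
          filter_upwards [Iio_mem_nhds h] with y hy
          exact Real.smoothTransition.zero_of_nonpos (le_of_lt hy)
        rw [this.deriv_eq, deriv_const]
      · have h1 : 1 < x := by
          by_contra hcon
          exact hx ⟨h, not_lt.1 hcon⟩
        have : Real.smoothTransition =ᶠ[𝓝 x] fun _ => 1 := by
          filter_upwards [Ioi_mem_nhds h1] with y hy
          exact Real.smoothTransition.one_of_one_le (le_of_lt hy)
        rw [this.deriv_eq, deriv_const]
    rw [h0, abs_zero]
    positivity

/-- A smooth odd truncation, vanishing on `[-k, k]` and equal to `±1` outside `(-h, h)`. -/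
noncomputable def smoothTrunc (k h t : ℝ) : ℝ :=
  Real.smoothTransition ((t - k) / (h - k)) - Real.smoothTransition ((-t - k) / (h - k))

section SmoothTrunc

variable {k h t : ℝ}

lemma contDiff_smoothTrunc (k h : ℝ) : ContDiff ℝ ∞ (smoothTrunc k h) := by
  have h1 : ContDiff ℝ ∞ Real.smoothTransition := Real.smoothTransition.contDiff
  exact (h1.comp ((contDiff_id.sub contDiff_const).div_const _)).sub
    (h1.comp ((contDiff_id.neg.sub contDiff_const).div_const _))

lemma smoothTrunc_eq_zero (hkh : k < h) (ht : |t| ≤ k) : smoothTrunc k h t = 0 := by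
  obtain ⟨h1, h2⟩ := abs_le.1 ht
  rw [smoothTrunc, Real.smoothTransition.zero_of_nonpos, Real.smoothTransition.zero_of_nonpos,
    sub_zero]
  · exact div_nonpos_of_nonpos_of_nonneg (by linarith) (by linarith)
  · exact div_nonpos_of_nonpos_of_nonneg (by linarith) (by linarith)

lemma abs_smoothTrunc_le_one : |smoothTrunc k h t| ≤ 1 := by
  rw [smoothTrunc, abs_le]
  have a1 := Real.smoothTransition.nonneg ((t - k) / (h - k))
  have a2 := Real.smoothTransition.le_one ((t - k) / (h - k))
  have a3 := Real.smoothTransition.nonneg ((-t - k) / (h - k))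
  have a4 := Real.smoothTransition.le_one ((-t - k) / (h - k))
  constructor <;> linarith

lemma abs_smoothTrunc_eq_one (hk : 0 ≤ k) (hkh : k < h) (ht : h ≤ |t|) :
    |smoothTrunc k h t| = 1 := by
  have hpos : 0 < h - k := by linarith
  rcases le_total 0 t with h0 | h0
  · rw [abs_of_nonneg h0] at ht
    rw [smoothTrunc, Real.smoothTransition.one_of_one_le, Real.smoothTransition.zero_of_nonpos]
    · simp
    · exact div_nonpos_of_nonpos_of_nonneg (by linarith) hpos.le
    · rw [one_le_div hpos]; linarith
  · rw [abs_of_nonpos h0] at ht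
    rw [smoothTrunc, Real.smoothTransition.zero_of_nonpos, Real.smoothTransition.one_of_one_le]
    · simp
    · rw [one_le_div hpos]; linarith
    · exact div_nonpos_of_nonpos_of_nonneg (by linarith) hpos.le

lemma deriv_smoothTrunc (k h t : ℝ) : deriv (smoothTrunc k h) t =
    (deriv Real.smoothTransition ((t - k) / (h - k)) +
      deriv Real.smoothTransition ((-t - k) / (h - k))) / (h - k) := by
  have hd : ∀ x, HasDerivAt Real.smoothTransition (deriv Real.smoothTransition x) x := fun x =>
    ((Real.smoothTransition.contDiff (n := 1)).differentiable (by simp) x).hasDerivAt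
  have h1 := (hd ((t - k) / (h - k))).comp t (((hasDerivAt_id t).sub_const k).div_const (h - k))
  have h2 := (hd ((-t - k) / (h - k))).comp t
    (((hasDerivAt_id t).neg.sub_const k).div_const (h - k))
  have h3 : HasDerivAt (smoothTrunc k h) _ t := h1.sub h2
  rw [h3.deriv]
  ring

lemma deriv_smoothTrunc_nonneg (hkh : k < h) : 0 ≤ deriv (smoothTrunc k h) t := by
  rw [deriv_smoothTrunc]
  exact div_nonneg (add_nonneg (Real.smoothTransition.monotone.deriv_nonneg)
    (Real.smoothTransition.monotone.deriv_nonneg)) (by linarith)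

lemma deriv_smoothTrunc_le {c : ℝ} (hc : ∀ x, |deriv Real.smoothTransition x| ≤ c) (hkh : k < h) :
    deriv (smoothTrunc k h) t ≤ 2 * c / (h - k) := by
  rw [deriv_smoothTrunc]
  have h1 := (abs_le.1 (hc ((t - k) / (h - k)))).2
  have h2 := (abs_le.1 (hc ((-t - k) / (h - k)))).2
  have : 0 < h - k := by linarith
  gcongr
  linarith

end SmoothTrunc

/-! ### Iteration on superlevel sets -/

/-- Stampacchia's iteration lemma. -/
lemma eq_zero_of_stampacchia {a : ℝ → ℝ} {C F V q b d : ℝ} (hV : 0 < V) (hC : 0 ≤ C)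
    (hF : 0 ≤ F) (hd : 0 < d) (hq : 0 < q) (hb : 1 < b) (ha0 : ∀ k, 0 ≤ a k) (hanti : Antitone a)
    (haV : a 0 ≤ V)
    (hstep : ∀ k h, 0 ≤ k → k < h → a h ≤ C * (F / (h - k)) ^ q * a k ^ b)
    (hdC : C * F ^ q * V ^ (b - 1) * 2 ^ q ≤ 2 ^ (-(q / (b - 1))) * d ^ q) : a d = 0 := by
  have hb1 : 0 < b - 1 := by linarith
  -- With this ratio `l ^ (b - 1) = 2 ^ (-q)`: the gain from the power `b > 1` cancels the loss `(2
  -- ^ q) ^ n` from halving the gaps between levels.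
  set l : ℝ := 2 ^ (-(q / (b - 1))) with hl
  have hl0 : 0 < l := by positivity
  have hl1 : l < 1 := Real.rpow_lt_one_of_one_lt_of_neg one_lt_two (neg_lt_zero.2 (by positivity))
  have hlb : l ^ (b - 1) = 2 ^ (-q) := by
    rw [hl, ← Real.rpow_mul zero_le_two]
    congr 1
    field_simp
  have key : ∀ n : ℕ, a (d * (1 - (1 / 2) ^ n)) ≤ V * l ^ n := by
    intro n
    induction n with
    | zero => simpa using haV
    | succ n ih =>
      have hpow : (0 : ℝ) < (1 / 2) ^ n := by positivity
      have hpow1 : ((1 : ℝ) / 2) ^ n ≤ 1 := pow_le_one₀ (by norm_num) (by norm_num)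
      have h1 := hstep (d * (1 - (1 / 2) ^ n)) (d * (1 - (1 / 2) ^ (n + 1)))
        (mul_nonneg hd.le (by linarith)) (by rw [pow_succ]; nlinarith)
      have h2 : d * (1 - (1 / 2) ^ (n + 1)) - d * (1 - (1 / 2) ^ n) = d / 2 ^ (n + 1) := by
        rw [pow_succ, pow_succ, one_div_pow]
        field_simp
        ring
      rw [h2] at h1
      refine h1.trans ?_
      have h3 : (F / (d / 2 ^ (n + 1))) ^ q = F ^ q * (2 ^ q * (2 ^ q) ^ n) / d ^ q := by
        rw [div_div_eq_mul_div, Real.div_rpow (by positivity) hd.le, Real.mul_rpow hF (by positivity),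
          pow_succ', Real.mul_rpow zero_le_two (by positivity), ← Real.rpow_natCast,
          ← Real.rpow_mul zero_le_two, mul_comm (n : ℝ) q, Real.rpow_mul zero_le_two,
          Real.rpow_natCast]
      have h4 : a (d * (1 - (1 / 2) ^ n)) ^ b ≤ (V * l ^ n) ^ b :=
        Real.rpow_le_rpow (ha0 _) ih (by linarith)
      have h5 : (V * l ^ n) ^ b = V ^ (b - 1) * V * (l ^ n * ((2 ^ q) ^ n)⁻¹) := by
        have e1 : b = (b - 1) + 1 := by ring
        rw [e1, Real.rpow_add_one (by positivity), Real.mul_rpow hV.le (by positivity),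
          ← e1, ← Real.rpow_natCast l n, ← Real.rpow_mul hl0.le, mul_comm (n : ℝ),
          Real.rpow_mul hl0.le, hlb, Real.rpow_neg zero_le_two, Real.rpow_natCast, inv_pow,
          Real.rpow_natCast]
        ring
      calc C * (F / (d / 2 ^ (n + 1))) ^ q * a (d * (1 - (1 / 2) ^ n)) ^ b
          ≤ C * (F / (d / 2 ^ (n + 1))) ^ q * (V * l ^ n) ^ b := by gcongr
        _ = (C * F ^ q * V ^ (b - 1) * 2 ^ q) / d ^ q * (V * l ^ n) := by
          rw [h3, h5]
          field_simp
        _ ≤ (l * d ^ q) / d ^ q * (V * l ^ n) := by gcongr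
        _ = V * l ^ (n + 1) := by
          rw [mul_div_cancel_right₀ _ (by positivity), pow_succ]
          ring
  refine le_antisymm ?_ (ha0 d)
  have hlim : Tendsto (fun n : ℕ => V * l ^ n) atTop (𝓝 0) := by
    simpa using (tendsto_pow_atTop_nhds_zero_of_lt_one hl0.le hl1).const_mul V
  refine ge_of_tendsto' hlim fun n => (hanti ?_).trans (key n)
  have : (0 : ℝ) < (1 / 2) ^ n := by positivity
  nlinarith

/-! ### Chain rule and weak Sobolev inequality in `W₀^{1,2}(Ω, X)` -/

section MemW0

variable {N m : ℕ} {X : Fin m → EuclideanSpace ℝ (Fin N) → EuclideanSpace ℝ (Fin N)}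
  {Ω : Set (EuclideanSpace ℝ (Fin N))} {u : EuclideanSpace ℝ (Fin N) → ℝ}
  {G : EuclideanSpace ℝ (Fin N) → EuclideanSpace ℝ (Fin m)}

lemma xGrad_comp {φ : EuclideanSpace ℝ (Fin N) → ℝ} {T : ℝ → ℝ} (hT : Differentiable ℝ T)
    (hφ : Differentiable ℝ φ) (x : EuclideanSpace ℝ (Fin N)) :
    xGrad X (fun y => T (φ y)) x = deriv T (φ x) • xGrad X φ x := by
  have h := ((hT (φ x)).hasDerivAt.comp_hasFDerivAt x (hφ x).hasFDerivAt).fderiv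
  simp only [Function.comp_def] at h
  ext j
  simp [xGrad, h]

/-- The chain rule in `W₀^{1,2}(Ω, X)`. -/
lemma MemW0.comp (hX : ∀ j, Continuous (X j)) (hu : MemW0 X Ω u G) {T : ℝ → ℝ} {K : ℝ}
    (hT : ContDiff ℝ ∞ T) (hT0 : T 0 = 0) (hK : ∀ t, |deriv T t| ≤ K) :
    MemW0 X Ω (fun x => T (u x)) (fun x => deriv T (u x) • G x) := by
  obtain ⟨hu2, hG2, φ, hφ, hφu, hφG⟩ := hu
  set μ := volume.restrict Ω
  have hTd : Differentiable ℝ T := hT.differentiable (by simp)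
  have hT'c : Continuous (deriv T) := hT.continuous_deriv (by simp)
  have hTlip : ∀ s t, |T s - T t| ≤ K * |s - t| := fun s t => by
    have := Convex.norm_image_sub_le_of_norm_deriv_le (s := univ) (f := T) (x := t) (y := s)
      (fun x _ => hTd x) (fun x _ => hK x) convex_univ (mem_univ _) (mem_univ _)
    simpa using this
  have hφd : ∀ n, Differentiable ℝ (φ n) := fun n => (hφ n).1.differentiable (by simp)
  have hφ1 : ∀ n, ContDiff ℝ 1 (φ n) := fun n => (hφ n).1.of_le (by simp)
  have hm : TendstoInMeasure μ φ atTop u :=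
    tendstoInMeasure_of_tendsto_eLpNorm two_ne_zero
      (fun n => (hφ n).1.continuous.aestronglyMeasurable) hu2.aestronglyMeasurable hφu
  -- Almost everywhere convergence gives `deriv T (φ (ns n)) → deriv T u` pointwise; multiplied by
  -- `G`, the difference is dominated by `2 * K * ‖G‖`.
  obtain ⟨ns, hns, hae⟩ := hm.exists_seq_tendsto_ae
  have hT'u : AEStronglyMeasurable (fun x => deriv T (u x)) μ :=
    hT'c.comp_aestronglyMeasurable hu2.aestronglyMeasurable
  have hK0 : 0 ≤ K := (abs_nonneg _).trans (hK 0)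
  refine ⟨?_, ?_, fun n x => T (φ (ns n) x), fun n => ⟨hT.comp (hφ _).1, ?_, ?_⟩, ?_, ?_⟩
  · refine hu2.of_le_mul (c := K) (hT.continuous.comp_aestronglyMeasurable hu2.aestronglyMeasurable)
      (Eventually.of_forall fun x => ?_)
    simpa [hT0] using hTlip (u x) 0
  · refine hG2.of_le_mul (c := K) (hT'u.smul hG2.aestronglyMeasurable)
      (Eventually.of_forall fun x => ?_)
    rw [norm_smul]
    exact mul_le_mul_of_nonneg_right (hK _) (norm_nonneg _)
  · exact (hφ _).2.1.comp_left hT0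
  · exact (closure_mono (Function.support_comp_subset hT0 _)).trans (hφ _).2.2
  · have h1 : Tendsto (fun n => ENNReal.ofReal K *
        eLpNorm (fun x => φ (ns n) x - u x) 2 μ) atTop (𝓝 0) := by
      simpa using ENNReal.Tendsto.const_mul (hφu.comp hns.tendsto_atTop)
        (Or.inr (ENNReal.ofReal_ne_top (r := K)))
    refine tendsto_of_tendsto_of_tendsto_of_le_of_le tendsto_const_nhds h1 (fun _ => zero_le)
      fun n => eLpNorm_le_mul_eLpNorm_of_ae_le_mul (Eventually.of_forall fun x => ?_) 2
    exact hTlip _ _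
  · have hXc : ∀ n, AEStronglyMeasurable (xGrad X (φ n)) μ := fun n =>
      (continuous_xGrad hX (hφ1 n)).aestronglyMeasurable
    have hT'φ : ∀ n, AEStronglyMeasurable (fun x => deriv T (φ n x)) μ := fun n =>
      (hT'c.comp (hφ n).1.continuous).aestronglyMeasurable
    have h1 : Tendsto (fun n => ENNReal.ofReal K *
        eLpNorm (fun x => xGrad X (φ (ns n)) x - G x) 2 μ) atTop (𝓝 0) := by
      simpa using ENNReal.Tendsto.const_mul (hφG.comp hns.tendsto_atTop)
        (Or.inr (ENNReal.ofReal_ne_top (r := K)))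
    have h2 : Tendsto (fun n => eLpNorm (fun x => (deriv T (φ (ns n) x) - deriv T (u x)) • G x)
        2 μ) atTop (𝓝 0) := by
      refine tendsto_eLpNorm_two_zero_of_dominated (g := fun x => (2 * K) • G x)
        (fun n => ((hT'φ _).sub hT'u).smul hG2.aestronglyMeasurable)
        (hG2.const_smul (2 * K))
        (fun n => Eventually.of_forall fun x => ?_) ?_
      · rw [norm_smul, norm_smul]
        refine mul_le_mul_of_nonneg_right ?_ (norm_nonneg _)
        rw [Real.norm_of_nonneg (mul_nonneg zero_le_two hK0), Real.norm_eq_abs]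
        exact (abs_sub _ _).trans (by linarith [hK (φ (ns n) x), hK (u x)])
      · filter_upwards [hae] with x hx
        have := (((hT'c.tendsto (u x)).comp hx).sub_const (deriv T (u x))).smul_const (G x)
        simpa [Function.comp_def] using this
    have h3 := h1.add h2
    rw [add_zero] at h3
    refine tendsto_of_tendsto_of_tendsto_of_le_of_le tendsto_const_nhds h3 (fun _ => zero_le)
      fun n => ?_
    have h4 : (fun x => xGrad X (fun y => T (φ (ns n) y)) x - deriv T (u x) • G x) =
        (fun x => deriv T (φ (ns n) x) • (xGrad X (φ (ns n)) x - G x)) +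
        fun x => (deriv T (φ (ns n) x) - deriv T (u x)) • G x := by
      funext x
      simp only [Pi.add_apply, xGrad_comp hTd (hφd _), smul_sub, sub_smul]
      abel
    simp only [h4]
    refine (eLpNorm_add_le ((hT'φ _).smul ((hXc _).sub hG2.aestronglyMeasurable))
      (((hT'φ _).sub hT'u).smul hG2.aestronglyMeasurable) (by norm_num)).trans
      (add_le_add_left ?_ _)
    refine eLpNorm_le_mul_eLpNorm_of_ae_le_mul (Eventually.of_forall fun x => ?_) 2
    rw [Pi.smul_apply', norm_smul]
    exact mul_le_mul_of_nonneg_right (hK _) (norm_nonneg _)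

/-- A weak-type Sobolev inequality extends from `C_c^∞(Ω)` to `W₀^{1,2}(Ω, X)`. -/
lemma MemW0.measure_lt_abs_le (hX : ∀ j, Continuous (X j)) (hΩ : IsOpen Ω) {C q : ℝ}
    (hq : 0 < q)
    (hC : ∀ φ : EuclideanSpace ℝ (Fin N) → ℝ, ContDiff ℝ 1 φ → HasCompactSupport φ →
      tsupport φ ⊆ Ω → ∀ t > 0, volume {y ∈ Ω | t < |φ y|} ≤
        ENNReal.ofReal (C * ((∫ x in Ω, ‖xGrad X φ x‖ ^ 2) / t ^ 2) ^ q))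
    (hC0 : 0 ≤ C) (hu : MemW0 X Ω u G) {t : ℝ} (ht : 0 < t) :
    volume.restrict Ω {y | t < |u y|} ≤
      ENNReal.ofReal (C * (4 * (∫ x in Ω, ‖G x‖ ^ 2) / t ^ 2) ^ q) := by
  obtain ⟨hu2, hG2, φ, hφ, hφu, hφG⟩ := hu
  set μ := volume.restrict Ω
  have hφ1 : ∀ n, ContDiff ℝ 1 (φ n) := fun n => (hφ n).1.of_le (by simp)
  have hm : TendstoInMeasure μ φ atTop u :=
    tendstoInMeasure_of_tendsto_eLpNorm two_ne_zero
      (fun n => (hφ n).1.continuous.aestronglyMeasurable) hu2.aestronglyMeasurable hφu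
  have hXc : ∀ n, AEStronglyMeasurable (xGrad X (φ n)) μ := fun n =>
    (continuous_xGrad hX (hφ1 n)).aestronglyMeasurable
  have hXL : ∀ n, MemLp (xGrad X (φ n)) 2 μ := fun n =>
    (memLp_norm_iff (hXc n)).1 ((memLp_norm_xGrad hX (hφ1 n) (hφ n).2.1).restrict Ω)
  set δ : ℕ → ℝ := fun n => (eLpNorm (fun x => xGrad X (φ n) x - G x) 2 μ).toReal
  have hδ : Tendsto δ atTop (𝓝 0) := by
    simpa [Function.comp_def] using (ENNReal.tendsto_toReal ENNReal.zero_ne_top).comp hφG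
  set E : ℝ := (eLpNorm G 2 μ).toReal
  have hE : ∀ n, (eLpNorm (xGrad X (φ n)) 2 μ).toReal ≤ δ n + E := fun n => by
    have h1 := eLpNorm_add_le ((hXc n).sub hG2.aestronglyMeasurable) hG2.aestronglyMeasurable
      (p := 2) (by norm_num)
    rw [sub_add_cancel] at h1
    have h2 := ((hXL n).sub hG2).2.ne
    exact (ENNReal.toReal_mono (ENNReal.add_ne_top.2 ⟨h2, hG2.2.ne⟩) h1).trans_eq
      (ENNReal.toReal_add h2 hG2.2.ne)
  -- Where `|u| > t`, either `|φ n| > t / 2` or `φ n` is at least `t / 2` away from `u`; convergence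
  -- in measure removes the second set. Halving `t` costs the factor `4`.
  have hbound : ∀ n, μ {y | t < |u y|} ≤
      ENNReal.ofReal (C * ((δ n + E) ^ 2 / (t / 2) ^ 2) ^ q) +
        μ {y | ENNReal.ofReal (t / 2) ≤ edist (φ n y) (u y)} := fun n => by
    have hsub : {y | t < |u y|} ⊆ {y | t / 2 < |φ n y|} ∪
        {y | ENNReal.ofReal (t / 2) ≤ edist (φ n y) (u y)} := fun y hy => by
      by_contra hcon
      simp only [mem_union, mem_ofPred_eq, not_or, not_lt, not_le, edist_dist,
        ENNReal.ofReal_lt_ofReal_iff (half_pos ht), Real.dist_eq] at hcon hy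
      have := abs_sub_abs_le_abs_sub (u y) (φ n y)
      rw [abs_sub_comm] at this
      linarith [hcon.1, hcon.2]
    refine (measure_mono hsub).trans ((measure_union_le _ _).trans (add_le_add_left ?_ _))
    have h1 := hC (φ n) (hφ1 n) (hφ n).2.1 (hφ n).2.2 (t / 2) (half_pos ht)
    rw [Measure.restrict_apply' hΩ.measurableSet, inter_comm]
    refine h1.trans (ENNReal.ofReal_le_ofReal ?_)
    rw [integral_norm_sq_eq_toReal_eLpNorm_sq (hXL n)]
    have := hE n
    gcongr
  have hlim : Tendsto (fun n => ENNReal.ofReal (C * ((δ n + E) ^ 2 / (t / 2) ^ 2) ^ q) +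
      μ {y | ENNReal.ofReal (t / 2) ≤ edist (φ n y) (u y)}) atTop
      (𝓝 (ENNReal.ofReal (C * ((0 + E) ^ 2 / (t / 2) ^ 2) ^ q) + 0)) := by
    refine Tendsto.add (ENNReal.tendsto_ofReal ?_)
      (hm _ (ENNReal.ofReal_pos.2 (half_pos ht)))
    exact ((((hδ.add_const E).pow 2).div_const _).rpow_const (Or.inr hq.le)).const_mul C
  refine (ge_of_tendsto' hlim hbound).trans_eq ?_
  rw [integral_norm_sq_eq_toReal_eLpNorm_sq hG2, add_zero, zero_add]
  congr 3
  field_simp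
  ring

end MemW0

/-! ### Energy and level-set estimates for weak solutions -/

/-- `p > Q / 2` makes `1 / (1 - 1 / p) < Q / (Q - 2)`, and any `q` strictly between works: the upper
bound is for Sobolev, the lower one makes the iteration superlinear. At `p = ⊤` the convention `1 /
p.toReal = 0` gives the right exponent. -/
lemma exists_sobolev_exponent {Q : ℝ} (hQ : 2 < Q) {p : ℝ≥0∞} (hp : ENNReal.ofReal (Q / 2) < p) :
    ∃ q : ℝ, 1 < q ∧ q * (Q - 2) < Q ∧ 1 < q * (1 - 1 / p.toReal) := by
  have h1 : 1 / p.toReal < 2 / Q := by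
    rcases eq_or_ne p ⊤ with rfl | hpt
    · simp
      linarith
    · have h2 : Q / 2 < p.toReal := by
        rwa [← ENNReal.ofReal_lt_iff_lt_toReal (by linarith) hpt]
      rw [← one_div_div Q 2]
      exact one_div_lt_one_div_of_lt (by linarith) h2
  have h0 : 0 ≤ 1 / p.toReal := by positivity
  set e := 1 - 1 / p.toReal
  have hQ0 : 2 / Q < 1 := by rw [div_lt_one] <;> linarith
  have he : 0 < e := by simp only [e]; linarith
  have he1 : e ≤ 1 := by simp only [e]; linarith
  have hQe : Q - 2 < e * Q := by
    have : 1 / p.toReal * Q < 2 := (lt_div_iff₀ (by linarith)).1 h1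
    simp only [e]
    linarith
  obtain ⟨q, hq1, hq2⟩ := exists_between (show 1 / e < Q / (Q - 2) by
    rw [div_lt_div_iff₀ he (by linarith)]
    linarith)
  exact ⟨q, ((one_le_div he).2 he1).trans_lt hq1, (lt_div_iff₀ (by linarith)).1 hq2,
    (div_lt_iff₀ he).1 hq1⟩

/-- The integral of `f * v` is controlled by the size of the set off which `v` vanishes. -/
lemma abs_integral_mul_le_of_eq_zero {α : Type*} [MeasurableSpace α] {μ : Measure α}
    [IsFiniteMeasure μ] {f v : α → ℝ} {p : ℝ≥0∞} (hp : 1 ≤ p) (hf : MemLp f p μ)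
    (hv : ∀ x, |v x| ≤ 1) {s : Set α} (hs : ∀ x ∉ s, v x = 0) :
    |∫ x, f x * v x ∂μ| ≤ (eLpNorm f p μ).toReal * μ.real s ^ (1 - 1 / p.toReal) := by
  have he : 0 ≤ 1 - 1 / p.toReal := by
    rcases eq_or_ne p ⊤ with rfl | hpt
    · simp
    · have : 1 ≤ p.toReal := by simpa using ENNReal.toReal_mono hpt hp
      rw [sub_nonneg, div_le_one] <;> linarith
  have h1 : ‖∫ x, f x * v x ∂μ‖ₑ ≤ eLpNorm f p μ * μ s ^ (1 - 1 / p.toReal) := by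
    rw [← setIntegral_eq_integral_of_forall_compl_eq_zero (s := s)
      fun x hx => by rw [hs x hx, mul_zero]]
    calc ‖∫ x in s, f x * v x ∂μ‖ₑ ≤ ∫⁻ x in s, ‖f x * v x‖ₑ ∂μ :=
          enorm_integral_le_lintegral_enorm _
      _ ≤ ∫⁻ x in s, ‖f x‖ₑ ∂μ := lintegral_mono fun x => by
          rw [enorm_le_iff_norm_le, norm_mul]
          exact mul_le_of_le_one_right (norm_nonneg _) (hv x)
      _ = eLpNorm f 1 (μ.restrict s) := by rw [eLpNorm_one_eq_lintegral_enorm]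
      _ ≤ eLpNorm f p (μ.restrict s) *
          μ.restrict s univ ^ (1 / (1 : ℝ≥0∞).toReal - 1 / p.toReal) :=
          eLpNorm_le_eLpNorm_mul_rpow_measure_univ hp
            (hf.aestronglyMeasurable.mono_measure Measure.restrict_le_self)
      _ ≤ _ := by
          rw [Measure.restrict_apply_univ, ENNReal.toReal_one, div_one]
          gcongr
          exact Measure.restrict_le_self
  have h2 := ENNReal.toReal_mono (ENNReal.mul_ne_top hf.2.ne
    (ENNReal.rpow_ne_top_of_nonneg he (measure_ne_top μ s))) h1
  rwa [toReal_enorm, ENNReal.toReal_mul, ← ENNReal.toReal_rpow] at h2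

section WeakSolution

variable {N m : ℕ} {X : Fin m → EuclideanSpace ℝ (Fin N) → EuclideanSpace ℝ (Fin N)}
  {Ω : Set (EuclideanSpace ℝ (Fin N))} {u f : EuclideanSpace ℝ (Fin N) → ℝ}
  {A : EuclideanSpace ℝ (Fin N) → Matrix (Fin m) (Fin m) ℝ}

/-- Caccioppoli's inequality for a truncation of a weak solution. -/
lemma IsWeakSolution.exists_memW0_smoothTrunc (hX : ∀ j, Continuous (X j))
    (hΩb : Bornology.IsBounded Ω) {α β c : ℝ} (hα : 0 < α) (hA : IsEllipticMatrix Ω A α β)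
    (hc : ∀ x, |deriv Real.smoothTransition x| ≤ c) {p : ℝ≥0∞} (hp : 1 ≤ p)
    (hf : MemLp f p (volume.restrict Ω)) (hu : IsWeakSolution X Ω A f u) {k h : ℝ} (hkh : k < h)
    (hk : 0 ≤ k) :
    ∃ H, MemW0 X Ω (fun x => smoothTrunc k h (u x)) H ∧
      ∫ x in Ω, ‖H x‖ ^ 2 ≤ 2 * c / α * ((eLpNorm f p (volume.restrict Ω)).toReal / (h - k)) *
        (volume.restrict Ω).real {x | k < |u x|} ^ (1 - 1 / p.toReal) := by
  obtain ⟨G, hG, hsol⟩ := hu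
  set T := smoothTrunc k h
  set μ := volume.restrict Ω with hμ
  have : IsFiniteMeasure μ := ⟨by
    rw [hμ, Measure.restrict_apply_univ]; exact hΩb.measure_lt_top⟩
  have hhk : 0 < h - k := sub_pos.2 hkh
  have hT0 : ∀ t, 0 ≤ deriv T t := fun t => deriv_smoothTrunc_nonneg hkh
  have hTK : ∀ t, deriv T t ≤ 2 * c / (h - k) := fun t => deriv_smoothTrunc_le hc hkh
  have hc0 : 0 ≤ c := (abs_nonneg _).trans (hc 0)
  have hW : MemW0 X Ω (fun x => T (u x)) (fun x => deriv T (u x) • G x) :=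
    hG.comp hX (contDiff_smoothTrunc k h) (smoothTrunc_eq_zero hkh (by simpa using hk))
      (fun t => by rw [abs_of_nonneg (hT0 t)]; exact hTK t)
  refine ⟨_, hW, ?_⟩
  obtain ⟨hint, heq⟩ := hsol _ _ hW
  -- The energy contains `T'` squared, the tested equation only one factor. The other is bounded by
  -- its maximum `2 * c / (h - k)`, so the estimate is linear in `f`.
  have hle : ∫ x in Ω, ‖deriv T (u x) • G x‖ ^ 2 ≤ ∫ x in Ω, 2 * c / (h - k) / α *
      ((A x *ᵥ (G x).ofLp) ⬝ᵥ (deriv T (u x) • G x).ofLp) := by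
    refine integral_mono_ae (hW.2.1.norm.integrable_sq) (hint.const_mul _) ?_
    filter_upwards [hA.2] with x hx
    have h1 := (hx (G x).ofLp).1
    have h2 : (G x).ofLp ⬝ᵥ (G x).ofLp = ‖G x‖ ^ 2 := by
      rw [EuclideanSpace.real_norm_sq_eq, dotProduct]
      exact Finset.sum_congr rfl fun i _ => (sq _).symm
    rw [h2] at h1
    simp only [norm_smul, Real.norm_eq_abs, abs_of_nonneg (hT0 _), WithLp.ofLp_smul, dotProduct_smul,
      smul_eq_mul]
    rw [mul_pow, sq, mul_assoc, div_mul_eq_mul_div, le_div_iff₀ hα]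
    calc deriv T (u x) * (deriv T (u x) * ‖G x‖ ^ 2) * α
        = deriv T (u x) * (deriv T (u x) * (α * ‖G x‖ ^ 2)) := by ring
      _ ≤ 2 * c / (h - k) * (deriv T (u x) * (A x *ᵥ (G x).ofLp ⬝ᵥ (G x).ofLp)) :=
        mul_le_mul (hTK _) (mul_le_mul_of_nonneg_left h1 (hT0 _))
          (mul_nonneg (hT0 _) (by positivity)) ((hT0 0).trans (hTK 0))
  rw [integral_const_mul, heq] at hle
  have hfv := (le_abs_self _).trans (abs_integral_mul_le_of_eq_zero hp hf
    (v := fun x => T (u x)) (fun x => abs_smoothTrunc_le_one) (s := {x | k < |u x|})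
    fun x hx => smoothTrunc_eq_zero hkh (not_lt.1 hx))
  refine (hle.trans (mul_le_mul_of_nonneg_left hfv (by positivity))).trans_eq ?_
  field_simp

/-- Decay of the distribution function of a weak solution. -/
lemma IsWeakSolution.measure_lt_abs_le (hX : ∀ j, Continuous (X j)) (hΩ : IsOpen Ω)
    (hΩb : Bornology.IsBounded Ω) {α β c C q : ℝ} (hα : 0 < α) (hA : IsEllipticMatrix Ω A α β)
    (hc : ∀ x, |deriv Real.smoothTransition x| ≤ c) {p : ℝ≥0∞} (hp : 1 ≤ p) (hq : 0 < q)
    (hC0 : 0 ≤ C)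
    (hC : ∀ φ : EuclideanSpace ℝ (Fin N) → ℝ, ContDiff ℝ 1 φ → HasCompactSupport φ →
      tsupport φ ⊆ Ω → ∀ t > 0, volume {y ∈ Ω | t < |φ y|} ≤
        ENNReal.ofReal (C * ((∫ x in Ω, ‖xGrad X φ x‖ ^ 2) / t ^ 2) ^ q))
    (hf : MemLp f p (volume.restrict Ω)) (hu : IsWeakSolution X Ω A f u) {k h : ℝ} (hk : 0 ≤ k)
    (hkh : k < h) :
    (volume.restrict Ω).real {x | h < |u x|} ≤ C * (32 * c / α) ^ q *
      ((eLpNorm f p (volume.restrict Ω)).toReal / (h - k)) ^ q *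
        (volume.restrict Ω).real {x | k < |u x|} ^ (q * (1 - 1 / p.toReal)) := by
  obtain ⟨H, hH, hle⟩ := hu.exists_memW0_smoothTrunc hX hΩb hα hA hc hp hf hkh hk
  have hhk : 0 < h - k := sub_pos.2 hkh
  have hc0 : 0 ≤ c := (abs_nonneg _).trans (hc 0)
  -- Height `1 / 2` detects `{|u| > h}`, where the truncation is `±1`. The resulting `4 / (1 / 2) ^
  -- 2 = 16` times the `2 * c / α` of the energy bound is the `32 * c / α` of the statement.
  have h1 := hH.measure_lt_abs_le hX hΩ hq hC hC0 (half_pos one_pos)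
  have hI : 0 ≤ ∫ x in Ω, ‖H x‖ ^ 2 := integral_nonneg fun _ => sq_nonneg _
  have hsub : {x | h < |u x|} ⊆ {y | (1 : ℝ) / 2 < |smoothTrunc k h (u y)|} := fun x hx => by
    rw [mem_ofPred_eq, abs_smoothTrunc_eq_one hk hkh (le_of_lt hx)]
    norm_num
  refine (ENNReal.toReal_le_of_le_ofReal (by positivity) ((measure_mono hsub).trans h1)).trans ?_
  rw [mul_comm q, Real.rpow_mul measureReal_nonneg, mul_assoc, mul_assoc,
    ← Real.mul_rpow (by positivity) (by positivity), ← Real.mul_rpow (by positivity) (by positivity)]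
  gcongr
  calc 4 * (∫ x in Ω, ‖H x‖ ^ 2) / (1 / 2) ^ 2 = 16 * ∫ x in Ω, ‖H x‖ ^ 2 := by ring
    _ ≤ 16 * _ := mul_le_mul_of_nonneg_left hle (by norm_num)
    _ = _ := by ring

end WeakSolution

/-! ### The boundedness theorem -/

theorem theorem4p2 {N m : ℕ} (hN : 2 ≤ N)
    (X : Fin m → EuclideanSpace ℝ (Fin N) → EuclideanSpace ℝ (Fin N))
    (hX : ∀ j, LocallyLipschitz (X j))
    (Ω : Set (EuclideanSpace ℝ (Fin N))) (hΩ : IsOpen Ω) (hΩb : Bornology.IsBounded Ω)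
    -- the space `Y` that carries the control distance, and the region `P` of its subunit paths
    (Y P : Set (EuclideanSpace ℝ (Fin N))) (hY : Y = Ω ∨ Y = univ) (hP : P = Y ∨ P = univ)
    (hconn : IsXConnected X P Y) (hcomp : IsEuclideanCompatible X P Y)
    (Q : ℝ) (hQ : 2 < Q) (hdoub : IsDoublingSpace X P Y Q)
    (hpoin : HasPoincareInequality X P Y)
    (p : ℝ≥0∞) (hp : ENNReal.ofReal (Q / 2) < p) (α : ℝ) (hα : 0 < α) :
    ∃ C : ℝ≥0, ∀ (β : ℝ), α < β →
      ∀ A : EuclideanSpace ℝ (Fin N) → Matrix (Fin m) (Fin m) ℝ, IsEllipticMatrix Ω A α β →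
      ∀ f : EuclideanSpace ℝ (Fin N) → ℝ, MemLp f p (volume.restrict Ω) →
      ∀ u : EuclideanSpace ℝ (Fin N) → ℝ, IsWeakSolution X Ω A f u →
        MemLp u ∞ (volume.restrict Ω) ∧
        eLpNorm u ∞ (volume.restrict Ω) ≤ C * eLpNorm f p (volume.restrict Ω) := by
  rcases Ω.eq_empty_or_nonempty with rfl | hne
  · exact ⟨0, fun β _ A _ f _ u _ => by simp⟩
  have hXc : ∀ j, Continuous (X j) := fun j => (hX j).continuous
  obtain ⟨q, hq, hqQ, hb⟩ := exists_sobolev_exponent hQ hp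
  obtain ⟨C, hC0, hC⟩ := exists_weak_sobolev (by lia) hX hΩ hΩb hne hY hconn hcomp hdoub hpoin
    hq hqQ
  obtain ⟨c, hc0, hc⟩ := exists_abs_deriv_smoothTransition_le
  have hp1 : 1 ≤ p := by
    refine le_trans ?_ hp.le
    rw [← ENNReal.ofReal_one]
    exact ENNReal.ofReal_le_ofReal (by linarith)
  set μ := volume.restrict Ω with hμ
  have : IsFiniteMeasure μ := ⟨by
    rw [hμ, Measure.restrict_apply_univ]; exact hΩb.measure_lt_top⟩
  set V := μ.real univ
  have hV : 0 < V := by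
    refine ENNReal.toReal_pos ?_ (measure_ne_top μ _)
    rw [hμ, Measure.restrict_apply_univ]
    exact (hΩ.measure_pos volume hne).ne'
  set b := q * (1 - 1 / p.toReal)
  set l : ℝ := 2 ^ (-(q / (b - 1)))
  have hl : 0 < l := by positivity
  set M := C * (32 * c / α) ^ q
  have hM : 0 ≤ M := by positivity
  -- Makes the smallness condition of `eq_zero_of_stampacchia` hold at every height `κ * (F + ε)`;
  -- the `+ 1` keeps `κ` positive.
  set κ := (M * V ^ (b - 1) * 2 ^ q / l + 1) ^ (1 / q)
  have hκ : 0 < κ := by positivity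
  have hκq : M * V ^ (b - 1) * 2 ^ q ≤ l * κ ^ q := by
    rw [← Real.rpow_mul (by positivity), one_div_mul_cancel (by linarith), Real.rpow_one, mul_add,
      mul_div_cancel₀ _ hl.ne']
    linarith
  refine ⟨κ.toNNReal, fun β _ A hA f hf u hu => ?_⟩
  have hu2 : AEStronglyMeasurable u μ := by
    obtain ⟨G, hG, -⟩ := hu
    exact hG.1.aestronglyMeasurable
  set F := (eLpNorm f p μ).toReal
  have hF : 0 ≤ F := ENNReal.toReal_nonneg
  -- The iteration needs a positive height, while `F` may be zero; `ε` is sent to zero along `1 / (n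
  -- + 1)` afterwards.
  have hlevel : ∀ ε > 0, ∀ᵐ x ∂μ, ‖u x‖ ≤ κ * (F + ε) := fun ε hε => by
    have h0 := eq_zero_of_stampacchia (a := fun k => μ.real {x | k < |u x|}) (C := M) (F := F)
      (V := V) (q := q) (b := b) (d := κ * (F + ε)) hV hM hF (by positivity) (by linarith) hb
      (fun _ => measureReal_nonneg)
      (fun k h hkh => measureReal_mono fun x hx => lt_of_le_of_lt hkh hx)
      (measureReal_mono (subset_univ _))
      (fun k h hk hkh => hu.measure_lt_abs_le hXc hΩ hΩb hα hA hc hp1 (by linarith) hC0 hC hf hk hkh)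
      (by
        rw [Real.mul_rpow hκ.le (by positivity)]
        calc M * F ^ q * V ^ (b - 1) * 2 ^ q = M * V ^ (b - 1) * 2 ^ q * F ^ q := by ring
          _ ≤ l * κ ^ q * (F + ε) ^ q := by gcongr; linarith
          _ = _ := by ring)
    rw [measureReal_eq_zero_iff] at h0
    filter_upwards [measure_eq_zero_iff_ae_notMem.1 h0] with x hx
    exact not_lt.1 hx
  have hae : ∀ᵐ x ∂μ, ‖u x‖ ≤ κ * F := by
    have h1 := ae_all_iff.2 fun n : ℕ => hlevel (1 / ((n : ℝ) + 1)) Nat.one_div_pos_of_nat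
    filter_upwards [h1] with x hx
    have h2 : Tendsto (fun n : ℕ => κ * (F + 1 / ((n : ℝ) + 1))) atTop (𝓝 (κ * (F + 0))) :=
      (tendsto_one_div_add_atTop_nhds_zero_nat.const_add F).const_mul κ
    rw [add_zero] at h2
    exact ge_of_tendsto' h2 hx
  refine ⟨memLp_top_of_bound hu2 _ hae, ?_⟩
  rw [eLpNorm_exponent_top]
  refine (eLpNormEssSup_le_of_ae_bound hae).trans_eq ?_
  rw [ENNReal.ofReal_mul hκ.le, ENNReal.ofReal_toReal hf.2.ne]
  rfl
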